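/- Let $n\ge 1$ and let $[g^{jk}(x)]_{j,k=0}^n$, $x\in\mathbb R^n$, be a matrix of real $C^\infty$ functions, independent of the time $x_0$, whose inverse $[g_{jk}(x)]_{j,k=0}^n$ is a Lorentz metric of signature $(1,-1,\dots,-1)$. Assume $g^{00}(x)>0$ for all $x\in\mathbb R^n$ and $g^{jk}(x)-\eta^{jk}=O(1/|x|)$ as $|x|\to\infty$, where $[\eta^{jk}]=\mathrm{diag}(1,-1,\dots,-1)$. Put $g(x)=\det[g_{jk}(x)]$ and consider the wave equation $$\sum_{j,k=0}^n\frac{1}{\sqrt{(-1)^ng(x)}}\frac{\partial}{\partial x_j}\left(\sqrt{(-1)^ng(x)}\,g^{jk}(x)\frac{\partial u(x_0,x)}{\partial x_k}\right)=0. \tag{1}$$ Let $S_0\in C^\infty(\mathbb R^n)$ be real-valued, such that $\{S_0=0\}$ is compact, $\partial S_0/\partial x\neq0$ on $\{S_0=0\}$, and $\Omega_{int}=\{S_0<0\}$ is bounded; let $\Omega_{ext}=\{S_0>0\}$ (so $\partial S_0/\partial x$ is an outward normal to the closed surface $S_0=0$). Assume that for all $x$ with $S_0(x)=0$ $$\sum_{j,k=1}^n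 g^{jk}(x)\frac{\partial S_0}{\partial x_j}(x)\frac{\partial S_0}{\partial x_k}(x)=0,\qquad \sum_{j=1}^n g^{j0}(x)\frac{\partial S_0}{\partial x_j}(x)<0 .$$ By a solution of (1) on $[t_0,T]\times\mathbb R^n$ we mean a real-valued $u\in C([t_0,T];H^1_{loc}(\mathbb R^n))\cap C^1([t_0,T];L^2_{loc}(\mathbb R^n))$ that satisfies (1), multiplied by $\sqrt{(-1)^n g}$, in the sense of distributions on $(t_0,T)\times\mathbb R^n$. Let $\|\cdot\|_{1,\Omega}$ and $\|\cdot\|_{0,\Omega}$ be the norms of $H^1(\Omega)$ and $L^2(\Omega)$, equal to $\infty$ for functions outside the space. Then: 1. For all real $t_0,T$ there is a finite constant $C_T\ge 0$ (depending only on $g^{jk}$, $S_0$, $t_0$, $T$) such that every solution $u$ of (1) on $[t_0,T]\times\mathbb R^n$ satisfies, for all $x_0\in[t_0,T]$, $$\|u(x_0,\cdot)\|_{1,\Omega_{ext}}^2+\|u_{x_0}(x_0,\cdot)\|_{0,\Omega_{ext}}^2\le C_T\left(\|u(t_0,\cdot)\|_{1,\Omega_{ext}}^2+\|u_{x_0}(t_0,\cdot)\|_{0,\Omega_{ext}}^2\right).$$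 2. Consequently, if a solution $u$ of (1) on $[t_0,T]\times\mathbb R^n$ has $u(t_0,\cdot)=u_{x_0}(t_0,\cdot)=0$ almost everywhere in $\Omega_{ext}$ (initial data supported in $\overline\Omega_{int}$), then for every $x_0\in[t_0,T]$ one has $u(x_0,\cdot)=u_{x_0}(x_0,\cdot)=0$ almost everywhere in $\Omega_{ext}$. -/

import Mathlib

open MeasureTheory Set Filter Topology
open scoped ENNReal NNReal ContDiff

noncomputable section

namespace ArtificialBlackHole

/-- The space `ℝⁿ` of the space variables `x = (x₁, …, xₙ)`. -/
abbrev Space (n : ℕ) : Type := EuclideanSpace ℝ (Fin n)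

/-- The partial derivative `∂f/∂x_j` of a function of the space variables. -/
def spacePartial {n : ℕ} (f : Space n → ℝ) (j : Fin n) (x : Space n) : ℝ :=
  fderiv ℝ f x (EuclideanSpace.single j 1)

/-! ### Stationary Lorentz metrics

Space-time indices run over `Fin (n + 1)`: the index `0` is the time `x₀` and the index `j.succ`
is the space coordinate `x_{j+1}`, `j : Fin n`. -/

/-- The Minkowski matrix `η = diag(1, -1, …, -1)`. -/
def minkowski (n : ℕ) : Matrix (Fin (n + 1)) (Fin (n + 1)) ℝ :=
  Matrix.diagonal (Fin.cons 1 (fun _ => -1))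

/-- `A` is (the matrix of) a symmetric bilinear form of signature `(1, -1, …, -1)`: it becomes
`diag(1, -1, …, -1)` in a suitable basis. -/
def HasLorentzSignature {n : ℕ} (A : Matrix (Fin (n + 1)) (Fin (n + 1)) ℝ) : Prop :=
  ∃ P : Matrix (Fin (n + 1)) (Fin (n + 1)) ℝ,
    IsUnit P.det ∧ P.transpose * A * P = minkowski n

/-- `g x` is the contravariant matrix `[g^{jk}(x)]` of a smooth, time-independent Lorentz metric
on `ℝⁿ × ℝ` with `g^{00} > 0`, which is asymptotically flat of order `1/|x|`. The covariant matrix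
`[g_{jk}(x)]` is the inverse matrix `(g x)⁻¹`. -/
structure IsStationaryMetric {n : ℕ}
    (g : Space n → Matrix (Fin (n + 1)) (Fin (n + 1)) ℝ) : Prop where
  smooth : ∀ j k, ContDiff ℝ ∞ (fun x => g x j k)
  lorentz : ∀ x, HasLorentzSignature ((g x)⁻¹)
  time_pos : ∀ x, 0 < g x 0 0
  asymptotic : ∀ j k,
    (fun x => g x j k - minkowski n j k) =O[Bornology.cobounded (Space n)] (fun x => ‖x‖⁻¹)

/-- The density `√((-1)ⁿ g(x))`, where `g(x) = det [g_{jk}(x)]`. -/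
def volDensity {n : ℕ} (g : Space n → Matrix (Fin (n + 1)) (Fin (n + 1)) ℝ) (x : Space n) : ℝ :=
  Real.sqrt ((-1) ^ n * ((g x)⁻¹).det)

/-! ### The surface `S₀ = 0` -/

/-- `S₀ = 0` is a closed bounded smooth surface in `ℝⁿ` whose normal `∂S₀/∂x` does not vanish and
points outward, that is, out of the bounded side `S₀ < 0`. -/
structure IsClosedSurface {n : ℕ} (S₀ : Space n → ℝ) : Prop where
  smooth : ContDiff ℝ ∞ S₀
  isCompact_zero : IsCompact {x | S₀ x = 0}
  isBounded_interior : Bornology.IsBounded {x | S₀ x < 0}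
  normal_ne_zero : ∀ x, S₀ x = 0 → fderiv ℝ S₀ x ≠ 0

/-- The exterior domain `Ω_ext` of the surface `S₀ = 0`. -/
def exterior {n : ℕ} (S₀ : Space n → ℝ) : Set (Space n) := {x | 0 < S₀ x}

/-- The surface `{S₀ = 0} × ℝ` is characteristic:
`∑_{j,k=1}^n g^{jk} S₀_{x_j} S₀_{x_k} = 0` when `S₀ = 0`. -/
def IsCharacteristic {n : ℕ} (g : Space n → Matrix (Fin (n + 1)) (Fin (n + 1)) ℝ)
    (S₀ : Space n → ℝ) : Prop :=
  ∀ x, S₀ x = 0 →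
    ∑ j : Fin n, ∑ k : Fin n,
      g x j.succ k.succ * spacePartial S₀ j x * spacePartial S₀ k x = 0

/-- The black hole sign condition: `∑_{j=1}^n g^{j0} S₀_{x_j} < 0` when `S₀ = 0`. -/
def IsIngoing {n : ℕ} (g : Space n → Matrix (Fin (n + 1)) (Fin (n + 1)) ℝ)
    (S₀ : Space n → ℝ) : Prop :=
  ∀ x, S₀ x = 0 → ∑ j : Fin n, g x j.succ 0 * spacePartial S₀ j x < 0

/-! ### Sobolev norms -/

/-- `w` is the weak gradient of `v` on the open set `Ω`. -/
structure HasWeakGradient {n : ℕ} (Ω : Set (Space n)) (v : Space n → ℝ)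
    (w : Space n → Space n) : Prop where
  locallyIntegrable : LocallyIntegrableOn v Ω
  locallyIntegrable_grad : LocallyIntegrableOn w Ω
  integral_eq : ∀ φ : Space n → ℝ, ContDiff ℝ ∞ φ → HasCompactSupport φ → tsupport φ ⊆ Ω →
    ∀ j : Fin n, ∫ x in Ω, v x * spacePartial φ j x = - ∫ x in Ω, w x j * φ x

/-- The squared norm of `H_0(Ω) = L²(Ω)`. -/
def normSqL2 {n : ℕ} {F : Type*} [NormedAddCommGroup F] (Ω : Set (Space n)) (v : Space n → F) :
    ℝ≥0∞ :=
  (eLpNorm v 2 (volume.restrict Ω)) ^ 2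

/-- The squared norm `‖v‖²_{L²(Ω)} + ‖∇v‖²_{L²(Ω)}` of the Sobolev space `H_1(Ω)`. It is `∞` when
`v ∉ H_1(Ω)`; the weak gradient is unique almost everywhere, so the infimum is over at most one
class of functions. -/
def normSqH1 {n : ℕ} (Ω : Set (Space n)) (v : Space n → ℝ) : ℝ≥0∞ :=
  ⨅ (w : Space n → Space n) (_ : HasWeakGradient Ω v w), normSqL2 Ω v + normSqL2 Ω w

/-! ### Solutions of the wave equation -/

/-- `f ∈ C(I; L²_loc(ℝⁿ; F))`. -/
structure ContinuousL2Loc {n : ℕ} {F : Type*} [NormedAddCommGroup F] (I : Set ℝ)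
    (f : ℝ → Space n → F) : Prop where
  memLp : ∀ t ∈ I, ∀ R : ℝ, MemLp (f t) 2 (volume.restrict (Metric.ball 0 R))
  tendsto : ∀ t ∈ I, ∀ R : ℝ,
    Tendsto (fun s => eLpNorm (f s - f t) 2 (volume.restrict (Metric.ball 0 R))) (𝓝[I] t) (𝓝 0)

/-- `f'` is the time derivative of `f` on `I` in the space `L²_loc(ℝⁿ)`. -/
def HasDerivL2Loc {n : ℕ} (I : Set ℝ) (f f' : ℝ → Space n → ℝ) : Prop :=
  ∀ t ∈ I, ∀ R : ℝ,
    Tendsto (fun s => eLpNorm ((s - t)⁻¹ • (f s - f t) - f' t) 2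
      (volume.restrict (Metric.ball 0 R))) (𝓝[I \ {t}] t) (𝓝 0)

/-- The space-time gradient `(∂φ/∂x₀, ∂φ/∂x₁, …, ∂φ/∂xₙ)` of a function of `(x₀, x)`. -/
def gradSpacetime {n : ℕ} (φ : ℝ × Space n → ℝ) (p : ℝ × Space n) : Fin (n + 1) → ℝ :=
  Fin.cons (fderiv ℝ φ p (1, 0)) (fun j => fderiv ℝ φ p (0, EuclideanSpace.single j 1))

/-- `u` is a solution of the wave equation
`∑_{j,k=0}^n (1/√((-1)ⁿ g)) ∂_j (√((-1)ⁿ g) g^{jk} ∂_k u) = 0` on `[t₀, T] × ℝⁿ` with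
`u ∈ C([t₀, T]; H¹_loc(ℝⁿ)) ∩ C¹([t₀, T]; L²_loc(ℝⁿ))`, and `ut` is its time derivative `u_{x₀}`.
The equation is understood in the sense of distributions on `(t₀, T) × ℝⁿ`; here `Du t` is the
weak gradient of `u t` in the space variables. No condition is imposed as `|x| → ∞`, and every
classical (`C²`) solution is a solution in this sense. -/
def IsSolution {n : ℕ} (g : Space n → Matrix (Fin (n + 1)) (Fin (n + 1)) ℝ) (t₀ T : ℝ)
    (u ut : ℝ → Space n → ℝ) : Prop :=
  ∃ Du : ℝ → Space n → Space n,
    (∀ t ∈ Icc t₀ T, HasWeakGradient univ (u t) (Du t)) ∧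
    ContinuousL2Loc (Icc t₀ T) u ∧
    ContinuousL2Loc (Icc t₀ T) Du ∧
    ContinuousL2Loc (Icc t₀ T) ut ∧
    HasDerivL2Loc (Icc t₀ T) u ut ∧
    ∀ φ : ℝ × Space n → ℝ, ContDiff ℝ ∞ φ → HasCompactSupport φ →
      tsupport φ ⊆ Ioo t₀ T ×ˢ univ →
      ∫ t in Ioo t₀ T, ∫ x, ∑ j : Fin (n + 1), ∑ k : Fin (n + 1),
        volDensity g x * g x j k * (Fin.cons (ut t x) (fun i => Du t x i) : Fin (n + 1) → ℝ) k *
          gradSpacetime φ (t, x) j = 0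

end ArtificialBlackHole

end

/-!
The wave equation is rewritten as a first order system in time. With `a^{jk} = √((-1)ⁿ g) g^{jk}`
and the momentum `m = a^{00} u_t + a^{0k} ∂_k u` it reads
`u_t = b m + N·∇u`, `m_t = div (N m + e ∇u)`, where `b = 1 / a^{00}` and the matrix `e` is
positive definite by the reversed Cauchy–Schwarz inequality for Lorentz forms.

The estimate is an energy estimate with the multiplier `∂_t - (1 - ψ) N·∇`. Near the hole `ψ = 0`:
this is the normal multiplier, whose energy is positive definite even where `∂_t` is not timelike.
Near infinity `ψ = 1`: this is the Killing field `∂_t`, whose bulk term contains no derivatives of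
the coefficients. That matters because no decay of the derivatives of the metric is assumed, and
there the energy of `∂_t` is positive since the metric is close to the flat one.
`exists_isAdmissible` provides such a `ψ`, and `energyPolar_rhs_eq` is the local energy identity.

The surface `S₀ = 0` is characteristic and the field `N` crosses it in the outward direction, so
the energy flux through the level sets of `S₀` has the favourable sign up to an error `O(S₀)`
(`flux_nonneg_waveCoeff`). Cutting off with `σ(S₀ / η)` gives a boundary term that is bounded below
by `-C (S₀ / η) σ'(S₀ / η)`, whose integral tends to zero with `η`. A cut-off to a shrinking cone
deals with infinity, by finite speed of propagation, and a weight `exp (-Λ t)` absorbs the bulk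
terms (`weighted_form_le`). This gives `WaveCoeff.IsAdmissible.energy_estimate` for regular
functions, up to a residual.

A solution is only in `H¹`, so it is mollified in space. The residuals are Friedrichs commutators of
the coefficients with the mollifier, and these tend to zero in `L²` (`tendsto_commutatorPartial`,
`IsWeakSystem.residual_eq`), which gives `WaveCoeff.IsAdmissible.weak_energy_estimate`. The
distributional equation is turned into a differential equation in time for integrals against test
functions of `x` by `hasDerivAt_of_weak_deriv` (`isWeakSystem_of_isSolution`). Finally the norm of
the first order state is uniformly equivalent to that of `(u, u_t, ∇u)`
(`WaveCoeff.IsAdmissible.exists_velocityForm_bounds`), and domain of dependence is the estimate with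
zero right hand side.
-/

open MeasureTheory Set Filter Topology
open scoped ENNReal NNReal ContDiff

noncomputable section

namespace ArtificialBlackHole

/-! ### Quadratic forms depending on a parameter -/

/-- A function that is continuous in a parameter and homogeneous of degree two in the variable is
bounded by the squared norm, uniformly for the parameter in a compact set. -/
theorem exists_abs_le_of_homogeneous {X E : Type*} [TopologicalSpace X] [NormedAddCommGroup E]
    [NormedSpace ℝ E] [ProperSpace E] {K : Set X} (hK : IsCompact K) {f : X → E → ℝ}
    (hf : Continuous (Function.uncurry f))
    (hom : ∀ x (s : ℝ) z, f x (s • z) = s ^ 2 * f x z) :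
    ∃ C, 0 ≤ C ∧ ∀ x ∈ K, ∀ z, |f x z| ≤ C * ‖z‖ ^ 2 := by
  obtain ⟨C, hC⟩ := (hK.prod (isCompact_sphere (0 : E) 1)).exists_bound_of_continuousOn
    hf.continuousOn
  refine ⟨max C 0, le_max_right _ _, fun x hx z => ?_⟩
  rcases eq_or_ne z 0 with rfl | hz
  · have := hom x 0 0
    simp at this
    simp [this]
  · have hz' : ‖z‖ ≠ 0 := norm_ne_zero_iff.2 hz
    have h1 : f x z = ‖z‖ ^ 2 * f x (‖z‖⁻¹ • z) := by
      rw [hom]; field_simp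
    have h2 : |f x (‖z‖⁻¹ • z)| ≤ C := hC (x, ‖z‖⁻¹ • z) ⟨hx, by
      simp [norm_smul, hz']⟩
    rw [h1, abs_mul, abs_of_nonneg (by positivity), mul_comm]
    gcongr
    exact h2.trans (le_max_left _ _)

/-- A form as in `exists_abs_le_of_homogeneous` that is positive definite for every parameter in a
compact set is uniformly positive definite there. -/
theorem exists_le_of_homogeneous {X E : Type*} [TopologicalSpace X] [NormedAddCommGroup E]
    [NormedSpace ℝ E] [ProperSpace E] {K : Set X} (hK : IsCompact K) {f : X → E → ℝ}
    (hf : Continuous (Function.uncurry f))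
    (hom : ∀ x (s : ℝ) z, f x (s • z) = s ^ 2 * f x z)
    (hpos : ∀ x ∈ K, ∀ z, z ≠ 0 → 0 < f x z) :
    ∃ c, 0 < c ∧ ∀ x ∈ K, ∀ z, c * ‖z‖ ^ 2 ≤ f x z := by
  have key : ∃ c, 0 < c ∧ ∀ p ∈ K ×ˢ Metric.sphere (0 : E) 1, c ≤ f p.1 p.2 := by
    rcases (K ×ˢ Metric.sphere (0 : E) 1).eq_empty_or_nonempty with h | h
    · exact ⟨1, one_pos, by simp [h]⟩
    · obtain ⟨p, hp, hmin⟩ := (hK.prod (isCompact_sphere (0 : E) 1)).exists_isMinOn h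
        hf.continuousOn
      refine ⟨f p.1 p.2, hpos _ hp.1 _ ?_, fun q hq => hmin hq⟩
      intro h0
      have := hp.2
      simp [h0] at this
  obtain ⟨c, hc, hle⟩ := key
  refine ⟨c, hc, fun x hx z => ?_⟩
  rcases eq_or_ne z 0 with rfl | hz
  · have := hom x 0 0
    simp at this
    simp [this]
  · have hz' : ‖z‖ ≠ 0 := norm_ne_zero_iff.2 hz
    have h1 : f x z = ‖z‖ ^ 2 * f x (‖z‖⁻¹ • z) := by
      rw [hom]; field_simp
    rw [h1, mul_comm]
    gcongr
    exact hle (x, ‖z‖⁻¹ • z) ⟨hx, by simp [norm_smul, hz']⟩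

/-! ### Functions that vanish on a regular level set -/

/-- A `C¹` function that vanishes on a level set `S = 0` is `O(S)` near a regular point of it: from
a nearby point with `S > 0` one reaches the level set along a transversal segment whose length is
comparable to `S`. -/
theorem exists_abs_le_mul_of_eq_zero {E : Type*} [NormedAddCommGroup E] [NormedSpace ℝ E]
    {S f : E → ℝ} (hS : ContDiff ℝ 1 S) (hf : ContDiff ℝ 1 f) (h0 : ∀ x, S x = 0 → f x = 0)
    {x₀ : E} (hx₀ : S x₀ = 0) (hd : fderiv ℝ S x₀ ≠ 0) :
    ∃ C, 0 ≤ C ∧ ∀ᶠ x in 𝓝 x₀, 0 < S x → |f x| ≤ C * S x := by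
  obtain ⟨v, hv⟩ : ∃ v, fderiv ℝ S x₀ v = 1 := by
    obtain ⟨w, hw⟩ : ∃ w, fderiv ℝ S x₀ w ≠ 0 := by
      by_contra! h
      exact hd (by ext w; simpa using h w)
    exact ⟨(fderiv ℝ S x₀ w)⁻¹ • w, by simp [hw]⟩
  have cS : Continuous fun y => fderiv ℝ S y v :=
    (hS.continuous_fderiv one_ne_zero).clm_apply continuous_const
  have cf : Continuous fun y => fderiv ℝ f y v :=
    (hf.continuous_fderiv one_ne_zero).clm_apply continuous_const
  set L := |fderiv ℝ f x₀ v| + 1 with hL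
  have e1 : ∀ᶠ y in 𝓝 x₀, 1 / 2 < fderiv ℝ S y v :=
    cS.continuousAt.eventually (lt_mem_nhds (by norm_num [hv]))
  have e2 : ∀ᶠ y in 𝓝 x₀, |fderiv ℝ f y v| < L :=
    cf.abs.continuousAt.eventually (gt_mem_nhds (by simp [hL]))
  obtain ⟨r, hr, hball⟩ := Metric.eventually_nhds_iff_ball.1 (e1.and e2)
  have e3 : ∀ᶠ x in 𝓝 x₀, 2 * S x * ‖v‖ < r / 2 := by
    have : Continuous fun x => 2 * S x * ‖v‖ := by have := hS.continuous; fun_prop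
    exact this.continuousAt.eventually (gt_mem_nhds (by simp [hx₀, hr]))
  refine ⟨2 * L, by positivity, ?_⟩
  filter_upwards [e3, Metric.ball_mem_nhds x₀ (half_pos hr)] with x hx hxb hpos
  set s := S x with hs
  have hmem : ∀ τ ∈ Icc 0 (2 * s), x - τ • v ∈ Metric.ball x₀ r := by
    intro τ hτ
    have h1 : dist (x - τ • v) x ≤ 2 * s * ‖v‖ := by
      rw [dist_eq_norm]
      simp only [sub_sub_cancel_left, norm_neg, norm_smul, Real.norm_eq_abs, abs_of_nonneg hτ.1]
      gcongr
      exact hτ.2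
    have := dist_triangle (x - τ • v) x x₀
    have h2 : dist x x₀ < r / 2 := hxb
    simp only [Metric.mem_ball]
    linarith
  have hline : ∀ τ : ℝ, HasDerivAt (fun τ : ℝ => x - τ • v) (-v) τ := fun τ => by
    simpa using ((hasDerivAt_id τ).smul_const v).const_sub x
  have dS : ∀ τ : ℝ, HasDerivAt (fun τ : ℝ => S (x - τ • v)) (-(fderiv ℝ S (x - τ • v) v)) τ :=
    fun τ => by
      have := ((hS.differentiable one_ne_zero (x - τ • v)).hasFDerivAt).comp_hasDerivAt τ (hline τ)
      rw [map_neg] at this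
      exact this
  have df : ∀ τ : ℝ, HasDerivAt (fun τ : ℝ => f (x - τ • v)) (-(fderiv ℝ f (x - τ • v) v)) τ :=
    fun τ => by
      have := ((hf.differentiable one_ne_zero (x - τ • v)).hasFDerivAt).comp_hasDerivAt τ (hline τ)
      rw [map_neg] at this
      exact this
  have hend : S (x - (2 * s) • v) ≤ 0 := by
    have := (convex_Icc 0 (2 * s)).image_sub_le_mul_sub_of_deriv_le (C := -(1 / 2))
      (f := fun τ : ℝ => S (x - τ • v))
      (fun τ _ => (dS τ).continuousAt.continuousWithinAt)
      (fun τ _ => (dS τ).differentiableAt.differentiableWithinAt)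
      (fun τ hτ => by
        rw [(dS τ).deriv]
        have := (hball _ (hmem τ (interior_subset hτ))).1
        linarith) 0 ⟨le_rfl, by linarith⟩ (2 * s) ⟨by linarith, le_rfl⟩ (by linarith)
    simp only [zero_smul, sub_zero] at this
    linarith
  obtain ⟨τ, hτ, hτ0⟩ : ∃ τ ∈ Icc 0 (2 * s), S (x - τ • v) = 0 := by
    have := intermediate_value_Icc' (by linarith : (0 : ℝ) ≤ 2 * s)
      (f := fun τ : ℝ => S (x - τ • v)) (fun τ _ => (dS τ).continuousAt.continuousWithinAt)
    obtain ⟨τ, hτ, h⟩ := this ⟨hend, by simpa using hpos.le⟩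
    exact ⟨τ, hτ, h⟩
  have hle := (convex_Icc 0 (2 * s)).norm_image_sub_le_of_norm_hasDerivWithin_le (C := L)
    (f := fun τ : ℝ => f (x - τ • v))
    (fun τ _ => (df τ).hasDerivWithinAt)
    (fun τ hτ => by
      rw [norm_neg, Real.norm_eq_abs]
      exact (hball _ (hmem τ hτ)).2.le) hτ ⟨le_rfl, by linarith⟩
  simp only [zero_smul, sub_zero, h0 _ hτ0, zero_sub, norm_neg, Real.norm_eq_abs,
    abs_of_nonneg hτ.1] at hle
  calc |f x| ≤ L * τ := hle
    _ ≤ L * (2 * s) := by gcongr; exact hτ.2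
    _ = 2 * L * s := by ring

/-! ### The smooth step function -/

theorem differentiable_smoothTransition : Differentiable ℝ Real.smoothTransition :=
  (Real.smoothTransition.contDiff (n := 1)).differentiable one_ne_zero

theorem continuous_deriv_smoothTransition : Continuous (deriv Real.smoothTransition) :=
  (Real.smoothTransition.contDiff (n := 1)).continuous_deriv le_rfl

theorem deriv_smoothTransition_nonneg (s : ℝ) : 0 ≤ deriv Real.smoothTransition s :=
  Real.smoothTransition.monotone.deriv_nonneg

theorem deriv_smoothTransition_of_nonpos {s : ℝ} (hs : s ≤ 0) :
    deriv Real.smoothTransition s = 0 := by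
  have h : IsLocalMin Real.smoothTransition s := by
    filter_upwards with y
    rw [Real.smoothTransition.zero_of_nonpos hs]
    exact Real.smoothTransition.nonneg y
  exact h.deriv_eq_zero

theorem deriv_smoothTransition_of_one_le {s : ℝ} (hs : 1 ≤ s) :
    deriv Real.smoothTransition s = 0 := by
  have h : IsLocalMax Real.smoothTransition s := by
    filter_upwards with y
    rw [Real.smoothTransition.one_of_one_le hs]
    exact Real.smoothTransition.le_one y
  exact h.deriv_eq_zero

theorem exists_mul_deriv_smoothTransition_le :
    ∃ C, 0 ≤ C ∧ ∀ s, |s * deriv Real.smoothTransition s| ≤ C := by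
  obtain ⟨C, hC⟩ := (isCompact_Icc (a := (0 : ℝ)) (b := 1)).exists_bound_of_continuousOn
    (continuous_id.mul continuous_deriv_smoothTransition).continuousOn
  refine ⟨max C 0, le_max_right _ _, fun s => ?_⟩
  rcases le_total s 0 with h | h
  · simp [deriv_smoothTransition_of_nonpos h]
  rcases le_total 1 s with h1 | h1
  · simp [deriv_smoothTransition_of_one_le h1]
  · exact (hC s ⟨h, h1⟩).trans (le_max_left _ _)

/-! ### Partial derivatives -/

section Partial

variable {n : ℕ} {f h : Space n → ℝ} {x : Space n}

theorem spacePartial_add (hf : DifferentiableAt ℝ f x) (hh : DifferentiableAt ℝ h x) (j : Fin n) :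
    spacePartial (fun y => f y + h y) j x = spacePartial f j x + spacePartial h j x := by
  simp [spacePartial, fderiv_fun_add hf hh]

theorem spacePartial_sub (hf : DifferentiableAt ℝ f x) (hh : DifferentiableAt ℝ h x) (j : Fin n) :
    spacePartial (fun y => f y - h y) j x = spacePartial f j x - spacePartial h j x := by
  simp [spacePartial, fderiv_fun_sub hf hh]

theorem spacePartial_mul (hf : DifferentiableAt ℝ f x) (hh : DifferentiableAt ℝ h x) (j : Fin n) :
    spacePartial (fun y => f y * h y) j x = spacePartial f j x * h x + f x * spacePartial h j x := by
  simp [spacePartial, fderiv_fun_mul hf hh]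
  ring

theorem spacePartial_const_mul (hf : DifferentiableAt ℝ f x) (c : ℝ) (j : Fin n) :
    spacePartial (fun y => c * f y) j x = c * spacePartial f j x := by
  simp [spacePartial, fderiv_const_mul hf]

theorem spacePartial_sum {ι : Type*} {s : Finset ι} {F : ι → Space n → ℝ}
    (hF : ∀ i ∈ s, DifferentiableAt ℝ (F i) x) (j : Fin n) :
    spacePartial (fun y => ∑ i ∈ s, F i y) j x = ∑ i ∈ s, spacePartial (F i) j x := by
  simp [spacePartial, fderiv_fun_sum hF]

theorem continuous_spacePartial (hf : ContDiff ℝ 1 f) (j : Fin n) :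
    Continuous (spacePartial f j) :=
  (hf.continuous_fderiv one_ne_zero).clm_apply continuous_const

theorem contDiff_spacePartial (hf : ContDiff ℝ ∞ f) (j : Fin n) :
    ContDiff ℝ ∞ (spacePartial f j) :=
  (hf.fderiv_right (by norm_cast)).clm_apply contDiff_const

theorem spacePartial_comm (hf : ContDiff ℝ 2 f) (i j : Fin n) (x : Space n) :
    spacePartial (spacePartial f i) j x = spacePartial (spacePartial f j) i x := by
  have hd : DifferentiableAt ℝ (fderiv ℝ f) x :=
    (hf.fderiv_right (m := 1) (by norm_num)).differentiable one_ne_zero x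
  have hsymm : IsSymmSndFDerivAt ℝ f x := hf.contDiffAt.isSymmSndFDerivAt (by simp)
  have key : ∀ i j : Fin n, spacePartial (spacePartial f i) j x =
      fderiv ℝ (fderiv ℝ f) x (EuclideanSpace.single j 1) (EuclideanSpace.single i 1) := by
    intro i j
    have : spacePartial f i = fun y => fderiv ℝ f y (EuclideanSpace.single i 1) := rfl
    rw [this, spacePartial, fderiv_clm_apply hd (differentiableAt_const _)]
    simp
  rw [key, key]
  exact hsymm _ _

theorem integral_spacePartial_eq_zero (hf : ContDiff ℝ 1 f) (hc : HasCompactSupport f)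
    (j : Fin n) : ∫ x, spacePartial f j x = 0 := by
  have hc' : HasCompactSupport (spacePartial f j) :=
    (hc.fderiv (𝕜 := ℝ)).comp_left (g := fun L : Space n →L[ℝ] ℝ =>
      L (EuclideanSpace.single j 1)) (by simp)
  have := integral_mul_fderiv_eq_neg_fderiv_mul_of_integrable (μ := (volume : Measure (Space n)))
    (f := fun _ => (1 : ℝ)) (g := f) (v := EuclideanSpace.single j 1) (by simp)
    (by
      simp only [one_mul]
      exact (continuous_spacePartial hf j).integrable_of_hasCompactSupport hc')
    (by simpa using hf.continuous.integrable_of_hasCompactSupport hc)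
    (fun _ _ => differentiableAt_const _) (fun _ _ => hf.differentiable one_ne_zero _)
  simpa [spacePartial] using this

end Partial

/-! ### Energy, flux and their algebra -/

/-- The values at one point of the coefficients `(b, N, e, ψ)`: the first order system is
`u_t = b m + N·∇u`, `m_t = div (N m + e ∇u)`, and `ψ` interpolates between the multipliers
`∂_t - N·∇` (`ψ = 0`) and `∂_t` (`ψ = 1`). -/
abbrev CoeffValue (n : ℕ) : Type := ℝ × (Fin n → ℝ) × (Fin n → Fin n → ℝ) × ℝ

/-- The values at one point of the unknowns `(u, m, ∇u)` of the first order system. -/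
abbrev State (n : ℕ) : Type := ℝ × ℝ × (Fin n → ℝ)

section Algebra

variable {n : ℕ}

/-- The vector `e ∇u`. -/
def ellipticPart (c : CoeffValue n) (z : State n) (j : Fin n) : ℝ := ∑ k, c.2.2.1 j k * z.2.2 k

/-- The derivative `N·∇u` along the shift. -/
def shiftDeriv (c : CoeffValue n) (z : State n) : ℝ := ∑ j, c.2.1 j * z.2.2 j

/-- The time derivative `b m + N·∇u` of `u` prescribed by the system. -/
def velocity (c : CoeffValue n) (z : State n) : ℝ := c.1 * z.2.1 + shiftDeriv c z

/-- The vector field `N m + e ∇u` whose divergence is the time derivative of `m`. -/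
def momentumFlux (c : CoeffValue n) (z : State n) (j : Fin n) : ℝ :=
  c.2.1 j * z.2.1 + ellipticPart c z j

/-- The energy density `(b m² + e ∇u·∇u) / 2` of the multiplier `∂_t - N·∇`. -/
def normalEnergy (c : CoeffValue n) (z : State n) : ℝ :=
  (c.1 * z.2.1 ^ 2 + ∑ j, ellipticPart c z j * z.2.2 j) / 2

/-- The energy density of the multiplier `∂_t - (1 - ψ) N·∇`, with a zeroth order term. -/
def energy (c : CoeffValue n) (z : State n) : ℝ :=
  z.1 ^ 2 / 2 + normalEnergy c z + c.2.2.2 * (z.2.1 * shiftDeriv c z)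

/-- The energy flux of the multiplier `∂_t - N·∇`. -/
def normalFlux (c : CoeffValue n) (z : State n) (j : Fin n) : ℝ :=
  c.1 * z.2.1 * ellipticPart c z j + c.2.1 j * normalEnergy c z

/-- The energy flux of the multiplier `∂_t`. -/
def killingFlux (c : CoeffValue n) (z : State n) (j : Fin n) : ℝ :=
  velocity c z * momentumFlux c z j

/-- The energy flux belonging to `energy`. -/
def flux (c : CoeffValue n) (z : State n) (j : Fin n) : ℝ :=
  (1 - c.2.2.2) * normalFlux c z j + c.2.2.2 * killingFlux c z j

/-- The symmetric bilinear form with `energyPolar c z z = 2 * energy c z`. -/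
def energyPolar (c : CoeffValue n) (z ζ : State n) : ℝ :=
  z.1 * ζ.1 + c.1 * z.2.1 * ζ.2.1 + ∑ j, ellipticPart c z j * ζ.2.2 j +
    c.2.2.2 * (ζ.2.1 * shiftDeriv c z + z.2.1 * shiftDeriv c ζ)

theorem ellipticPart_symm {c : CoeffValue n} (hc : ∀ j k, c.2.2.1 j k = c.2.2.1 k j)
    (z ζ : State n) :
    ∑ j, ellipticPart c z j * ζ.2.2 j = ∑ j, ellipticPart c ζ j * z.2.2 j := by
  simp only [ellipticPart, Finset.sum_mul]
  rw [Finset.sum_comm]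
  refine Finset.sum_congr rfl fun k _ => Finset.sum_congr rfl fun j _ => ?_
  rw [hc j k]; ring

theorem energyPolar_add (c : CoeffValue n) (z ζ ξ : State n) :
    energyPolar c z (ζ + ξ) = energyPolar c z ζ + energyPolar c z ξ := by
  simp only [energyPolar, shiftDeriv, Prod.fst_add, Prod.snd_add, Pi.add_apply, mul_add,
    Finset.sum_add_distrib]
  ring

theorem ellipticPart_smul (c : CoeffValue n) (s : ℝ) (z : State n) (j : Fin n) :
    ellipticPart c (s • z) j = s * ellipticPart c z j := by
  simp only [ellipticPart, Finset.mul_sum, Prod.smul_snd, Pi.smul_apply, smul_eq_mul]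
  exact Finset.sum_congr rfl fun _ _ => by ring

theorem shiftDeriv_smul (c : CoeffValue n) (s : ℝ) (z : State n) :
    shiftDeriv c (s • z) = s * shiftDeriv c z := by
  simp only [shiftDeriv, Finset.mul_sum, Prod.smul_snd, Pi.smul_apply, smul_eq_mul]
  exact Finset.sum_congr rfl fun _ _ => by ring

theorem velocity_smul (c : CoeffValue n) (s : ℝ) (z : State n) :
    velocity c (s • z) = s * velocity c z := by
  simp only [velocity, shiftDeriv_smul, Prod.smul_snd, Prod.smul_fst, smul_eq_mul]
  ring

theorem momentumFlux_smul (c : CoeffValue n) (s : ℝ) (z : State n) (j : Fin n) :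
    momentumFlux c (s • z) j = s * momentumFlux c z j := by
  simp only [momentumFlux, ellipticPart_smul, Prod.smul_snd, Prod.smul_fst, smul_eq_mul]
  ring

theorem normalEnergy_smul (c : CoeffValue n) (s : ℝ) (z : State n) :
    normalEnergy c (s • z) = s ^ 2 * normalEnergy c z := by
  have : ∑ j, ellipticPart c (s • z) j * (s • z).2.2 j =
      s ^ 2 * ∑ j, ellipticPart c z j * z.2.2 j := by
    rw [Finset.mul_sum]
    refine Finset.sum_congr rfl fun _ _ => ?_
    rw [ellipticPart_smul]
    simp only [Prod.smul_snd, Pi.smul_apply, smul_eq_mul]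
    ring
  rw [normalEnergy, this]
  simp only [normalEnergy, Prod.smul_snd, Prod.smul_fst, smul_eq_mul]
  ring

theorem energy_smul (c : CoeffValue n) (s : ℝ) (z : State n) :
    energy c (s • z) = s ^ 2 * energy c z := by
  simp only [energy, normalEnergy_smul, shiftDeriv_smul, Prod.smul_snd, Prod.smul_fst, smul_eq_mul]
  ring

theorem normalFlux_smul (c : CoeffValue n) (s : ℝ) (z : State n) (j : Fin n) :
    normalFlux c (s • z) j = s ^ 2 * normalFlux c z j := by
  simp only [normalFlux, normalEnergy_smul, ellipticPart_smul, Prod.smul_snd, Prod.smul_fst,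
    smul_eq_mul]
  ring

theorem killingFlux_smul (c : CoeffValue n) (s : ℝ) (z : State n) (j : Fin n) :
    killingFlux c (s • z) j = s ^ 2 * killingFlux c z j := by
  simp only [killingFlux, velocity_smul, momentumFlux_smul]
  ring

theorem flux_smul (c : CoeffValue n) (s : ℝ) (z : State n) (j : Fin n) :
    flux c (s • z) j = s ^ 2 * flux c z j := by
  simp only [flux, normalFlux_smul, killingFlux_smul]
  ring

theorem energyPolar_smul (c : CoeffValue n) (s : ℝ) (z ζ : State n) :
    energyPolar c (s • z) (s • ζ) = s ^ 2 * energyPolar c z ζ := by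
  have : ∑ j, ellipticPart c (s • z) j * (s • ζ).2.2 j =
      s ^ 2 * ∑ j, ellipticPart c z j * ζ.2.2 j := by
    rw [Finset.mul_sum]
    refine Finset.sum_congr rfl fun _ _ => ?_
    rw [ellipticPart_smul]
    simp only [Prod.smul_snd, Pi.smul_apply, smul_eq_mul]
    ring
  rw [energyPolar, this]
  simp only [energyPolar, shiftDeriv_smul, Prod.smul_snd, Prod.smul_fst, smul_eq_mul]
  ring

section Continuity

variable {X : Type*} [TopologicalSpace X] {c : X → CoeffValue n} {z ζ : X → State n}

theorem continuous_ellipticPart (hc : Continuous c) (hz : Continuous z) (j : Fin n) :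
    Continuous fun x => ellipticPart (c x) (z x) j := by
  unfold ellipticPart; fun_prop

theorem continuous_shiftDeriv (hc : Continuous c) (hz : Continuous z) :
    Continuous fun x => shiftDeriv (c x) (z x) := by
  unfold shiftDeriv; fun_prop

theorem continuous_normalEnergy (hc : Continuous c) (hz : Continuous z) :
    Continuous fun x => normalEnergy (c x) (z x) := by
  have := continuous_ellipticPart hc hz
  unfold normalEnergy; fun_prop

theorem continuous_energy (hc : Continuous c) (hz : Continuous z) :
    Continuous fun x => energy (c x) (z x) := by
  have := continuous_normalEnergy hc hz
  have := continuous_shiftDeriv hc hz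
  unfold energy; fun_prop

theorem continuous_normalFlux (hc : Continuous c) (hz : Continuous z) (j : Fin n) :
    Continuous fun x => normalFlux (c x) (z x) j := by
  have := continuous_normalEnergy hc hz
  have := continuous_ellipticPart hc hz
  unfold normalFlux; fun_prop

theorem continuous_velocity (hc : Continuous c) (hz : Continuous z) :
    Continuous fun x => velocity (c x) (z x) := by
  have := continuous_shiftDeriv hc hz
  unfold velocity; fun_prop

theorem continuous_momentumFlux (hc : Continuous c) (hz : Continuous z) (j : Fin n) :
    Continuous fun x => momentumFlux (c x) (z x) j := by
  have := continuous_ellipticPart hc hz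
  unfold momentumFlux; fun_prop

theorem continuous_killingFlux (hc : Continuous c) (hz : Continuous z) (j : Fin n) :
    Continuous fun x => killingFlux (c x) (z x) j := by
  have := continuous_velocity hc hz
  have := continuous_momentumFlux hc hz
  unfold killingFlux; fun_prop

theorem continuous_flux (hc : Continuous c) (hz : Continuous z) (j : Fin n) :
    Continuous fun x => flux (c x) (z x) j := by
  have := continuous_normalFlux hc hz
  have := continuous_killingFlux hc hz
  unfold flux; fun_prop

theorem continuous_energyPolar (hc : Continuous c) (hz : Continuous z) (hζ : Continuous ζ) :
    Continuous fun x => energyPolar (c x) (z x) (ζ x) := by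
  have := continuous_ellipticPart hc hz
  have := continuous_shiftDeriv hc hz
  have := continuous_shiftDeriv hc hζ
  unfold energyPolar; fun_prop

end Continuity

theorem hasDerivAt_energy {c : CoeffValue n} (hc : ∀ j k, c.2.2.1 j k = c.2.2.1 k j)
    {z : ℝ → State n} {ζ : State n} {t : ℝ} (hu : HasDerivAt (fun s => (z s).1) ζ.1 t)
    (hm : HasDerivAt (fun s => (z s).2.1) ζ.2.1 t)
    (hp : ∀ j, HasDerivAt (fun s => (z s).2.2 j) (ζ.2.2 j) t) :
    HasDerivAt (fun s => energy c (z s)) (energyPolar c (z t) ζ) t := by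
  have hA : ∀ j, HasDerivAt (fun s => ellipticPart c (z s) j) (ellipticPart c ζ j) t := fun j =>
    HasDerivAt.fun_sum fun k _ => (hp k).const_mul _
  have hS : HasDerivAt (fun s => shiftDeriv c (z s)) (shiftDeriv c ζ) t :=
    HasDerivAt.fun_sum fun k _ => (hp k).const_mul _
  have h := (((hu.fun_pow 2).div_const 2).fun_add ((((hm.fun_pow 2).const_mul c.1).fun_add
    (HasDerivAt.fun_sum fun j (_ : j ∈ Finset.univ) => (hA j).fun_mul (hp j))).div_const 2)).fun_add
    ((hm.fun_mul hS).const_mul c.2.2.2)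
  refine (h.congr_deriv ?_)
  have := ellipticPart_symm hc (z t) ζ
  simp only [energyPolar, Finset.sum_add_distrib, ← this]
  push_cast
  ring

end Algebra

/-! ### Coefficient fields and the divergence identity -/

/-- Coefficients `b`, `N`, `e` of the first order system `u_t = b m + N·∇u`,
`m_t = div (N m + e ∇u)` and the interpolating function `ψ`. -/
structure WaveCoeff (n : ℕ) where
  /-- the coefficient of `m` in `u_t` -/
  b : Space n → ℝ
  /-- the shift vector field -/
  N : Fin n → Space n → ℝ
  /-- the matrix of the elliptic part -/
  e : Fin n → Fin n → Space n → ℝ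
  /-- the weight of the multiplier `∂_t` -/
  ψ : Space n → ℝ

/-- The value of all coefficients at a point. -/
def WaveCoeff.val {n : ℕ} (a : WaveCoeff n) (x : Space n) : CoeffValue n :=
  (a.b x, fun j => a.N j x, fun j k => a.e j k x, a.ψ x)

/-- Smoothness of the coefficients and symmetry of the elliptic part. -/
structure WaveCoeff.IsSmooth {n : ℕ} (a : WaveCoeff n) : Prop where
  b : ContDiff ℝ ∞ a.b
  N : ∀ j, ContDiff ℝ ∞ (a.N j)
  e : ∀ j k, ContDiff ℝ ∞ (a.e j k)
  ψ : ContDiff ℝ ∞ a.ψ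
  symm : ∀ j k x, a.e j k x = a.e k j x

section Divergence

variable {n : ℕ} (a : WaveCoeff n)

/-- The quadratic form in `(m, ∇u)` produced by the derivatives of the coefficients in the energy
identity of the multiplier `∂_t - N·∇`. -/
def normalBulk (x : Space n) (z : State n) : ℝ :=
  ∑ j, (spacePartial (a.N j) j x * (a.b x * z.2.1 ^ 2 - normalEnergy (a.val x) z)
    - a.N j x * spacePartial a.b j x * z.2.1 ^ 2 / 2
    - a.N j x * (∑ k, (∑ l, spacePartial (a.e k l) j x * z.2.2 l) * z.2.2 k) / 2
    + ellipticPart (a.val x) z j * ∑ l, spacePartial (a.N l) j x * z.2.2 l)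

/-- The bulk term of the energy identity; it vanishes where `ψ` is locally equal to `1`. -/
def bulk (x : Space n) (z : State n) : ℝ :=
  (1 - a.ψ x) * normalBulk a x z
    + ∑ j, spacePartial a.ψ j x * (normalFlux (a.val x) z j - killingFlux (a.val x) z j)

theorem bulk_smul (x : Space n) (s : ℝ) (z : State n) :
    bulk a x (s • z) = s ^ 2 * bulk a x z := by
  have h1 : normalBulk a x (s • z) = s ^ 2 * normalBulk a x z := by
    rw [normalBulk, normalBulk, Finset.mul_sum]
    refine Finset.sum_congr rfl fun j _ => ?_
    have e1 : ∀ k, ∑ l, spacePartial (a.e k l) j x * (s • z).2.2 l =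
        s * ∑ l, spacePartial (a.e k l) j x * z.2.2 l := fun k => by
      rw [Finset.mul_sum]
      refine Finset.sum_congr rfl fun l _ => ?_
      simp only [Prod.smul_snd, Pi.smul_apply, smul_eq_mul]; ring
    have e2 : ∑ k, (∑ l, spacePartial (a.e k l) j x * (s • z).2.2 l) * (s • z).2.2 k =
        s ^ 2 * ∑ k, (∑ l, spacePartial (a.e k l) j x * z.2.2 l) * z.2.2 k := by
      rw [Finset.mul_sum]
      refine Finset.sum_congr rfl fun k _ => ?_
      rw [e1]
      simp only [Prod.smul_snd, Pi.smul_apply, smul_eq_mul]; ring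
    have e3 : ∑ l, spacePartial (a.N l) j x * (s • z).2.2 l =
        s * ∑ l, spacePartial (a.N l) j x * z.2.2 l := by
      rw [Finset.mul_sum]
      refine Finset.sum_congr rfl fun l _ => ?_
      simp only [Prod.smul_snd, Pi.smul_apply, smul_eq_mul]; ring
    rw [e2, e3, normalEnergy_smul, ellipticPart_smul]
    simp only [Prod.smul_snd, Prod.smul_fst, smul_eq_mul]; ring
  have h2 : ∑ j, spacePartial a.ψ j x *
        (normalFlux (a.val x) (s • z) j - killingFlux (a.val x) (s • z) j) =
      s ^ 2 * ∑ j, spacePartial a.ψ j x *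
        (normalFlux (a.val x) z j - killingFlux (a.val x) z j) := by
    rw [Finset.mul_sum]
    refine Finset.sum_congr rfl fun j _ => ?_
    rw [normalFlux_smul, killingFlux_smul]; ring
  rw [bulk, bulk, h1, h2]; ring

variable {a}

theorem WaveCoeff.IsSmooth.continuous_val (ha : a.IsSmooth) : Continuous a.val := by
  have h1 := ha.b.continuous
  have h2 := fun j => (ha.N j).continuous
  have h3 := fun j k => (ha.e j k).continuous
  have h4 := ha.ψ.continuous
  unfold WaveCoeff.val
  fun_prop

theorem continuous_bulk (ha : a.IsSmooth) : Continuous (Function.uncurry (bulk a)) := by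
  have hv := ha.continuous_val.comp (continuous_fst (X := Space n) (Y := State n))
  have hz := continuous_snd (X := Space n) (Y := State n)
  have h1 := continuous_normalEnergy hv hz
  have h2 := continuous_ellipticPart hv hz
  have h3 := continuous_normalFlux hv hz
  have h4 := continuous_killingFlux hv hz
  have hb := ha.b.continuous
  have hN := fun j => (ha.N j).continuous
  have hψ := ha.ψ.continuous
  have db := fun j => continuous_spacePartial (ha.b.of_le (by norm_cast)) j
  have dψ := fun j => continuous_spacePartial (ha.ψ.of_le (by norm_cast)) j
  have dN := fun i j => continuous_spacePartial ((ha.N i).of_le (by norm_cast)) j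
  have de := fun k l j =>
    continuous_spacePartial ((ha.e k l).of_le (by norm_cast)) j
  simp only [Function.comp_def] at h1 h2 h3 h4
  unfold Function.uncurry bulk normalBulk
  fun_prop

theorem bulk_eq_zero {x : Space n} (hx : a.ψ =ᶠ[𝓝 x] fun _ => 1) (z : State n) :
    bulk a x z = 0 := by
  have h1 : a.ψ x = 1 := hx.eq_of_nhds
  have h2 : ∀ j, spacePartial a.ψ j x = 0 := fun j => by
    simp [spacePartial, hx.fderiv_eq]
  simp [bulk, h1, h2]

/-- The local energy identity: if `u_t` and `m_t` are given by the right hand sides of the system,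
the time derivative of the energy density is the divergence of the flux plus the bulk term and
`u u_t`. -/
theorem energyPolar_rhs_eq (ha : a.IsSmooth) {u m : Space n → ℝ} {p : Fin n → Space n → ℝ}
    (hm : Differentiable ℝ m) (hp : ∀ j, Differentiable ℝ (p j))
    (x : Space n) (hsymm : ∀ i j, spacePartial (p i) j x = spacePartial (p j) i x) :
    energyPolar (a.val x) (u x, m x, fun j => p j x)
      (velocity (a.val x) (u x, m x, fun j => p j x),
        ∑ j, spacePartial (fun y => momentumFlux (a.val y) (u y, m y, fun j => p j y) j) j x,
        fun j => spacePartial (fun y => velocity (a.val y) (u y, m y, fun j => p j y)) j x) =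
    ∑ j, spacePartial (fun y => flux (a.val y) (u y, m y, fun j => p j y) j) j x
      + bulk a x (u x, m x, fun j => p j x)
      + u x * velocity (a.val x) (u x, m x, fun j => p j x) := by
  have hb := ha.b.differentiable (by simp)
  have hN := fun j => (ha.N j).differentiable (by simp)
  have he := fun j k => (ha.e j k).differentiable (by simp)
  have hψ := ha.ψ.differentiable (by simp)
  set z : Space n → State n := fun y => (u y, m y, fun j => p j y) with hz
  set A : Fin n → Space n → ℝ := fun j y => ellipticPart (a.val y) (z y) j with hAdef
  set V : Space n → ℝ := fun y => velocity (a.val y) (z y) with hVdef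
  set H : Space n → ℝ := fun y => normalEnergy (a.val y) (z y) with hHdef
  have dA : ∀ j, Differentiable ℝ (A j) := fun j => by
    simp only [hAdef, ellipticPart, WaveCoeff.val, hz]; fun_prop
  have dV : Differentiable ℝ V := by
    simp only [hVdef, velocity, shiftDeriv, WaveCoeff.val, hz]; fun_prop
  have dH : Differentiable ℝ H := by
    have : H = fun y => (a.b y * m y ^ 2 + ∑ j, A j y * p j y) / 2 := rfl
    rw [this]; fun_prop
  -- partial derivatives of the building blocks
  have pA : ∀ k j, spacePartial (A k) j x =
      ∑ l, spacePartial (a.e k l) j x * p l x + ∑ l, a.e k l x * spacePartial (p l) j x := by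
    intro k j
    have : A k = fun y => ∑ l, a.e k l y * p l y := rfl
    rw [this, spacePartial_sum fun l _ => ((he k l).fun_mul (hp l)).differentiableAt,
      ← Finset.sum_add_distrib]
    exact Finset.sum_congr rfl fun l _ =>
      spacePartial_mul (he k l).differentiableAt (hp l).differentiableAt j
  have pV : ∀ j, spacePartial V j x = spacePartial a.b j x * m x + a.b x * spacePartial m j x +
      (∑ l, spacePartial (a.N l) j x * p l x + ∑ l, a.N l x * spacePartial (p l) j x) := by
    intro j
    have : V = fun y => a.b y * m y + ∑ l, a.N l y * p l y := rfl
    rw [this, spacePartial_add (by fun_prop) (by fun_prop),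
      spacePartial_mul hb.differentiableAt hm.differentiableAt,
      spacePartial_sum fun l _ => ((hN l).fun_mul (hp l)).differentiableAt,
      ← Finset.sum_add_distrib]
    congr 1
    exact Finset.sum_congr rfl fun l _ =>
      spacePartial_mul (hN l).differentiableAt (hp l).differentiableAt j
  have hsw : ∀ j, ∑ k, (∑ l, a.e k l x * spacePartial (p l) j x) * p k x =
      ∑ k, A k x * spacePartial (p k) j x := fun j =>
    ellipticPart_symm (c := a.val x) (fun i k => ha.symm i k x)
      (0, 0, fun l => spacePartial (p l) j x) (z x)
  have pH : ∀ j, spacePartial H j x = (spacePartial a.b j x * m x ^ 2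
      + 2 * (a.b x * m x * spacePartial m j x)
      + ∑ k, (∑ l, spacePartial (a.e k l) j x * p l x) * p k x
      + 2 * ∑ k, A k x * spacePartial (p k) j x) / 2 := by
    intro j
    have : H = fun y => (1 / 2) * (a.b y * (m y * m y) + ∑ j, A j y * p j y) := by
      funext y; simp only [hHdef, normalEnergy]; simp only [WaveCoeff.val, hz]
      rw [pow_two]; simp only [hAdef, hz]; unfold WaveCoeff.val; ring
    rw [this, spacePartial_const_mul (by fun_prop), spacePartial_add (by fun_prop) (by fun_prop),
      spacePartial_mul (by fun_prop) (by fun_prop), spacePartial_mul (by fun_prop) (by fun_prop),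
      spacePartial_sum fun l _ => ((dA l).fun_mul (hp l)).differentiableAt]
    have : ∀ k, spacePartial (fun y => A k y * p k y) j x =
        (∑ l, spacePartial (a.e k l) j x * p l x) * p k x
          + (∑ l, a.e k l x * spacePartial (p l) j x) * p k x
          + A k x * spacePartial (p k) j x := fun k => by
      rw [spacePartial_mul (dA k).differentiableAt (hp k).differentiableAt, pA]; ring
    simp only [this, Finset.sum_add_distrib]
    rw [hsw]
    ring
  have pF : ∀ j, spacePartial (fun y => momentumFlux (a.val y) (z y) j) j x =
      spacePartial (a.N j) j x * m x + a.N j x * spacePartial m j x + spacePartial (A j) j x := by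
    intro j
    have : (fun y => momentumFlux (a.val y) (z y) j) = fun y => a.N j y * m y + A j y := rfl
    rw [this, spacePartial_add (by fun_prop) (by fun_prop),
      spacePartial_mul (by fun_prop) (by fun_prop)]
  have dF : ∀ j, Differentiable ℝ (fun y => momentumFlux (a.val y) (z y) j) := fun j => by
    have : (fun y => momentumFlux (a.val y) (z y) j) = fun y => a.N j y * m y + A j y := rfl
    rw [this]; fun_prop
  have pΦ : ∀ j, spacePartial (fun y => flux (a.val y) (z y) j) j x =
      (1 - a.ψ x) * (spacePartial a.b j x * m x * A j x + a.b x * spacePartial m j x * A j x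
        + a.b x * m x * spacePartial (A j) j x + spacePartial (a.N j) j x * H x
        + a.N j x * spacePartial H j x)
      + a.ψ x * (spacePartial V j x * momentumFlux (a.val x) (z x) j
        + V x * spacePartial (fun y => momentumFlux (a.val y) (z y) j) j x)
      - spacePartial a.ψ j x * (normalFlux (a.val x) (z x) j - killingFlux (a.val x) (z x) j) := by
    intro j
    have h0 : (fun y => flux (a.val y) (z y) j) = fun y =>
        (a.b y * m y * A j y + a.N j y * H y)
        + a.ψ y * (V y * momentumFlux (a.val y) (z y) j
          - (a.b y * m y * A j y + a.N j y * H y)) := by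
      funext y
      simp only [flux, normalFlux, killingFlux, hAdef, hHdef, hVdef, WaveCoeff.val, hz]
      ring
    have dF' := dF j
    have d1 : Differentiable ℝ (fun y => a.b y * m y * A j y + a.N j y * H y) := by fun_prop
    have d2 : Differentiable ℝ (fun y => V y * momentumFlux (a.val y) (z y) j) := dV.mul dF'
    have e1 : spacePartial (fun y => a.b y * m y * A j y + a.N j y * H y) j x =
        spacePartial a.b j x * m x * A j x + a.b x * spacePartial m j x * A j x
        + a.b x * m x * spacePartial (A j) j x + spacePartial (a.N j) j x * H x
        + a.N j x * spacePartial H j x := by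
      rw [spacePartial_add (by fun_prop) (by fun_prop),
        spacePartial_mul (by fun_prop) (by fun_prop), spacePartial_mul (by fun_prop) (by fun_prop),
        spacePartial_mul (by fun_prop) (by fun_prop)]
      ring
    rw [h0, spacePartial_add d1.differentiableAt (hψ.fun_mul (d2.fun_sub d1)).differentiableAt,
      spacePartial_mul hψ.differentiableAt (d2.fun_sub d1).differentiableAt,
      spacePartial_sub d2.differentiableAt d1.differentiableAt,
      spacePartial_mul dV.differentiableAt dF'.differentiableAt, e1]
    simp only [normalFlux, killingFlux, hAdef, hHdef, hVdef, WaveCoeff.val, hz]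
    ring
  -- the only second derivatives of `u` that survive cancel by symmetry
  have hcancel : ∑ j, A j x * ∑ l, a.N l x * spacePartial (p l) j x =
      ∑ j, a.N j x * ∑ k, A k x * spacePartial (p k) j x := by
    simp only [Finset.mul_sum]
    rw [Finset.sum_comm]
    refine Finset.sum_congr rfl fun l _ => Finset.sum_congr rfl fun j _ => ?_
    rw [hsymm l j]; ring
  have hvx : V x = a.b x * m x + shiftDeriv (a.val x) (z x) := rfl
  have hFx : ∀ j, momentumFlux (a.val x) (z x) j = a.N j x * m x + A j x := fun j => rfl
  have main : ∑ j, (a.b x * m x * spacePartial (fun y => momentumFlux (a.val y) (z y) j) j x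
        + A j x * spacePartial V j x) =
      ∑ j, (spacePartial a.b j x * m x * A j x + a.b x * spacePartial m j x * A j x
        + a.b x * m x * spacePartial (A j) j x + spacePartial (a.N j) j x * H x
        + a.N j x * spacePartial H j x) + normalBulk a x (z x) := by
    rw [normalBulk, ← Finset.sum_add_distrib, ← sub_eq_zero, ← Finset.sum_sub_distrib]
    have : ∀ j, (a.b x * m x * spacePartial (fun y => momentumFlux (a.val y) (z y) j) j x
        + A j x * spacePartial V j x) -
        (spacePartial a.b j x * m x * A j x + a.b x * spacePartial m j x * A j x
        + a.b x * m x * spacePartial (A j) j x + spacePartial (a.N j) j x * H x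
        + a.N j x * spacePartial H j x +
        (spacePartial (a.N j) j x * (a.b x * (z x).2.1 ^ 2 - normalEnergy (a.val x) (z x))
        - a.N j x * spacePartial a.b j x * (z x).2.1 ^ 2 / 2
        - a.N j x * (∑ k, (∑ l, spacePartial (a.e k l) j x * (z x).2.2 l) * (z x).2.2 k) / 2
        + ellipticPart (a.val x) (z x) j * ∑ l, spacePartial (a.N l) j x * (z x).2.2 l)) =
        A j x * (∑ l, a.N l x * spacePartial (p l) j x)
          - a.N j x * ∑ k, A k x * spacePartial (p k) j x := by
      intro j
      rw [pF, pV, pH]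
      have : H x = normalEnergy (a.val x) (z x) := rfl
      rw [← this]
      have : A j x = ellipticPart (a.val x) (z x) j := rfl
      rw [← this]
      simp only [hz]
      ring
    rw [Finset.sum_congr rfl fun j _ => this j, Finset.sum_sub_distrib, hcancel, sub_self]
  have lhs : energyPolar (a.val x) (z x) (V x,
        ∑ j, spacePartial (fun y => momentumFlux (a.val y) (z y) j) j x,
        fun j => spacePartial V j x) =
      u x * V x + (1 - a.ψ x) * ∑ j, (a.b x * m x *
          spacePartial (fun y => momentumFlux (a.val y) (z y) j) j x + A j x * spacePartial V j x)
      + a.ψ x * ∑ j, (spacePartial V j x * momentumFlux (a.val x) (z x) j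
        + V x * spacePartial (fun y => momentumFlux (a.val y) (z y) j) j x) := by
    simp only [energyPolar, hFx, hvx]
    have e1 : ∑ j, spacePartial V j x * (a.N j x * m x + A j x) =
        m x * (∑ j, a.N j x * spacePartial V j x) + ∑ j, A j x * spacePartial V j x := by
      rw [Finset.mul_sum, ← Finset.sum_add_distrib]
      exact Finset.sum_congr rfl fun j _ => by ring
    rw [Finset.sum_add_distrib, Finset.sum_add_distrib, ← Finset.mul_sum, ← Finset.mul_sum, e1]
    have e2 : shiftDeriv (a.val x) (V x,
        ∑ j, spacePartial (fun y => momentumFlux (a.val y) (z y) j) j x,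
        fun j => spacePartial V j x) = ∑ j, a.N j x * spacePartial V j x := rfl
    have e3 : ∑ j, ellipticPart (a.val x) (z x) j * spacePartial V j x =
      ∑ j, A j x * spacePartial V j x := rfl
    have e4 : (a.val x).1 = a.b x := rfl
    have e5 : (a.val x).2.2.2 = a.ψ x := rfl
    simp only [hvx] at e2
    rw [e2, e3, e4, e5]
    simp only [hz]
    ring
  refine lhs.trans ?_
  have hsum : ∑ j, spacePartial (fun y => flux (a.val y) (z y) j) j x =
      (1 - a.ψ x) * ∑ j, (spacePartial a.b j x * m x * A j x + a.b x * spacePartial m j x * A j x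
        + a.b x * m x * spacePartial (A j) j x + spacePartial (a.N j) j x * H x
        + a.N j x * spacePartial H j x)
      + a.ψ x * ∑ j, (spacePartial V j x * momentumFlux (a.val x) (z x) j
        + V x * spacePartial (fun y => momentumFlux (a.val y) (z y) j) j x)
      - ∑ j, spacePartial a.ψ j x *
        (normalFlux (a.val x) (z x) j - killingFlux (a.val x) (z x) j) := by
    rw [Finset.mul_sum, Finset.mul_sum, ← Finset.sum_add_distrib, ← Finset.sum_sub_distrib]
    exact Finset.sum_congr rfl fun j _ => pΦ j
  change _ = ∑ j, spacePartial (fun y => flux (a.val y) (z y) j) j x + bulk a x (z x)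
    + u x * V x
  rw [hsum, main, bulk]
  ring

end Divergence

/-! ### Uniform bounds for the quadratic forms -/

section Bounds

variable {n : ℕ}

/-- The coefficients of the flat wave equation, with `ψ = 1`. -/
def flatCoeff (n : ℕ) : CoeffValue n := (1, 0, fun j k => if j = k then 1 else 0, 1)

/-- The hypotheses on the coefficients under which the energy estimate in the exterior of
`S₀ = 0` holds: the coefficients become flat at infinity, where `ψ = 1`, the energy density is
positive definite, and the flux through the level sets of `S₀` towards `S₀ = 0` has the right sign
up to an error `O(S₀)`. -/
structure WaveCoeff.IsAdmissible (a : WaveCoeff n) (S₀ : Space n → ℝ) : Prop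
    extends a.IsSmooth where
  tendsto : Tendsto a.val (Bornology.cobounded (Space n)) (𝓝 (flatCoeff n))
  ψ_eq_one : ∀ᶠ x in Bornology.cobounded (Space n), a.ψ x = 1
  energy_pos : ∀ x z, z ≠ 0 → 0 < energy (a.val x) z
  flux_nonneg : ∀ x₀, S₀ x₀ = 0 → ∃ C, 0 ≤ C ∧ ∀ᶠ x in 𝓝 x₀, 0 < S₀ x → ∀ z,
    -(C * S₀ x * ‖z‖ ^ 2) ≤ ∑ j, spacePartial S₀ j x * flux (a.val x) z j

theorem energy_flatCoeff_pos {z : State n} (hz : z ≠ 0) : 0 < energy (flatCoeff n) z := by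
  have h : energy (flatCoeff n) z = (z.1 ^ 2 + z.2.1 ^ 2 + ∑ j, z.2.2 j ^ 2) / 2 := by
    simp [energy, normalEnergy, ellipticPart, shiftDeriv, flatCoeff, pow_two]
    ring
  have h0 : 0 ≤ ∑ j, z.2.2 j ^ 2 := Finset.sum_nonneg fun _ _ => sq_nonneg _
  rw [h]
  refine lt_of_le_of_ne (by positivity) fun h1 => hz ?_
  have e1 : z.1 = 0 := by nlinarith [sq_nonneg z.1, sq_nonneg z.2.1]
  have e2 : z.2.1 = 0 := by nlinarith [sq_nonneg z.1, sq_nonneg z.2.1]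
  have e3 : ∑ j, z.2.2 j ^ 2 = 0 := by nlinarith [sq_nonneg z.1, sq_nonneg z.2.1]
  have e4 : z.2.2 = 0 := by
    funext j
    have := (Finset.sum_eq_zero_iff_of_nonneg fun _ _ => sq_nonneg _).1 e3 j (Finset.mem_univ j)
    simpa using this
  ext <;> simp [e1, e2, e4]

variable {a : WaveCoeff n} {S₀ : Space n → ℝ}

/-- Together with their limit at infinity the values of the coefficients form a compact set, which
makes the constants in bounds for quadratic forms uniform on the whole space. -/
theorem WaveCoeff.IsAdmissible.isCompact_values (ha : a.IsAdmissible S₀) :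
    IsCompact (insert (flatCoeff n) (range a.val)) := by
  have h := ha.tendsto
  rw [Metric.cobounded_eq_cocompact] at h
  exact h.isCompact_insert_range_of_cocompact ha.toIsSmooth.continuous_val

theorem WaveCoeff.IsAdmissible.exists_energy_lower_bound (ha : a.IsAdmissible S₀) :
    ∃ c, 0 < c ∧ ∀ x z, c * ‖z‖ ^ 2 ≤ energy (a.val x) z := by
  obtain ⟨c, hc, h⟩ := exists_le_of_homogeneous ha.isCompact_values (f := energy)
    (continuous_energy continuous_fst continuous_snd) energy_smul (by
      rintro x (rfl | ⟨y, rfl⟩) z hz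
      · exact energy_flatCoeff_pos hz
      · exact ha.energy_pos y z hz)
  exact ⟨c, hc, fun x z => h _ (Or.inr ⟨x, rfl⟩) z⟩

/-- Upper bounds, uniform on the whole space, for all quadratic forms in the energy identity. -/
theorem WaveCoeff.IsAdmissible.exists_upper_bound (ha : a.IsAdmissible S₀) :
    ∃ C, 0 ≤ C ∧ (∀ x z, energy (a.val x) z ≤ C * ‖z‖ ^ 2) ∧
      (∀ x z j, |flux (a.val x) z j| ≤ C * ‖z‖ ^ 2) ∧
      (∀ x z, |z.1 * velocity (a.val x) z| ≤ C * ‖z‖ ^ 2) ∧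
      (∀ x z ζ, |energyPolar (a.val x) z ζ| ≤ C * (‖z‖ ^ 2 + ‖ζ‖ ^ 2)) ∧
      ∀ x z, |bulk a x z| ≤ C * ‖z‖ ^ 2 := by
  have hK := ha.isCompact_values
  obtain ⟨C₁, hC₁, h₁⟩ := exists_abs_le_of_homogeneous hK (f := energy)
    (continuous_energy continuous_fst continuous_snd) energy_smul
  have hfl : ∀ j, ∃ C, 0 ≤ C ∧ ∀ c ∈ insert (flatCoeff n) (range a.val), ∀ z : State n,
      |flux c z j| ≤ C * ‖z‖ ^ 2 := fun j =>
    exists_abs_le_of_homogeneous hK (f := fun c z => flux c z j)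
      (continuous_flux continuous_fst continuous_snd j) (fun c s z => flux_smul c s z j)
  choose C₂ hC₂ h₂ using hfl
  obtain ⟨C₃, hC₃, h₃⟩ := exists_abs_le_of_homogeneous hK
    (f := fun c (z : State n) => z.1 * velocity c z)
    (by
      have := continuous_velocity (continuous_fst (X := CoeffValue n) (Y := State n))
        continuous_snd
      exact (continuous_fst.comp continuous_snd).mul this)
    (fun c s z => by simp only [velocity_smul, Prod.smul_fst, smul_eq_mul]; ring)
  obtain ⟨C₄, hC₄, h₄⟩ := exists_abs_le_of_homogeneous hK
    (f := fun c (y : State n × State n) => energyPolar c y.1 y.2)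
    (continuous_energyPolar continuous_fst (continuous_fst.comp continuous_snd)
      (continuous_snd.comp continuous_snd)) (fun c s y => energyPolar_smul c s y.1 y.2)
  obtain ⟨r, hr⟩ : ∃ r : ℝ, ∀ x : Space n, r < ‖x‖ → a.ψ x = 1 := by
    have h := ha.ψ_eq_one
    rw [← comap_norm_atTop, eventually_comap] at h
    obtain ⟨r, hr⟩ := eventually_atTop.1 h
    exact ⟨r, fun x hx => hr _ hx.le x rfl⟩
  obtain ⟨C₅, hC₅, h₅⟩ := exists_abs_le_of_homogeneous (isCompact_closedBall (0 : Space n) r)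
    (continuous_bulk ha.toIsSmooth) (bulk_smul a)
  have hsum : 0 ≤ ∑ j, C₂ j := Finset.sum_nonneg fun j _ => hC₂ j
  refine ⟨C₁ + ∑ j, C₂ j + C₃ + C₄ + C₅, by positivity, fun x z => ?_, fun x z j => ?_,
    fun x z => ?_, fun x z ζ => ?_, fun x z => ?_⟩
  · refine ((le_abs_self _).trans (h₁ _ (Or.inr ⟨x, rfl⟩) z)).trans ?_
    gcongr; linarith
  · refine (h₂ j _ (Or.inr ⟨x, rfl⟩) z).trans ?_
    have : C₂ j ≤ ∑ j, C₂ j := Finset.single_le_sum (fun j _ => hC₂ j) (Finset.mem_univ j)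
    gcongr; linarith
  · refine (h₃ _ (Or.inr ⟨x, rfl⟩) z).trans ?_
    gcongr; linarith
  · refine (h₄ _ (Or.inr ⟨x, rfl⟩) (z, ζ)).trans ?_
    have : ‖(z, ζ)‖ ^ 2 ≤ ‖z‖ ^ 2 + ‖ζ‖ ^ 2 := by
      rw [Prod.norm_def]
      rcases max_choice ‖z‖ ‖ζ‖ with h | h <;> simp only [h] <;>
        nlinarith [sq_nonneg ‖z‖, sq_nonneg ‖ζ‖]
    gcongr; linarith
  · rcases le_or_gt ‖x‖ r with hx | hx
    · refine (h₅ x (by simpa using hx) z).trans ?_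
      gcongr; linarith
    · rw [bulk_eq_zero ?_, abs_zero]
      · positivity
      · have : IsOpen {y : Space n | r < ‖y‖} := isOpen_lt continuous_const continuous_norm
        filter_upwards [this.mem_nhds hx] with y hy using hr y hy

/-- On bounded sets the flux through the level sets of `S₀` is nonnegative up to `O(S₀)`. -/
theorem WaveCoeff.IsAdmissible.exists_flux_lower_bound (ha : a.IsAdmissible S₀)
    (hS : ContDiff ℝ ∞ S₀) (R : ℝ) :
    ∃ C, 0 ≤ C ∧ ∀ x ∈ Metric.closedBall (0 : Space n) R, 0 < S₀ x → ∀ z,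
      -(C * S₀ x * ‖z‖ ^ 2) ≤ ∑ j, spacePartial S₀ j x * flux (a.val x) z j := by
  refine (isCompact_closedBall (0 : Space n) R).induction_on
    (p := fun s => ∃ C, 0 ≤ C ∧ ∀ x ∈ s, 0 < S₀ x → ∀ z,
      -(C * S₀ x * ‖z‖ ^ 2) ≤ ∑ j, spacePartial S₀ j x * flux (a.val x) z j)
    ⟨0, le_rfl, by simp⟩ ?_ ?_ ?_
  · rintro s t hst ⟨C, hC, h⟩
    exact ⟨C, hC, fun x hx => h x (hst hx)⟩
  · rintro s t ⟨C, hC, h⟩ ⟨C', hC', h'⟩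
    refine ⟨C + C', by positivity, fun x hx hpos z => ?_⟩
    have h3 : 0 ≤ S₀ x * ‖z‖ ^ 2 := by positivity
    rcases hx with hx | hx
    · nlinarith [h x hx hpos z, mul_nonneg hC' h3]
    · nlinarith [h' x hx hpos z, mul_nonneg hC h3]
  · intro x₀ hx₀
    rcases lt_trichotomy (S₀ x₀) 0 with h0 | h0 | h0
    · refine ⟨{x | S₀ x < 0}, mem_nhdsWithin_of_mem_nhds
        ((isOpen_lt hS.continuous continuous_const).mem_nhds h0), 0, le_rfl, ?_⟩
      intro x hx hpos
      exact absurd hpos (not_lt.2 (le_of_lt hx))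
    · obtain ⟨C, hC, h⟩ := ha.flux_nonneg x₀ h0
      exact ⟨_, mem_nhdsWithin_of_mem_nhds h, C, hC, fun x hx => hx⟩
    · obtain ⟨C, hC, -, hfl, -⟩ := ha.exists_upper_bound
      have hd : ∀ j, Continuous (spacePartial S₀ j) := fun j =>
        continuous_spacePartial (hS.of_le (by norm_cast)) j
      set D := (∑ j, |spacePartial S₀ j x₀|) + 1 with hD
      have hDpos : 0 < D := by positivity
      have hcont : Continuous fun x => ∑ j, |spacePartial S₀ j x| := by fun_prop
      refine ⟨{x | S₀ x₀ / 2 < S₀ x ∧ ∑ j, |spacePartial S₀ j x| < D},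
        mem_nhdsWithin_of_mem_nhds (IsOpen.mem_nhds ((isOpen_lt continuous_const
          hS.continuous).inter (isOpen_lt hcont continuous_const)) ⟨by linarith, by
            simp [hD]⟩), 2 * D * C / S₀ x₀, by positivity, ?_⟩
      rintro x ⟨hx1, hx2⟩ hpos z
      have h1 : |∑ j, spacePartial S₀ j x * flux (a.val x) z j| ≤ D * (C * ‖z‖ ^ 2) := by
        calc |∑ j, spacePartial S₀ j x * flux (a.val x) z j|
            ≤ ∑ j, |spacePartial S₀ j x| * (C * ‖z‖ ^ 2) := by
              refine (Finset.abs_sum_le_sum_abs _ _).trans (Finset.sum_le_sum fun j _ => ?_)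
              rw [abs_mul]
              gcongr
              exact hfl x z j
          _ ≤ D * (C * ‖z‖ ^ 2) := by
              rw [← Finset.sum_mul]
              gcongr
      have h2 : D * (C * ‖z‖ ^ 2) ≤ 2 * D * C / S₀ x₀ * S₀ x * ‖z‖ ^ 2 := by
        have : 1 ≤ 2 / S₀ x₀ * S₀ x := by
          rw [div_mul_eq_mul_div, le_div_iff₀ h0]; linarith
        calc D * (C * ‖z‖ ^ 2) = 1 * (D * (C * ‖z‖ ^ 2)) := by ring
          _ ≤ (2 / S₀ x₀ * S₀ x) * (D * (C * ‖z‖ ^ 2)) := by gcongr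
          _ = _ := by ring
      have := neg_abs_le (∑ j, spacePartial S₀ j x * flux (a.val x) z j)
      linarith

end Bounds

/-! ### The weight -/

section Weight

variable {n : ℕ}

/-- The smooth substitute `√(1 + |x|²)` for `|x|`. -/
def bracket (x : Space n) : ℝ := Real.sqrt (1 + ‖x‖ ^ 2)

theorem norm_le_bracket (x : Space n) : ‖x‖ ≤ bracket x :=
  Real.le_sqrt_of_sq_le (by linarith)

theorem bracket_le (x : Space n) : bracket x ≤ 1 + ‖x‖ := by
  rw [bracket, Real.sqrt_le_left (by positivity)]
  nlinarith [norm_nonneg x]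

theorem contDiff_bracket : ContDiff ℝ ∞ (bracket (n := n)) :=
  (contDiff_const.add (contDiff_norm_sq ℝ)).sqrt fun x => by positivity

theorem abs_spacePartial_bracket_le (j : Fin n) (x : Space n) : |spacePartial bracket j x| ≤ 1 := by
  have hpos : 0 < 1 + ‖x‖ ^ 2 := by positivity
  have h : HasFDerivAt (bracket (n := n))
      ((1 / (2 * Real.sqrt (1 + ‖x‖ ^ 2))) • (2 • innerSL ℝ x)) x :=
    (((hasStrictFDerivAt_norm_sq x).hasFDerivAt).const_add 1).sqrt hpos.ne'
  have hj : |x j| ≤ Real.sqrt (1 + ‖x‖ ^ 2) :=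
    (PiLp.norm_apply_le x j).trans (norm_le_bracket x)
  have h1 : spacePartial bracket j x = x j / Real.sqrt (1 + ‖x‖ ^ 2) := by
    rw [spacePartial, h.fderiv]
    simp [EuclideanSpace.inner_single_right]
    field_simp
  rw [h1, abs_div, abs_of_nonneg (Real.sqrt_nonneg _)]
  exact div_le_one_of_le₀ hj (Real.sqrt_nonneg _)

/-- The cut-off `σ(R - √(1 + |x|²) - c τ)` to a ball shrinking with speed `c`, as a function of the
elapsed time `τ`. -/
def coneCutoff (R c τ : ℝ) (x : Space n) : ℝ := Real.smoothTransition (R - bracket x - c * τ)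

/-- The weight of the energy estimate: the factor `exp (-Λ τ)` absorbs the bulk terms, the second
one localizes to a backward cone, and the last one is a cut-off to `S₀ > 0` at the scale `η`. -/
def weight (S₀ : Space n → ℝ) (Λ R c η τ : ℝ) (x : Space n) : ℝ :=
  Real.exp (-Λ * τ) * (coneCutoff R c τ x * Real.smoothTransition (S₀ x / η))

/-- The derivative of `weight` in the time variable. -/
def weightDeriv (S₀ : Space n → ℝ) (Λ R c η τ : ℝ) (x : Space n) : ℝ :=
  Real.exp (-Λ * τ) * ((-Λ * coneCutoff R c τ x
    - c * deriv Real.smoothTransition (R - bracket x - c * τ)) * Real.smoothTransition (S₀ x / η))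

variable {S₀ : Space n → ℝ} {Λ R c η : ℝ}

theorem hasDerivAt_weight (τ : ℝ) (x : Space n) :
    HasDerivAt (fun τ => weight S₀ Λ R c η τ x) (weightDeriv S₀ Λ R c η τ x) τ := by
  have h1 : HasDerivAt (fun τ : ℝ => R - bracket x - c * τ) (-c) τ := by
    simpa using ((hasDerivAt_id τ).const_mul c).const_sub (R - bracket x)
  have h2 : HasDerivAt (fun τ => coneCutoff R c τ x)
      (deriv Real.smoothTransition (R - bracket x - c * τ) * (-c)) τ :=
    (differentiable_smoothTransition _).hasDerivAt.comp τ h1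
  have h3 : HasDerivAt (fun τ : ℝ => Real.exp (-Λ * τ)) (Real.exp (-Λ * τ) * (-Λ)) τ := by
    simpa using ((hasDerivAt_id τ).const_mul (-Λ)).exp
  refine (h3.fun_mul (h2.mul_const (Real.smoothTransition (S₀ x / η)))).congr_deriv ?_
  rw [weightDeriv]; ring

theorem continuous_weight (hS : Continuous S₀) :
    Continuous fun q : ℝ × Space n => weight S₀ Λ R c η q.1 q.2 := by
  have := Real.smoothTransition.continuous
  have := (contDiff_bracket (n := n)).continuous
  unfold weight coneCutoff
  fun_prop

theorem continuous_weightDeriv (hS : Continuous S₀) :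
    Continuous fun q : ℝ × Space n => weightDeriv S₀ Λ R c η q.1 q.2 := by
  have := Real.smoothTransition.continuous
  have := continuous_deriv_smoothTransition
  have := (contDiff_bracket (n := n)).continuous
  unfold weightDeriv coneCutoff
  fun_prop

theorem contDiff_weight (hS : ContDiff ℝ ∞ S₀) (τ : ℝ) :
    ContDiff ℝ ∞ (weight S₀ Λ R c η τ) := by
  have h1 : ContDiff ℝ ∞ (coneCutoff (n := n) R c τ) :=
    Real.smoothTransition.contDiff.comp
      ((contDiff_const.sub contDiff_bracket).sub contDiff_const)
  exact contDiff_const.mul (h1.mul (Real.smoothTransition.contDiff.comp (hS.div_const η)))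

theorem spacePartial_comp_real {φ : ℝ → ℝ} {f : Space n → ℝ} {x : Space n}
    (hφ : DifferentiableAt ℝ φ (f x)) (hf : DifferentiableAt ℝ f x) (j : Fin n) :
    spacePartial (fun y => φ (f y)) j x = deriv φ (f x) * spacePartial f j x := by
  have := hφ.hasDerivAt.comp_hasFDerivAt x hf.hasFDerivAt
  rw [spacePartial, show (fun y => φ (f y)) = φ ∘ f from rfl, this.fderiv]
  simp [spacePartial]

theorem spacePartial_weight (hS : ContDiff ℝ ∞ S₀) (τ : ℝ) (x : Space n) (j : Fin n) :
    spacePartial (weight S₀ Λ R c η τ) j x = Real.exp (-Λ * τ) *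
      (-(deriv Real.smoothTransition (R - bracket x - c * τ) * spacePartial bracket j x)
          * Real.smoothTransition (S₀ x / η)
        + coneCutoff R c τ x *
          (deriv Real.smoothTransition (S₀ x / η) * (spacePartial S₀ j x / η))) := by
  have dS := hS.differentiable (by simp)
  have db := (contDiff_bracket (n := n)).differentiable (by simp)
  have dσ := differentiable_smoothTransition
  have d1 : Differentiable ℝ fun y : Space n => R - bracket y - c * τ := by fun_prop
  have d2 : Differentiable ℝ fun y => S₀ y / η := by fun_prop
  have d3 : Differentiable ℝ (coneCutoff (n := n) R c τ) := dσ.comp d1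
  have d4 : Differentiable ℝ fun y => Real.smoothTransition (S₀ y / η) := dσ.comp d2
  have e1 : spacePartial (coneCutoff (n := n) R c τ) j x =
      -(deriv Real.smoothTransition (R - bracket x - c * τ) * spacePartial bracket j x) := by
    have : coneCutoff (n := n) R c τ =
      fun y => Real.smoothTransition (R - bracket y - c * τ) := rfl
    rw [this, spacePartial_comp_real (dσ _) (d1 x)]
    have : spacePartial (fun y => R - bracket y - c * τ) j x = -spacePartial bracket j x := by
      rw [spacePartial, fderiv_sub_const, fderiv_const_sub]; simp [spacePartial]
    rw [this]; ring
  have e2 : spacePartial (fun y => Real.smoothTransition (S₀ y / η)) j x =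
      deriv Real.smoothTransition (S₀ x / η) * (spacePartial S₀ j x / η) := by
    rw [spacePartial_comp_real (dσ _) (d2 x)]
    have : spacePartial (fun y => S₀ y / η) j x = spacePartial S₀ j x / η := by
      simp only [div_eq_inv_mul]
      exact spacePartial_const_mul (dS x) _ j
    rw [this]
  have : weight S₀ Λ R c η τ = fun y => Real.exp (-Λ * τ) *
    (coneCutoff R c τ y * Real.smoothTransition (S₀ y / η)) := rfl
  rw [this, spacePartial_const_mul ((d3 x).fun_mul (d4 x)), spacePartial_mul (d3 x) (d4 x), e1, e2]

theorem coneCutoff_eq_zero {τ : ℝ} (hc : 0 ≤ c) (hτ : 0 ≤ τ) {x : Space n} (hx : R ≤ ‖x‖) :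
    coneCutoff R c τ x = 0 :=
  Real.smoothTransition.zero_of_nonpos (by
    have := norm_le_bracket x
    have := mul_nonneg hc hτ
    linarith)

theorem weight_eq_zero {τ : ℝ} (hc : 0 ≤ c) (hτ : 0 ≤ τ) {x : Space n} (hx : R ≤ ‖x‖) :
    weight S₀ Λ R c η τ x = 0 := by
  simp [weight, coneCutoff_eq_zero hc hτ hx]

/-- The decisive pointwise inequality: for suitable `Λ` and `c`, all terms of the weighted energy
identity have a sign, except for the residual `ρ` of the equation and for an error that is
concentrated near `S₀ = 0`. -/
theorem weighted_form_le {a : WaveCoeff n} (hS : ContDiff ℝ ∞ S₀)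
    {c₀ C C' : ℝ} (hc₀ : 0 < c₀) (hC : 0 ≤ C)
    (hE : ∀ x z, c₀ * ‖z‖ ^ 2 ≤ energy (a.val x) z)
    (hfl : ∀ x z j, |flux (a.val x) z j| ≤ C * ‖z‖ ^ 2)
    (hvel : ∀ x z, |z.1 * velocity (a.val x) z| ≤ C * ‖z‖ ^ 2)
    (hpol : ∀ x z ζ, |energyPolar (a.val x) z ζ| ≤ C * (‖z‖ ^ 2 + ‖ζ‖ ^ 2))
    (hbulk : ∀ x z, |bulk a x z| ≤ C * ‖z‖ ^ 2) (hC' : 0 ≤ C')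
    (hR : ∀ x ∈ Metric.closedBall (0 : Space n) R, 0 < S₀ x → ∀ z,
      -(C' * S₀ x * ‖z‖ ^ 2) ≤ ∑ j, spacePartial S₀ j x * flux (a.val x) z j)
    (hη : 0 < η) {τ : ℝ} (hτ : 0 ≤ τ) (x : Space n) (hx : x ∈ Metric.closedBall (0 : Space n) R)
    (z ρ : State n) :
    weightDeriv S₀ (3 * C / c₀) R (n * C / c₀) η τ x * energy (a.val x) z
      - ∑ j, spacePartial (weight S₀ (3 * C / c₀) R (n * C / c₀) η τ) j x * flux (a.val x) z j
      + weight S₀ (3 * C / c₀) R (n * C / c₀) η τ x *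
        (bulk a x z + z.1 * velocity (a.val x) z + energyPolar (a.val x) z ρ) ≤
    C * ‖ρ‖ ^ 2 + C' * ‖z‖ ^ 2 * (S₀ x / η * deriv Real.smoothTransition (S₀ x / η)) := by
  set Λ := 3 * C / c₀ with hΛ
  set c := n * C / c₀ with hcdef
  have hΛ0 : 0 ≤ Λ := by positivity
  set E := Real.exp (-Λ * τ) with hEdef
  have hE0 : 0 < E := Real.exp_pos _
  have hE1 : E ≤ 1 := Real.exp_le_one_iff.2 (by nlinarith)
  set A := coneCutoff R c τ x with hA
  set A' := deriv Real.smoothTransition (R - bracket x - c * τ) with hA'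
  set B := Real.smoothTransition (S₀ x / η) with hB
  set B' := deriv Real.smoothTransition (S₀ x / η) with hB'
  have hA0 : 0 ≤ A := Real.smoothTransition.nonneg _
  have hA1 : A ≤ 1 := Real.smoothTransition.le_one _
  have hA'0 : 0 ≤ A' := deriv_smoothTransition_nonneg _
  have hB0 : 0 ≤ B := Real.smoothTransition.nonneg _
  have hB1 : B ≤ 1 := Real.smoothTransition.le_one _
  have hB'0 : 0 ≤ B' := deriv_smoothTransition_nonneg _
  set e := energy (a.val x) z with he
  set Y := ∑ j, spacePartial bracket j x * flux (a.val x) z j with hY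
  set Z := ∑ j, spacePartial S₀ j x * flux (a.val x) z j with hZ
  set W := bulk a x z + z.1 * velocity (a.val x) z + energyPolar (a.val x) z ρ with hW
  have hee := hE x z
  rw [← he] at hee
  -- `c` bounds the ratio of flux and energy, that is, the speed of propagation
  have hYle : Y ≤ c * e := by
    have h1 : Y ≤ n * (C * ‖z‖ ^ 2) := by
      calc Y ≤ ∑ _j : Fin n, C * ‖z‖ ^ 2 := by
            refine Finset.sum_le_sum fun j _ => (le_abs_self _).trans ?_
            rw [abs_mul]
            calc _ ≤ 1 * (C * ‖z‖ ^ 2) :=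
                  mul_le_mul (abs_spacePartial_bracket_le j x) (hfl x z j) (abs_nonneg _) one_pos.le
              _ = _ := one_mul _
        _ = n * (C * ‖z‖ ^ 2) := by simp
    have h2 : n * (C * ‖z‖ ^ 2) = c * (c₀ * ‖z‖ ^ 2) := by
      rw [hcdef]; field_simp
    have hc0 : 0 ≤ c := by positivity
    calc Y ≤ c * (c₀ * ‖z‖ ^ 2) := h2 ▸ h1
      _ ≤ c * e := by gcongr
  -- `Λ` is chosen to absorb the three bulk terms, each at most `C * ‖z‖ ^ 2` up to the residual
  have hWle : -Λ * e + W ≤ C * ‖ρ‖ ^ 2 := by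
    have h1 := (le_abs_self _).trans (hbulk x z)
    have h2 := (le_abs_self _).trans (hvel x z)
    have h3 := (le_abs_self _).trans (hpol x z ρ)
    have h4 : Λ * (c₀ * ‖z‖ ^ 2) = 3 * C * ‖z‖ ^ 2 := by rw [hΛ]; field_simp
    have h5 : Λ * (c₀ * ‖z‖ ^ 2) ≤ Λ * e := by gcongr
    rw [hW]; nlinarith
  -- the flux through the level sets of `S₀` has a sign up to `O(S₀)`, where `S₀` is positive;
  -- elsewhere the derivative of the cut-off vanishes
  have hZle : -(B' * Z / η) ≤ C' * ‖z‖ ^ 2 * (S₀ x / η * B') := by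
    rcases le_or_gt (S₀ x) 0 with h | h
    · have : B' = 0 := deriv_smoothTransition_of_nonpos (div_nonpos_of_nonpos_of_nonneg h hη.le)
      simp [this]
    · have h1 := hR x hx h z
      rw [← hZ] at h1
      have h2 : C' * ‖z‖ ^ 2 * (S₀ x / η * B') + B' * Z / η =
        B' / η * (Z + C' * S₀ x * ‖z‖ ^ 2) := by ring
      have h3 : 0 ≤ B' / η * (Z + C' * S₀ x * ‖z‖ ^ 2) :=
        mul_nonneg (by positivity) (by linarith)
      linarith
  have hZ0 : 0 ≤ C' * ‖z‖ ^ 2 * (S₀ x / η * B') := by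
    rcases le_or_gt (S₀ x) 0 with h | h
    · have : B' = 0 := deriv_smoothTransition_of_nonpos (div_nonpos_of_nonpos_of_nonneg h hη.le)
      simp [this]
    · positivity
  have hsum : ∑ j, spacePartial (weight S₀ Λ R c η τ) j x * flux (a.val x) z j =
      E * (-(A' * B) * Y + A * (B' * Z / η)) := by
    rw [hY, hZ, Finset.mul_sum, Finset.mul_sum, Finset.sum_div, Finset.mul_sum,
      ← Finset.sum_add_distrib, Finset.mul_sum]
    refine Finset.sum_congr rfl fun j _ => ?_
    rw [spacePartial_weight hS]
    ring
  have hid : weightDeriv S₀ Λ R c η τ x * e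
      - ∑ j, spacePartial (weight S₀ Λ R c η τ) j x * flux (a.val x) z j
      + weight S₀ Λ R c η τ x * W =
      (E * A * B) * (-Λ * e + W) + E * A' * B * (Y - c * e) + (E * A) * (-(B' * Z / η)) := by
    rw [hsum, weightDeriv, weight]
    ring
  rw [hid]
  have t1 : (E * A * B) * (-Λ * e + W) ≤ C * ‖ρ‖ ^ 2 := by
    have : E * A * B ≤ 1 := by
      calc E * A * B ≤ 1 * 1 * 1 := by gcongr
        _ = 1 := by norm_num
    calc (E * A * B) * (-Λ * e + W) ≤ (E * A * B) * (C * ‖ρ‖ ^ 2) := by gcongr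
      _ ≤ 1 * (C * ‖ρ‖ ^ 2) := by gcongr
      _ = _ := one_mul _
  have t2 : E * A' * B * (Y - c * e) ≤ 0 :=
    mul_nonpos_of_nonneg_of_nonpos (by positivity) (by linarith)
  have t3 : (E * A) * (-(B' * Z / η)) ≤ C' * ‖z‖ ^ 2 * (S₀ x / η * B') := by
    have : E * A ≤ 1 := by
      calc E * A ≤ 1 * 1 := by gcongr
        _ = 1 := by norm_num
    calc (E * A) * (-(B' * Z / η)) ≤ (E * A) * (C' * ‖z‖ ^ 2 * (S₀ x / η * B')) := by gcongr
      _ ≤ 1 * (C' * ‖z‖ ^ 2 * (S₀ x / η * B')) := by gcongr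
      _ = _ := one_mul _
  linarith

end Weight

/-! ### The energy estimate for regular functions -/

section EnergyEstimate

variable {n : ℕ}

/-- The state `(u, m, ∇u)` of a pair of functions `u`, `m` at the time `t`. -/
def stateOf (u m : ℝ → Space n → ℝ) (t : ℝ) (x : Space n) : State n :=
  (u t x, m t x, fun j => spacePartial (u t) j x)

/-- A pair of functions `u`, `m` on `[t₀, T] × ℝⁿ`, smooth in `x`, with time derivatives `ut`, `mt`
on `(t₀, T)`, such that everything that enters the energy is continuous up to the end points. -/
structure IsRegularPair (t₀ T : ℝ) (u m ut mt : ℝ → Space n → ℝ) : Prop where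
  contDiff_u : ∀ t ∈ Icc t₀ T, ContDiff ℝ ∞ (u t)
  contDiff_m : ∀ t ∈ Icc t₀ T, ContDiff ℝ ∞ (m t)
  contDiff_ut : ∀ t ∈ Icc t₀ T, ContDiff ℝ ∞ (ut t)
  continuous_mt : ∀ t ∈ Icc t₀ T, Continuous (mt t)
  continuousOn_u : ContinuousOn (fun q : ℝ × Space n => u q.1 q.2) (Icc t₀ T ×ˢ univ)
  continuousOn_m : ContinuousOn (fun q : ℝ × Space n => m q.1 q.2) (Icc t₀ T ×ˢ univ)
  continuousOn_ut : ContinuousOn (fun q : ℝ × Space n => ut q.1 q.2) (Icc t₀ T ×ˢ univ)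
  continuousOn_mt : ContinuousOn (fun q : ℝ × Space n => mt q.1 q.2) (Icc t₀ T ×ˢ univ)
  continuousOn_grad : ∀ j,
    ContinuousOn (fun q : ℝ × Space n => spacePartial (u q.1) j q.2) (Icc t₀ T ×ˢ univ)
  continuousOn_grad_ut : ∀ j,
    ContinuousOn (fun q : ℝ × Space n => spacePartial (ut q.1) j q.2) (Icc t₀ T ×ˢ univ)
  hasDerivAt_u : ∀ t ∈ Ioo t₀ T, ∀ x, HasDerivAt (fun s => u s x) (ut t x) t
  hasDerivAt_m : ∀ t ∈ Ioo t₀ T, ∀ x, HasDerivAt (fun s => m s x) (mt t x) t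
  hasDerivAt_grad : ∀ t ∈ Ioo t₀ T, ∀ j x,
    HasDerivAt (fun s => spacePartial (u s) j x) (spacePartial (ut t) j x) t

/-- The residuals `r = u_t - (b m + N·∇u)` and `q = m_t - div (N m + e ∇u)`, arranged as the state
`(r, q, ∇r)`. -/
def residual (a : WaveCoeff n) (u m ut mt : ℝ → Space n → ℝ) (t : ℝ) (x : Space n) : State n :=
  (ut t x - velocity (a.val x) (stateOf u m t x),
    mt t x - ∑ j, spacePartial (fun y => momentumFlux (a.val y) (stateOf u m t y) j) j x,
    fun j => spacePartial (ut t) j x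
      - spacePartial (fun y => velocity (a.val y) (stateOf u m t y)) j x)

variable {a : WaveCoeff n} {S₀ : Space n → ℝ} {t₀ T : ℝ} {u m ut mt : ℝ → Space n → ℝ}

theorem IsRegularPair.contDiff_stateOf (h : IsRegularPair t₀ T u m ut mt) {t : ℝ}
    (ht : t ∈ Icc t₀ T) : ContDiff ℝ ∞ (stateOf u m t) :=
  (h.contDiff_u t ht).prodMk ((h.contDiff_m t ht).prodMk
    (contDiff_pi.2 fun j => contDiff_spacePartial (h.contDiff_u t ht) j))

theorem IsRegularPair.continuousOn_stateOf (h : IsRegularPair t₀ T u m ut mt) :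
    ContinuousOn (fun q : ℝ × Space n => stateOf u m q.1 q.2) (Icc t₀ T ×ˢ univ) :=
  h.continuousOn_u.prodMk (h.continuousOn_m.prodMk (continuousOn_pi.2 h.continuousOn_grad))

theorem contDiff_ellipticPart (ha : a.IsSmooth) {z : Space n → State n} (hz : ContDiff ℝ ∞ z)
    (j : Fin n) : ContDiff ℝ ∞ fun y => ellipticPart (a.val y) (z y) j := by
  have he := ha.e
  have hz3 := fun k => (contDiff_pi.1 hz.snd.snd) k
  unfold ellipticPart WaveCoeff.val
  exact ContDiff.sum fun k _ => (he j k).mul (hz3 k)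

theorem contDiff_velocity (ha : a.IsSmooth) {z : Space n → State n} (hz : ContDiff ℝ ∞ z) :
    ContDiff ℝ ∞ fun y => velocity (a.val y) (z y) := by
  have hz3 := fun k => (contDiff_pi.1 hz.snd.snd) k
  exact (ha.b.mul hz.snd.fst).add (ContDiff.sum fun k _ => (ha.N k).mul (hz3 k))

theorem contDiff_momentumFlux (ha : a.IsSmooth) {z : Space n → State n} (hz : ContDiff ℝ ∞ z)
    (j : Fin n) : ContDiff ℝ ∞ fun y => momentumFlux (a.val y) (z y) j :=
  ((ha.N j).mul hz.snd.fst).add (contDiff_ellipticPart ha hz j)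

theorem contDiff_flux (ha : a.IsSmooth) {z : Space n → State n} (hz : ContDiff ℝ ∞ z)
    (j : Fin n) : ContDiff ℝ ∞ fun y => flux (a.val y) (z y) j := by
  have hz3 := fun k => (contDiff_pi.1 hz.snd.snd) k
  have hA := contDiff_ellipticPart ha hz
  have hH : ContDiff ℝ ∞ fun y => normalEnergy (a.val y) (z y) :=
    ((ha.b.mul (hz.snd.fst.pow 2)).add (ContDiff.sum fun j _ => (hA j).mul (hz3 j))).div_const 2
  exact ((contDiff_const.sub ha.ψ).mul (((ha.b.mul hz.snd.fst).mul (hA j)).add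
    ((ha.N j).mul hH))).add (ha.ψ.mul ((contDiff_velocity ha hz).mul
      (contDiff_momentumFlux ha hz j)))

theorem IsRegularPair.continuous_residual (h : IsRegularPair t₀ T u m ut mt) (ha : a.IsSmooth)
    {t : ℝ} (ht : t ∈ Icc t₀ T) : Continuous (residual a u m ut mt t) := by
  have hz := h.contDiff_stateOf ht
  have h1 : ContDiff ℝ ∞ fun y => velocity (a.val y) (stateOf u m t y) := contDiff_velocity ha hz
  refine ((h.contDiff_ut t ht).continuous.sub h1.continuous).prodMk
    (((h.continuous_mt t ht).sub (continuous_finsetSum _ fun j _ =>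
      continuous_spacePartial ((contDiff_momentumFlux ha hz j).of_le (by norm_cast)) j)).prodMk
      (continuous_pi fun j => ?_))
  exact (continuous_spacePartial ((h.contDiff_ut t ht).of_le (by norm_cast)) j).sub
    (continuous_spacePartial (h1.of_le (by norm_cast)) j)

/-- The energy density at the time `t₀ + τ`, weighted. -/
def weightedEnergy (a : WaveCoeff n) (S₀ : Space n → ℝ) (Λ R c η t₀ : ℝ)
    (u m : ℝ → Space n → ℝ) (t : ℝ) (x : Space n) : ℝ :=
  weight S₀ Λ R c η (t - t₀) x * energy (a.val x) (stateOf u m t x)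

/-- The time derivative of `weightedEnergy`. -/
def weightedEnergyDeriv (a : WaveCoeff n) (S₀ : Space n → ℝ) (Λ R c η t₀ : ℝ)
    (u m ut mt : ℝ → Space n → ℝ) (t : ℝ) (x : Space n) : ℝ :=
  weightDeriv S₀ Λ R c η (t - t₀) x * energy (a.val x) (stateOf u m t x) +
    weight S₀ Λ R c η (t - t₀) x *
      energyPolar (a.val x) (stateOf u m t x) (ut t x, mt t x, fun j => spacePartial (ut t) j x)

variable {Λ R c η : ℝ}

theorem IsRegularPair.hasDerivAt_weightedEnergy (h : IsRegularPair t₀ T u m ut mt)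
    (ha : a.IsSmooth) {t : ℝ} (ht : t ∈ Ioo t₀ T) (x : Space n) :
    HasDerivAt (fun s => weightedEnergy a S₀ Λ R c η t₀ u m s x)
      (weightedEnergyDeriv a S₀ Λ R c η t₀ u m ut mt t x) t := by
  have h1 : HasDerivAt (fun s => weight S₀ Λ R c η (s - t₀) x)
      (weightDeriv S₀ Λ R c η (t - t₀) x) t := by
    simpa using (hasDerivAt_weight (t - t₀) x).comp_sub_const t t₀
  have h2 := hasDerivAt_energy (c := a.val x) (fun j k => ha.symm j k x)
    (z := fun s => stateOf u m s x) (ζ := (ut t x, mt t x, fun j => spacePartial (ut t) j x))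
    (h.hasDerivAt_u t ht x) (h.hasDerivAt_m t ht x) (fun j => h.hasDerivAt_grad t ht j x)
  exact h1.fun_mul h2

theorem IsRegularPair.continuousOn_weightedEnergy (h : IsRegularPair t₀ T u m ut mt)
    (ha : a.IsSmooth) (hS : Continuous S₀) :
    ContinuousOn (fun q : ℝ × Space n => weightedEnergy a S₀ Λ R c η t₀ u m q.1 q.2)
      (Icc t₀ T ×ˢ univ) := by
  have h1 : Continuous fun q : ℝ × Space n => weight S₀ Λ R c η (q.1 - t₀) q.2 :=
    (continuous_weight hS).comp ((continuous_fst.sub continuous_const).prodMk continuous_snd)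
  have h2 := (continuous_energy (continuous_fst (X := CoeffValue n) (Y := State n))
    continuous_snd).comp_continuousOn
      ((ha.continuous_val.comp continuous_snd).continuousOn.prodMk h.continuousOn_stateOf)
  exact h1.continuousOn.mul h2

theorem IsRegularPair.continuousOn_weightedEnergyDeriv (h : IsRegularPair t₀ T u m ut mt)
    (ha : a.IsSmooth) (hS : Continuous S₀) :
    ContinuousOn (fun q : ℝ × Space n => weightedEnergyDeriv a S₀ Λ R c η t₀ u m ut mt q.1 q.2)
      (Icc t₀ T ×ˢ univ) := by
  have hq : Continuous fun q : ℝ × Space n => (q.1 - t₀, q.2) :=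
    (continuous_fst.sub continuous_const).prodMk continuous_snd
  have hv : ContinuousOn (fun q : ℝ × Space n => a.val q.2) (Icc t₀ T ×ˢ univ) :=
    (ha.continuous_val.comp continuous_snd).continuousOn
  have h2 := (continuous_energy (continuous_fst (X := CoeffValue n) (Y := State n))
    continuous_snd).comp_continuousOn (hv.prodMk h.continuousOn_stateOf)
  have h3 : ContinuousOn (fun q : ℝ × Space n =>
      ((ut q.1 q.2, mt q.1 q.2, fun j => spacePartial (ut q.1) j q.2) : State n))
      (Icc t₀ T ×ˢ univ) :=
    h.continuousOn_ut.prodMk (h.continuousOn_mt.prodMk (continuousOn_pi.2 h.continuousOn_grad_ut))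
  have h4 := (continuous_energyPolar (continuous_fst (X := CoeffValue n) (Y := State n × State n))
    (continuous_fst.comp continuous_snd) (continuous_snd.comp continuous_snd)).comp_continuousOn
      (hv.prodMk (h.continuousOn_stateOf.prodMk h3))
  exact ((continuous_weightDeriv hS).comp hq).continuousOn.mul h2 |>.add
    (((continuous_weight hS).comp hq).continuousOn.mul h4)

/-- The energy identity at a fixed time, integrated over space: the divergence of the flux
integrates to its pairing with the gradient of the weight. -/
theorem IsRegularPair.integral_weightedEnergyDeriv (h : IsRegularPair t₀ T u m ut mt)
    (ha : a.IsSmooth) (hS : ContDiff ℝ ∞ S₀) (hc : 0 ≤ c) {t : ℝ} (ht : t ∈ Icc t₀ T) :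
    ∫ x in Metric.closedBall (0 : Space n) R, weightedEnergyDeriv a S₀ Λ R c η t₀ u m ut mt t x =
    ∫ x in Metric.closedBall (0 : Space n) R,
      (weightDeriv S₀ Λ R c η (t - t₀) x * energy (a.val x) (stateOf u m t x)
        - ∑ j, spacePartial (weight S₀ Λ R c η (t - t₀)) j x * flux (a.val x) (stateOf u m t x) j
        + weight S₀ Λ R c η (t - t₀) x * (bulk a x (stateOf u m t x)
          + (stateOf u m t x).1 * velocity (a.val x) (stateOf u m t x)
          + energyPolar (a.val x) (stateOf u m t x) (residual a u m ut mt t x))) := by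
  have hz := h.contDiff_stateOf ht
  set z := stateOf u m t with hzdef
  set w := weight S₀ Λ R c η (t - t₀) with hw
  have hwC : ContDiff ℝ ∞ w := contDiff_weight hS _
  have hτ : 0 ≤ t - t₀ := by linarith [ht.1]
  have hfC : ∀ j, ContDiff ℝ ∞ fun y => flux (a.val y) (z y) j := contDiff_flux ha hz
  have hprod : ∀ j, ContDiff ℝ ∞ fun y => w y * flux (a.val y) (z y) j := fun j => hwC.mul (hfC j)
  have hzero : ∀ j, ∀ x ∉ Metric.closedBall (0 : Space n) R,
      spacePartial (fun y => w y * flux (a.val y) (z y) j) j x = 0 := by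
    intro j x hx
    have hx' : R < ‖x‖ := by simpa using hx
    have : (fun y => w y * flux (a.val y) (z y) j) =ᶠ[𝓝 x] fun _ => 0 := by
      filter_upwards [(isOpen_lt continuous_const continuous_norm).mem_nhds hx'] with y hy
      rw [hw, weight_eq_zero hc hτ (le_of_lt hy), zero_mul]
    simp [spacePartial, this.fderiv_eq]
  have hdiv : ∀ j, ∫ x in Metric.closedBall (0 : Space n) R,
      spacePartial (fun y => w y * flux (a.val y) (z y) j) j x = 0 := by
    intro j
    rw [setIntegral_eq_integral_of_forall_compl_eq_zero (hzero j)]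
    refine integral_spacePartial_eq_zero ((hprod j).of_le (by norm_cast)) ?_ j
    refine HasCompactSupport.intro (isCompact_closedBall (0 : Space n) R) fun x hx => ?_
    rw [hw, weight_eq_zero hc hτ (le_of_lt (by simpa using hx)), zero_mul]
  have hint : ∀ j, IntegrableOn (fun x => spacePartial (fun y => w y * flux (a.val y) (z y) j) j x)
      (Metric.closedBall (0 : Space n) R) := fun j =>
    ((continuous_spacePartial ((hprod j).of_le (by norm_cast)) j).continuousOn).integrableOn_compact
      (isCompact_closedBall _ _)
  have hpoint : ∀ x, weightedEnergyDeriv a S₀ Λ R c η t₀ u m ut mt t x =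
      (weightDeriv S₀ Λ R c η (t - t₀) x * energy (a.val x) (z x)
        - ∑ j, spacePartial w j x * flux (a.val x) (z x) j
        + w x * (bulk a x (z x) + (z x).1 * velocity (a.val x) (z x)
          + energyPolar (a.val x) (z x) (residual a u m ut mt t x)))
        + ∑ j, spacePartial (fun y => w y * flux (a.val y) (z y) j) j x := by
    intro x
    have hsplit : ((ut t x, mt t x, fun j => spacePartial (ut t) j x) : State n) =
        (velocity (a.val x) (z x),
          ∑ j, spacePartial (fun y => momentumFlux (a.val y) (z y) j) j x,
          fun j => spacePartial (fun y => velocity (a.val y) (z y)) j x)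
        + residual a u m ut mt t x := by
      simp only [residual, Prod.mk_add_mk, Prod.mk.injEq]
      refine ⟨by simp [hzdef], by simp [hzdef], ?_⟩
      funext j; simp [hzdef]
    have hu2 : ContDiff ℝ 2 (u t) := (h.contDiff_u t ht).of_le (by norm_cast)
    have hid := energyPolar_rhs_eq ha (u := u t) (m := m t) (p := fun j => spacePartial (u t) j)
      ((h.contDiff_m t ht).differentiable (by simp))
      (fun j => (contDiff_spacePartial (h.contDiff_u t ht) j).differentiable (by simp)) x
      (fun i j => spacePartial_comm hu2 i j x)
    have hid' : energyPolar (a.val x) (z x) (velocity (a.val x) (z x),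
        ∑ j, spacePartial (fun y => momentumFlux (a.val y) (z y) j) j x,
        fun j => spacePartial (fun y => velocity (a.val y) (z y)) j x) =
        ∑ j, spacePartial (fun y => flux (a.val y) (z y) j) j x + bulk a x (z x)
          + (z x).1 * velocity (a.val x) (z x) := hid
    have hp : ∀ j, spacePartial (fun y => w y * flux (a.val y) (z y) j) j x =
        spacePartial w j x * flux (a.val x) (z x) j
          + w x * spacePartial (fun y => flux (a.val y) (z y) j) j x := fun j =>
      spacePartial_mul (hwC.differentiable (by simp) x) ((hfC j).differentiable (by simp) x) j
    rw [weightedEnergyDeriv, hsplit, energyPolar_add, hid', Finset.sum_congr rfl fun j _ => hp j,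
      Finset.sum_add_distrib, ← Finset.mul_sum]
    ring
  have hcont1 : IntegrableOn (fun x => weightedEnergyDeriv a S₀ Λ R c η t₀ u m ut mt t x)
      (Metric.closedBall (0 : Space n) R) := by
    refine ContinuousOn.integrableOn_compact (isCompact_closedBall _ _) ?_
    exact (h.continuousOn_weightedEnergyDeriv ha hS.continuous).comp
      (continuous_const.prodMk continuous_id).continuousOn (fun x _ => ⟨ht, mem_univ _⟩)
  have hsumint := integrable_finsetSum Finset.univ fun j (_ : j ∈ Finset.univ) => hint j
  have h0 : ∫ x in Metric.closedBall (0 : Space n) R,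
      ∑ j, spacePartial (fun y => w y * flux (a.val y) (z y) j) j x = 0 := by
    rw [integral_finsetSum _ fun j _ => hint j]
    simp [hdiv]
  have := integral_sub hcont1 hsumint
  rw [h0, sub_zero] at this
  rw [← this]
  exact integral_congr_ae (ae_of_all _ fun x => by simp only [hpoint x, add_sub_cancel_right])

theorem IsRegularPair.integrable_weightedEnergyDeriv (h : IsRegularPair t₀ T u m ut mt)
    (ha : a.IsSmooth) (hS : Continuous S₀) {t : ℝ} (ht : t ∈ Icc t₀ T) :
    Integrable (fun q : ℝ × Space n => weightedEnergyDeriv a S₀ Λ R c η t₀ u m ut mt q.1 q.2)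
      ((volume.restrict (Icc t₀ t)).prod (volume.restrict (Metric.closedBall (0 : Space n) R))) := by
  rw [Measure.prod_restrict]
  exact ((h.continuousOn_weightedEnergyDeriv ha hS).mono
    (prod_mono (Icc_subset_Icc_right ht.2) (subset_univ _))).integrableOn_compact
      (isCompact_Icc.prod (isCompact_closedBall (0 : Space n) R))

/-- Fundamental theorem of calculus in time for the weighted energy. -/
theorem IsRegularPair.integral_weightedEnergy_sub (h : IsRegularPair t₀ T u m ut mt)
    (ha : a.IsSmooth) (hS : Continuous S₀) {t : ℝ} (ht : t ∈ Icc t₀ T) :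
    (∫ x in Metric.closedBall (0 : Space n) R, weightedEnergy a S₀ Λ R c η t₀ u m t x)
      - ∫ x in Metric.closedBall (0 : Space n) R, weightedEnergy a S₀ Λ R c η t₀ u m t₀ x =
    ∫ s in Icc t₀ t, ∫ x in Metric.closedBall (0 : Space n) R,
      weightedEnergyDeriv a S₀ Λ R c η t₀ u m ut mt s x := by
  have hK := isCompact_closedBall (0 : Space n) R
  have hE := h.continuousOn_weightedEnergy (Λ := Λ) (R := R) (c := c) (η := η) ha hS
  have hD := h.continuousOn_weightedEnergyDeriv (Λ := Λ) (R := R) (c := c) (η := η) ha hS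
  have hint : ∀ s ∈ Icc t₀ T, IntegrableOn (fun x => weightedEnergy a S₀ Λ R c η t₀ u m s x)
      (Metric.closedBall (0 : Space n) R) := fun s hs =>
    ContinuousOn.integrableOn_compact hK (hE.comp (continuous_const.prodMk continuous_id).continuousOn
      (fun x _ => ⟨hs, mem_univ _⟩))
  have ht₀ : t₀ ∈ Icc t₀ T := ⟨le_rfl, ht.1.trans ht.2⟩
  rw [← integral_sub (hint t ht) (hint t₀ ht₀)]
  have hsub : Icc t₀ t ⊆ Icc t₀ T := Icc_subset_Icc_right ht.2
  have hftc : ∀ x, weightedEnergy a S₀ Λ R c η t₀ u m t x - weightedEnergy a S₀ Λ R c η t₀ u m t₀ x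
      = ∫ s in Icc t₀ t, weightedEnergyDeriv a S₀ Λ R c η t₀ u m ut mt s x := by
    intro x
    have hcD : ContinuousOn (fun s => weightedEnergyDeriv a S₀ Λ R c η t₀ u m ut mt s x)
        (Icc t₀ t) :=
      hD.comp (continuous_id.prodMk continuous_const).continuousOn
        (fun s hs => ⟨hsub hs, mem_univ _⟩)
    rw [integral_Icc_eq_integral_Ioc, ← intervalIntegral.integral_of_le ht.1,
      intervalIntegral.integral_eq_sub_of_hasDerivAt_of_le ht.1
        (hE.comp (continuous_id.prodMk continuous_const).continuousOn
          (fun s hs => ⟨hsub hs, mem_univ _⟩))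
        (fun s hs => h.hasDerivAt_weightedEnergy ha ⟨hs.1, hs.2.trans_le ht.2⟩ x)
        (hcD.intervalIntegrable_of_Icc ht.1)]
    rfl
  rw [integral_congr_ae (ae_of_all _ hftc)]
  exact integral_integral_swap (h.integrable_weightedEnergyDeriv ha hS ht).swap

end EnergyEstimate

/-! ### Removing the cut-off near the surface -/

section EnergyEstimate

variable {n : ℕ} {a : WaveCoeff n} {S₀ : Space n → ℝ} {t₀ T : ℝ}

theorem mul_deriv_smoothTransition_nonneg (s : ℝ) : 0 ≤ s * deriv Real.smoothTransition s := by
  rcases le_total s 0 with h | h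
  · simp [deriv_smoothTransition_of_nonpos h]
  · exact mul_nonneg h (deriv_smoothTransition_nonneg s)

theorem tendsto_smoothTransition_mul (s : ℝ) :
    Tendsto (fun k : ℕ => Real.smoothTransition (s * k)) atTop (𝓝 (if 0 < s then 1 else 0)) := by
  split_ifs with h
  · refine tendsto_const_nhds.congr' ?_
    filter_upwards [(tendsto_natCast_atTop_atTop.const_mul_atTop h).eventually_ge_atTop 1] with k hk
    exact (Real.smoothTransition.one_of_one_le hk).symm
  · refine tendsto_const_nhds.congr fun k => ?_
    exact (Real.smoothTransition.zero_of_nonpos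
      (mul_nonpos_of_nonpos_of_nonneg (not_lt.1 h) (Nat.cast_nonneg k))).symm

theorem tendsto_mul_deriv_smoothTransition (s : ℝ) :
    Tendsto (fun k : ℕ => s * k * deriv Real.smoothTransition (s * k)) atTop (𝓝 0) := by
  rcases le_or_gt s 0 with h | h
  · refine tendsto_const_nhds.congr fun k => ?_
    rw [deriv_smoothTransition_of_nonpos
      (mul_nonpos_of_nonpos_of_nonneg h (Nat.cast_nonneg k)), mul_zero]
  · refine tendsto_const_nhds.congr' ?_
    filter_upwards [(tendsto_natCast_atTop_atTop.const_mul_atTop h).eventually_ge_atTop 1] with k hk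
    rw [deriv_smoothTransition_of_one_le hk, mul_zero]

/-- The estimate with the cut-off at scale `η` near `S₀ = 0`; `M` bounds the state. -/
theorem IsRegularPair.integral_weightedEnergy_le {u m ut mt : ℝ → Space n → ℝ}
    (h : IsRegularPair t₀ T u m ut mt) (ha : a.IsSmooth) (hS : ContDiff ℝ ∞ S₀)
    {c₀ C C' R η M : ℝ} (hc₀ : 0 < c₀) (hC : 0 ≤ C)
    (hE : ∀ x z, c₀ * ‖z‖ ^ 2 ≤ energy (a.val x) z)
    (hfl : ∀ x z j, |flux (a.val x) z j| ≤ C * ‖z‖ ^ 2)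
    (hvel : ∀ x z, |z.1 * velocity (a.val x) z| ≤ C * ‖z‖ ^ 2)
    (hpol : ∀ x z ζ, |energyPolar (a.val x) z ζ| ≤ C * (‖z‖ ^ 2 + ‖ζ‖ ^ 2))
    (hbulk : ∀ x z, |bulk a x z| ≤ C * ‖z‖ ^ 2) (hC' : 0 ≤ C')
    (hR : ∀ x ∈ Metric.closedBall (0 : Space n) R, 0 < S₀ x → ∀ z,
      -(C' * S₀ x * ‖z‖ ^ 2) ≤ ∑ j, spacePartial S₀ j x * flux (a.val x) z j)
    (hη : 0 < η) (hM : ∀ s ∈ Icc t₀ T, ∀ x ∈ Metric.closedBall (0 : Space n) R,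
      ‖stateOf u m s x‖ ^ 2 ≤ M)
    {f : ℝ → ℝ} (hf : IntegrableOn f (Icc t₀ T))
    (hres : ∀ s ∈ Icc t₀ T,
      ∫ x in Metric.closedBall (0 : Space n) R, ‖residual a u m ut mt s x‖ ^ 2 ≤ f s)
    {t : ℝ} (ht : t ∈ Icc t₀ T) :
    ∫ x in Metric.closedBall (0 : Space n) R,
        weightedEnergy a S₀ (3 * C / c₀) R (n * C / c₀) η t₀ u m t x ≤
      (∫ x in Metric.closedBall (0 : Space n) R,
        weightedEnergy a S₀ (3 * C / c₀) R (n * C / c₀) η t₀ u m t₀ x)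
      + (C * (∫ s in Icc t₀ T, f s) + (t - t₀) * (C' * M *
        ∫ x in Metric.closedBall (0 : Space n) R,
          S₀ x / η * deriv Real.smoothTransition (S₀ x / η))) := by
  set B := Metric.closedBall (0 : Space n) R with hB
  have hBc : IsCompact B := isCompact_closedBall _ _
  have hcn : 0 ≤ n * C / c₀ := by positivity
  set g : Space n → ℝ := fun x => S₀ x / η * deriv Real.smoothTransition (S₀ x / η) with hg
  have hgc : Continuous g := by
    have := hS.continuous
    have := continuous_deriv_smoothTransition
    rw [hg]; fun_prop
  have hg0 : ∀ x, 0 ≤ g x := fun x => mul_deriv_smoothTransition_nonneg _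
  have hgi : IntegrableOn g B := hgc.continuousOn.integrableOn_compact hBc
  have hf0 : ∀ s ∈ Icc t₀ T, 0 ≤ f s := fun s hs =>
    (integral_nonneg fun x => by positivity).trans (hres s hs)
  have hslice : ∀ s ∈ Icc t₀ T, ∫ x in B,
      weightedEnergyDeriv a S₀ (3 * C / c₀) R (n * C / c₀) η t₀ u m ut mt s x ≤
      C * f s + C' * M * ∫ x in B, g x := by
    intro s hs
    have hz := (h.contDiff_stateOf hs).continuous
    have hρ := h.continuous_residual ha hs
    have hv := ha.continuous_val
    have hwC := contDiff_weight (Λ := 3 * C / c₀) (R := R) (c := n * C / c₀) (η := η) hS (s - t₀)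
    rw [h.integral_weightedEnergyDeriv ha hS hcn hs]
    have hcont : Continuous fun x =>
        weightDeriv S₀ (3 * C / c₀) R (n * C / c₀) η (s - t₀) x * energy (a.val x) (stateOf u m s x)
        - ∑ j, spacePartial (weight S₀ (3 * C / c₀) R (n * C / c₀) η (s - t₀)) j x
            * flux (a.val x) (stateOf u m s x) j
        + weight S₀ (3 * C / c₀) R (n * C / c₀) η (s - t₀) x * (bulk a x (stateOf u m s x)
          + (stateOf u m s x).1 * velocity (a.val x) (stateOf u m s x)
          + energyPolar (a.val x) (stateOf u m s x) (residual a u m ut mt s x)) := by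
      have c1 : Continuous fun x => weightDeriv S₀ (3 * C / c₀) R (n * C / c₀) η (s - t₀) x :=
        (continuous_weightDeriv hS.continuous).comp (continuous_const.prodMk continuous_id)
      have c2 := continuous_energy hv hz
      have c3 := fun j => continuous_flux hv hz j
      have c4 := fun j => continuous_spacePartial (hwC.of_le (by norm_cast)) j
      have c5 := hwC.continuous
      have c6 : Continuous fun x => bulk a x (stateOf u m s x) :=
        (continuous_bulk ha).comp (continuous_id.prodMk hz)
      have c7 := continuous_velocity hv hz
      have c8 := continuous_energyPolar hv hz hρ
      exact ((c1.mul c2).sub (continuous_finsetSum _ fun j _ => (c4 j).mul (c3 j))).add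
        (c5.mul ((c6.add (hz.fst.mul c7)).add c8))
    have hρi : IntegrableOn (fun x => ‖residual a u m ut mt s x‖ ^ 2) B :=
      (hρ.norm.pow 2).continuousOn.integrableOn_compact hBc
    calc _ ≤ ∫ x in B, (C * ‖residual a u m ut mt s x‖ ^ 2 + C' * M * g x) := by
          refine setIntegral_mono_on (hcont.continuousOn.integrableOn_compact hBc)
            ((hρi.const_mul C).add (hgi.const_mul (C' * M))) hBc.measurableSet fun x hx => ?_
          refine (weighted_form_le hS hc₀ hC hE hfl hvel hpol hbulk hC' hR hη
            (by linarith [hs.1]) x hx _ _).trans ?_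
          have h1 := hM s hs x hx
          have h2 := hg0 x
          change _ + C' * _ * g x ≤ _
          gcongr
      _ = C * (∫ x in B, ‖residual a u m ut mt s x‖ ^ 2) + C' * M * ∫ x in B, g x := by
          rw [integral_add (hρi.const_mul C) (hgi.const_mul (C' * M)), integral_const_mul,
            integral_const_mul]
      _ ≤ _ := by gcongr; exact hres s hs
  have hsub : Icc t₀ t ⊆ Icc t₀ T := Icc_subset_Icc_right ht.2
  have hftc := h.integral_weightedEnergy_sub (Λ := 3 * C / c₀) (R := R) (c := n * C / c₀) (η := η)
    ha hS.continuous ht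
  have hfin : volume (Icc t₀ t) ≠ ⊤ := isCompact_Icc.measure_lt_top.ne
  have htime : ∫ s in Icc t₀ t, ∫ x in B,
      weightedEnergyDeriv a S₀ (3 * C / c₀) R (n * C / c₀) η t₀ u m ut mt s x ≤
      C * (∫ s in Icc t₀ T, f s) + (t - t₀) * (C' * M * ∫ x in B, g x) := by
    calc _ ≤ ∫ s in Icc t₀ t, (C * f s + C' * M * ∫ x in B, g x) := by
          refine setIntegral_mono_on
            (h.integrable_weightedEnergyDeriv ha hS.continuous ht).integral_prod_left
            (((hf.mono_set hsub).const_mul C).add (integrableOn_const hfin)) measurableSet_Icc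
            fun s hs => hslice s (hsub hs)
      _ = C * (∫ s in Icc t₀ t, f s) + (t - t₀) * (C' * M * ∫ x in B, g x) := by
          rw [integral_add ((hf.mono_set hsub).const_mul C) (integrableOn_const hfin),
            integral_const_mul, setIntegral_const]
          simp [ht.1, Measure.real]
      _ ≤ _ := by
          have : ∫ s in Icc t₀ t, f s ≤ ∫ s in Icc t₀ T, f s := by
            refine setIntegral_mono_set hf ?_ hsub.eventuallyLE
            filter_upwards [ae_restrict_mem measurableSet_Icc] with s hs using hf0 s hs
          gcongr
  linarith

/-- The energy estimate in the exterior of `S₀ = 0`, for regular functions that satisfy the system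
up to a residual. There is no boundary term on `S₀ = 0` because the flux through it has a sign, and
none at infinity because the speed of propagation is bounded: the estimate on the ball of radius
`R` only involves the initial state on the ball of radius `R + ℓ`. -/
theorem WaveCoeff.IsAdmissible.energy_estimate (ha : a.IsAdmissible S₀) (hS : ContDiff ℝ ∞ S₀)
    (t₀ T : ℝ) :
    ∃ C, 0 ≤ C ∧ ∃ ℓ, 0 ≤ ℓ ∧ ∀ (R : ℝ) (u m ut mt : ℝ → Space n → ℝ),
      IsRegularPair t₀ T u m ut mt → ∀ f : ℝ → ℝ, IntegrableOn f (Icc t₀ T) →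
      (∀ s ∈ Icc t₀ T,
        ∫ x in Metric.closedBall (0 : Space n) (R + ℓ), ‖residual a u m ut mt s x‖ ^ 2 ≤ f s) →
      ∀ t ∈ Icc t₀ T,
        ∫ x in Metric.closedBall (0 : Space n) R ∩ exterior S₀, ‖stateOf u m t x‖ ^ 2 ≤
        C * ((∫ x in Metric.closedBall (0 : Space n) (R + ℓ) ∩ exterior S₀,
          ‖stateOf u m t₀ x‖ ^ 2) + ∫ s in Icc t₀ T, f s) := by
  obtain ⟨c₀, hc₀, hE⟩ := ha.exists_energy_lower_bound
  obtain ⟨C, hC, hE', hfl, hvel, hpol, hbulk⟩ := ha.exists_upper_bound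
  set Λ := 3 * C / c₀ with hΛ
  set c := n * C / c₀ with hc
  have hΛ0 : 0 ≤ Λ := by positivity
  have hc0 : 0 ≤ c := by positivity
  set δ := Real.exp (-Λ * (T - t₀)) * c₀ with hδ
  have hδ0 : 0 < δ := by positivity
  -- `smoothTransition` is one from one on and the bracket is at most `1 + ‖x‖`, so with this margin
  -- the cone cut-off equals one on the ball of radius `R` up to time `T`
  refine ⟨C / δ, by positivity, 2 + c * |T - t₀|, by positivity, ?_⟩
  intro R u m ut mt h f hf hres t ht
  set R₀ := R + (2 + c * |T - t₀|) with hR₀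
  set B := Metric.closedBall (0 : Space n) R₀ with hB
  have hBc : IsCompact B := isCompact_closedBall _ _
  have hΩ : MeasurableSet (exterior S₀) :=
    (isOpen_lt continuous_const hS.continuous).measurableSet
  obtain ⟨C', hC', hR⟩ := ha.exists_flux_lower_bound hS R₀
  obtain ⟨M, hM⟩ := (isCompact_Icc.prod hBc).exists_bound_of_continuousOn
    ((h.continuousOn_stateOf.mono (prod_mono le_rfl (subset_univ B))).norm.pow 2)
  have hM' : ∀ s ∈ Icc t₀ T, ∀ x ∈ B, ‖stateOf u m s x‖ ^ 2 ≤ M := fun s hs x hx =>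
    (le_abs_self _).trans (hM (s, x) ⟨hs, hx⟩)
  have ht₀ : t₀ ∈ Icc t₀ T := ⟨le_rfl, ht.1.trans ht.2⟩
  -- the limit of the weighted energies as the scale of the cut-off tends to zero
  have hlim : ∀ s ∈ Icc t₀ T, Tendsto (fun k : ℕ => ∫ x in B,
      weightedEnergy a S₀ Λ R₀ c ((k : ℝ)⁻¹) t₀ u m s x) atTop
      (𝓝 (∫ x in B, (exterior S₀).indicator (fun x => Real.exp (-Λ * (s - t₀)) *
        coneCutoff R₀ c (s - t₀) x * energy (a.val x) (stateOf u m s x)) x)) := by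
    intro s hs
    have hz := (h.contDiff_stateOf hs).continuous
    have hen := continuous_energy ha.toIsSmooth.continuous_val hz
    have hτ : 0 ≤ s - t₀ := by linarith [hs.1]
    refine tendsto_integral_of_dominated_convergence
      (fun x => |energy (a.val x) (stateOf u m s x)|) (fun k => ?_)
      (hen.abs.continuousOn.integrableOn_compact hBc) (fun k => ae_of_all _ fun x => ?_)
      (ae_of_all _ fun x => ?_)
    · exact ((contDiff_weight hS _).continuous.mul hen).aestronglyMeasurable
    · rw [weightedEnergy, norm_mul, Real.norm_eq_abs, Real.norm_eq_abs]
      refine mul_le_of_le_one_left (abs_nonneg _) ?_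
      rw [weight, abs_mul, abs_mul, abs_of_nonneg (Real.exp_pos _).le,
        abs_of_nonneg (Real.smoothTransition.nonneg _), coneCutoff,
        abs_of_nonneg (Real.smoothTransition.nonneg _)]
      calc _ ≤ (1 : ℝ) * (1 * 1) := by
            gcongr
            · exact mul_nonneg (Real.smoothTransition.nonneg _) (Real.smoothTransition.nonneg _)
            · exact Real.exp_le_one_iff.2 (by nlinarith)
            · exact Real.smoothTransition.nonneg _
            · exact Real.smoothTransition.le_one _
            · exact Real.smoothTransition.le_one _
        _ = 1 := by norm_num
    · have h1 := tendsto_smoothTransition_mul (S₀ x)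
      have h2 := ((h1.const_mul (coneCutoff R₀ c (s - t₀) x)).const_mul
        (Real.exp (-Λ * (s - t₀)))).mul_const (energy (a.val x) (stateOf u m s x))
      have h3 : (exterior S₀).indicator (fun x => Real.exp (-Λ * (s - t₀)) *
          coneCutoff R₀ c (s - t₀) x * energy (a.val x) (stateOf u m s x)) x =
          Real.exp (-Λ * (s - t₀)) * (coneCutoff R₀ c (s - t₀) x * if 0 < S₀ x then 1 else 0)
            * energy (a.val x) (stateOf u m s x) := by
        by_cases hx : 0 < S₀ x
        · rw [indicator_of_mem (show x ∈ exterior S₀ from hx), if_pos hx]; ring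
        · rw [indicator_of_notMem (show x ∉ exterior S₀ from hx), if_neg hx]; ring
      rw [h3]
      simpa only [weightedEnergy, weight, div_inv_eq_mul] using h2
  -- the error of the flux disappears with the scale: `s σ'(s)` is bounded, and zero unless `0 < s < 1`
  have hlim0 : Tendsto (fun k : ℕ => ∫ x in B,
      S₀ x / (k : ℝ)⁻¹ * deriv Real.smoothTransition (S₀ x / (k : ℝ)⁻¹)) atTop (𝓝 0) := by
    obtain ⟨Cσ, -, hCσ⟩ := exists_mul_deriv_smoothTransition_le
    have hcσ := continuous_deriv_smoothTransition
    have hcS := hS.continuous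
    rw [← integral_zero (Space n) ℝ (μ := volume.restrict B)]
    refine tendsto_integral_of_dominated_convergence (fun _ => Cσ) (fun k => ?_)
      (integrableOn_const hBc.measure_lt_top.ne) (fun k => ae_of_all _ fun x => hCσ _)
      (ae_of_all _ fun x => ?_)
    · exact Continuous.aestronglyMeasurable (by fun_prop)
    · simpa only [div_inv_eq_mul] using tendsto_mul_deriv_smoothTransition (S₀ x)
  have hle := le_of_tendsto_of_tendsto (hlim t ht)
    ((hlim t₀ ht₀).add (((hlim0.const_mul (C' * M)).const_mul (t - t₀)).const_add
      (C * ∫ s in Icc t₀ T, f s))) (by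
      filter_upwards [eventually_gt_atTop 0] with k hk
      exact h.integral_weightedEnergy_le ha.toIsSmooth hS hc₀ hC hE hfl hvel hpol hbulk hC' hR
        (by positivity) hM' hf hres ht)
  rw [setIntegral_indicator hΩ, setIntegral_indicator hΩ, mul_zero, mul_zero, add_zero] at hle
  have hnorm : ∀ s ∈ Icc t₀ T, IntegrableOn (fun x => ‖stateOf u m s x‖ ^ 2) B := fun s hs =>
    ((h.contDiff_stateOf hs).continuous.norm.pow 2).continuousOn.integrableOn_compact hBc
  have hconeC : ∀ τ, Continuous fun x : Space n => coneCutoff R₀ c τ x := fun τ => by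
    have := Real.smoothTransition.continuous
    have := (contDiff_bracket (n := n)).continuous
    unfold coneCutoff; fun_prop
  have hen0 : ∀ x z, 0 ≤ energy (a.val x) z := fun x z =>
    (by positivity : 0 ≤ c₀ * ‖z‖ ^ 2).trans (hE x z)
  have hWint : ∀ s ∈ Icc t₀ T, IntegrableOn (fun x => Real.exp (-Λ * (s - t₀)) *
      coneCutoff R₀ c (s - t₀) x * energy (a.val x) (stateOf u m s x)) B := fun s hs =>
    ((continuous_const.mul (hconeC _)).mul (continuous_energy ha.toIsSmooth.continuous_val
      (h.contDiff_stateOf hs).continuous)).continuousOn.integrableOn_compact hBc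
  have hsubB : Metric.closedBall (0 : Space n) R ∩ exterior S₀ ⊆ B ∩ exterior S₀ :=
    inter_subset_inter_left _ (Metric.closedBall_subset_closedBall (by
      have : 0 ≤ c * |T - t₀| := by positivity
      linarith))
  have hlow : δ * ∫ x in Metric.closedBall (0 : Space n) R ∩ exterior S₀, ‖stateOf u m t x‖ ^ 2 ≤
      ∫ x in B ∩ exterior S₀, Real.exp (-Λ * (t - t₀)) *
        coneCutoff R₀ c (t - t₀) x * energy (a.val x) (stateOf u m t x) := by
    rw [← integral_const_mul]
    calc _ ≤ ∫ x in Metric.closedBall (0 : Space n) R ∩ exterior S₀, Real.exp (-Λ * (t - t₀)) *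
        coneCutoff R₀ c (t - t₀) x * energy (a.val x) (stateOf u m t x) := by
          refine setIntegral_mono_on
            (((hnorm t ht).mono_set (hsubB.trans inter_subset_left)).const_mul δ)
            ((hWint t ht).mono_set (hsubB.trans inter_subset_left))
            (Metric.isClosed_closedBall.measurableSet.inter hΩ) fun x hx => ?_
          have hx' : ‖x‖ ≤ R := by simpa using hx.1
          have h1 : coneCutoff R₀ c (t - t₀) x = 1 := by
            refine Real.smoothTransition.one_of_one_le ?_
            have h2 := bracket_le x
            have h3 : c * (t - t₀) ≤ c * |T - t₀| :=
              mul_le_mul_of_nonneg_left ((by linarith [ht.2] : t - t₀ ≤ T - t₀).trans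
                (le_abs_self _)) hc0
            linarith
          rw [h1, hδ, mul_one, mul_assoc]
          have h4 : Real.exp (-Λ * (T - t₀)) ≤ Real.exp (-Λ * (t - t₀)) :=
            Real.exp_le_exp.2 (by nlinarith [ht.2])
          exact mul_le_mul h4 (hE _ _) (by positivity) (Real.exp_pos _).le
      _ ≤ _ := by
          refine setIntegral_mono_set ((hWint t ht).mono_set inter_subset_left)
            (ae_of_all _ fun x => ?_) hsubB.eventuallyLE
          exact mul_nonneg (mul_nonneg (Real.exp_pos _).le (Real.smoothTransition.nonneg _))
            (hen0 _ _)
  have hup : ∫ x in B ∩ exterior S₀, Real.exp (-Λ * (t₀ - t₀)) *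
        coneCutoff R₀ c (t₀ - t₀) x * energy (a.val x) (stateOf u m t₀ x) ≤
      C * ∫ x in B ∩ exterior S₀, ‖stateOf u m t₀ x‖ ^ 2 := by
    rw [← integral_const_mul]
    refine setIntegral_mono_on ((hWint t₀ ht₀).mono_set inter_subset_left)
      (((hnorm t₀ ht₀).mono_set inter_subset_left).const_mul C) (hBc.measurableSet.inter hΩ)
      fun x hx => ?_
    rw [sub_self, mul_zero, Real.exp_zero, one_mul]
    exact (mul_le_of_le_one_left (hen0 _ _) (Real.smoothTransition.le_one _)).trans (hE' _ _)
  rw [div_mul_eq_mul_div, le_div_iff₀ hδ0, mul_comm _ δ, mul_add]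
  linarith

end EnergyEstimate

/-! ### Mollification -/

section Mollifier

variable {n : ℕ}

/-- The convolution `x ↦ ∫ v(y) φ(x - y) dy`. -/
def conv (v φ : Space n → ℝ) : Space n → ℝ :=
  convolution v φ (ContinuousLinearMap.mul ℝ ℝ) volume

theorem conv_apply (v φ : Space n → ℝ) (x : Space n) : conv v φ x = ∫ y, v y * φ (x - y) := rfl

theorem integrable_conv_integrand {v φ : Space n → ℝ} (hv : LocallyIntegrable v)
    (hφ : Continuous φ) (hc : HasCompactSupport φ) (x : Space n) :
    Integrable fun y => v y * φ (x - y) :=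
  hc.convolutionExists_right (ContinuousLinearMap.mul ℝ ℝ) hv hφ x

theorem conv_sub {v w φ : Space n → ℝ} (hv : LocallyIntegrable v) (hw : LocallyIntegrable w)
    (hφ : Continuous φ) (hc : HasCompactSupport φ) :
    conv (v - w) φ = conv v φ - conv w φ := by
  funext x
  simp only [conv_apply, Pi.sub_apply]
  rw [← integral_sub (integrable_conv_integrand hv hφ hc x) (integrable_conv_integrand hw hφ hc x)]
  simp only [sub_mul]

theorem conv_add {v w φ : Space n → ℝ} (hv : LocallyIntegrable v) (hw : LocallyIntegrable w)
    (hφ : Continuous φ) (hc : HasCompactSupport φ) :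
    conv (fun x => v x + w x) φ = fun x => conv v φ x + conv w φ x := by
  funext x
  simp only [conv_apply]
  rw [← integral_add (integrable_conv_integrand hv hφ hc x) (integrable_conv_integrand hw hφ hc x)]
  simp only [add_mul]

theorem conv_sum {ι : Type*} {s : Finset ι} {v : ι → Space n → ℝ} {φ : Space n → ℝ}
    (hv : ∀ i ∈ s, LocallyIntegrable (v i)) (hφ : Continuous φ) (hc : HasCompactSupport φ) :
    conv (fun x => ∑ i ∈ s, v i x) φ = fun x => ∑ i ∈ s, conv (v i) φ x := by
  funext x
  simp only [conv_apply]
  rw [← integral_finsetSum s fun i hi => integrable_conv_integrand (hv i hi) hφ hc x]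
  simp only [Finset.sum_mul]

theorem conv_smul (c : ℝ) (v φ : Space n → ℝ) : conv (c • v) φ = c • conv v φ := by
  funext x
  simp only [conv_apply, Pi.smul_apply, smul_eq_mul, mul_assoc, integral_const_mul]

theorem contDiff_conv {v φ : Space n → ℝ} (hv : LocallyIntegrable v) (hφ : ContDiff ℝ ∞ φ)
    (hc : HasCompactSupport φ) : ContDiff ℝ ∞ (conv v φ) :=
  hc.contDiff_convolution_right _ hv hφ

theorem hasCompactSupport_spacePartial {φ : Space n → ℝ} (hc : HasCompactSupport φ) (j : Fin n) :
    HasCompactSupport (spacePartial φ j) :=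
  (hc.fderiv (𝕜 := ℝ)).comp_left (g := fun L : Space n →L[ℝ] ℝ => L (EuclideanSpace.single j 1))
    (by simp)

theorem spacePartial_conv {v φ : Space n → ℝ} (hv : LocallyIntegrable v) (hφ : ContDiff ℝ ∞ φ)
    (hc : HasCompactSupport φ) (j : Fin n) :
    spacePartial (conv v φ) j = conv v (spacePartial φ j) := by
  funext x
  have h := hc.hasFDerivAt_convolution_right (ContinuousLinearMap.mul ℝ ℝ) hv
    (hφ.of_le (by norm_cast)) x
  rw [spacePartial, conv, h.fderiv]
  have hi : Integrable fun y =>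
      (ContinuousLinearMap.mul ℝ ℝ).precompR (Space n) (v y) (fderiv ℝ φ (x - y)) :=
    (hc.fderiv (𝕜 := ℝ)).convolutionExists_right _ hv (hφ.continuous_fderiv (by simp)) x
  rw [convolution_def, ContinuousLinearMap.integral_apply hi]
  rfl

/-- A fixed bump function supported in the unit ball. -/
def stdBump (n : ℕ) : ContDiffBump (0 : Space n) := ⟨1 / 2, 1, by norm_num, by norm_num⟩

/-- The standard mollifier `δ⁻ⁿ ρ(x / δ)`. -/
def mollifier (n : ℕ) (δ : ℝ) (x : Space n) : ℝ :=
  δ⁻¹ ^ n * (stdBump n).normed volume (δ⁻¹ • x)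

theorem contDiff_mollifier (δ : ℝ) : ContDiff ℝ ∞ (mollifier n δ) :=
  contDiff_const.mul ((stdBump n).contDiff_normed.comp (contDiff_const_smul _))

theorem mollifier_eq_zero {δ : ℝ} (hδ : 0 < δ) {x : Space n} (hx : δ < ‖x‖) :
    mollifier n δ x = 0 := by
  have : δ⁻¹ • x ∉ Function.support ((stdBump n).normed volume) := by
    rw [ContDiffBump.support_normed_eq]
    simp only [stdBump, Metric.mem_ball, dist_zero_right, norm_smul, norm_inv, Real.norm_eq_abs,
      abs_of_pos hδ, not_lt]
    rw [inv_mul_eq_div, le_div_iff₀ hδ]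
    linarith
  rw [mollifier, Function.notMem_support.1 this, mul_zero]

theorem hasCompactSupport_mollifier {δ : ℝ} (hδ : 0 < δ) : HasCompactSupport (mollifier n δ) :=
  HasCompactSupport.intro (isCompact_closedBall (0 : Space n) δ) fun _ hx =>
    mollifier_eq_zero hδ (by simpa using hx)

theorem mollifier_nonneg {δ : ℝ} (hδ : 0 < δ) (x : Space n) : 0 ≤ mollifier n δ x :=
  mul_nonneg (by positivity) ((stdBump n).nonneg_normed _)

theorem integral_mollifier {δ : ℝ} (hδ : 0 < δ) : ∫ x, mollifier n δ x = 1 := by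
  simp only [mollifier]
  rw [integral_const_mul, Measure.integral_comp_inv_smul_of_nonneg _ _ hδ.le,
    ContDiffBump.integral_normed]
  simp [hδ.ne']

theorem spacePartial_mollifier (δ : ℝ) (j : Fin n) (x : Space n) :
    spacePartial (mollifier n δ) j x =
      δ⁻¹ ^ (n + 1) * spacePartial ((stdBump n).normed volume) j (δ⁻¹ • x) := by
  have h1 : HasFDerivAt (fun x : Space n => δ⁻¹ • x) (δ⁻¹ • ContinuousLinearMap.id ℝ (Space n)) x :=
    (hasFDerivAt_id x).fun_const_smul _
  have h2 := ((((stdBump n).contDiff_normed (μ := volume) (n := 1)).differentiable one_ne_zero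
    (δ⁻¹ • x)).hasFDerivAt.comp x h1).const_mul (δ⁻¹ ^ n)
  have : mollifier n δ = fun x => δ⁻¹ ^ n * (((stdBump n).normed volume) ∘ fun x => δ⁻¹ • x) x := rfl
  rw [spacePartial, this, h2.fderiv]
  simp [spacePartial]
  ring

theorem spacePartial_mollifier_eq_zero {δ : ℝ} (hδ : 0 < δ) {x : Space n} (hx : δ < ‖x‖)
    (j : Fin n) : spacePartial (mollifier n δ) j x = 0 := by
  have : mollifier n δ =ᶠ[𝓝 x] fun _ => 0 := by
    filter_upwards [(isOpen_lt continuous_const continuous_norm).mem_nhds hx] with y hy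
      using mollifier_eq_zero hδ hy
  simp [spacePartial, this.fderiv_eq]

theorem exists_mollifier_bound (n : ℕ) :
    ∃ M, 0 ≤ M ∧ ∀ δ, 0 < δ → ∀ x : Space n, |mollifier n δ x| ≤ M * δ⁻¹ ^ n ∧
      ∀ j, |spacePartial (mollifier n δ) j x| ≤ M * δ⁻¹ ^ (n + 1) := by
  have hc : HasCompactSupport ((stdBump n).normed volume) := (stdBump n).hasCompactSupport_normed
  obtain ⟨A, hA⟩ := hc.exists_bound_of_continuous (stdBump n).continuous_normed
  have hD : ∀ j, ∃ D, ∀ x, ‖spacePartial ((stdBump n).normed volume) j x‖ ≤ D := fun j =>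
    (hasCompactSupport_spacePartial hc j).exists_bound_of_continuous
      (continuous_spacePartial (stdBump n).contDiff_normed j)
  choose D hD using hD
  have hA0 : 0 ≤ A := (norm_nonneg _).trans (hA 0)
  have hD0 : ∀ j, 0 ≤ D j := fun j => (norm_nonneg _).trans (hD j 0)
  have hS : 0 ≤ ∑ j, D j := Finset.sum_nonneg fun j _ => hD0 j
  refine ⟨A + ∑ j, D j, by positivity, fun δ hδ x => ⟨?_, fun j => ?_⟩⟩
  · rw [mollifier, abs_mul, abs_of_nonneg (by positivity), mul_comm]
    gcongr
    exact (hA _).trans (by linarith)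
  · rw [spacePartial_mollifier, abs_mul, abs_of_nonneg (by positivity), mul_comm]
    have : D j ≤ ∑ j, D j := Finset.single_le_sum (fun j _ => hD0 j) (Finset.mem_univ j)
    gcongr
    exact (hD j _).trans (by linarith)

theorem integral_mollifier_sub {δ : ℝ} (hδ : 0 < δ) (x : Space n) :
    ∫ y, mollifier n δ (x - y) = 1 := by
  rw [integral_sub_left_eq_self, integral_mollifier hδ]

/-- For a Lipschitz function the mollification error is at most the Lipschitz constant times the
radius. -/
theorem abs_conv_mollifier_sub_le {h : Space n → ℝ} {L : ℝ≥0} (hL : LipschitzWith L h) {δ : ℝ}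
    (hδ : 0 < δ) (x : Space n) : |conv h (mollifier n δ) x - h x| ≤ L * δ := by
  have hm := (contDiff_mollifier (n := n) δ).continuous
  have hc := hasCompactSupport_mollifier (n := n) hδ
  have h1 := integrable_conv_integrand hL.continuous.locallyIntegrable hm hc x
  have h2 : Integrable fun y => mollifier n δ (x - y) :=
    (hm.integrable_of_hasCompactSupport hc).comp_sub_left x
  have h3 : conv h (mollifier n δ) x - h x = ∫ y, (h y - h x) * mollifier n δ (x - y) := by
    have : h x = ∫ y, h x * mollifier n δ (x - y) := by
      rw [integral_const_mul, integral_mollifier_sub hδ, mul_one]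
    rw [conv_apply, this, ← integral_sub h1 (h2.const_mul _)]
    simp only [integral_const_mul, integral_mollifier_sub hδ, mul_one, sub_mul]
  rw [h3]
  calc |∫ y, (h y - h x) * mollifier n δ (x - y)|
      ≤ ∫ y, (L * δ) * mollifier n δ (x - y) := by
        refine abs_integral_le_integral_abs.trans (integral_mono_of_nonneg
          (ae_of_all _ fun y => abs_nonneg _) (h2.const_mul _) (ae_of_all _ fun y => ?_))
        simp only [abs_mul, abs_of_nonneg (mollifier_nonneg hδ _)]
        rcases le_or_gt ‖x - y‖ δ with hy | hy
        · have := hL.dist_le_mul y x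
          rw [Real.dist_eq, dist_comm, dist_eq_norm] at this
          have h4 : |h y - h x| ≤ L * δ := this.trans (by gcongr)
          exact mul_le_mul_of_nonneg_right h4 (mollifier_nonneg hδ _)
        · simp [mollifier_eq_zero hδ hy]
    _ = L * δ := by rw [integral_const_mul, integral_mollifier_sub hδ, mul_one]

/-- Young's inequality for kernels supported in balls of radius `δ`: a function bounded by `M` times
the average of `|v|` over balls of radius `δ` has `L²` norm at most a constant times that of `v`. -/
theorem eLpNorm_le_of_le_average {v F : Space n → ℝ} {M : ℝ≥0∞} {R δ : ℝ}
    (hδ : 0 < δ) (hδ1 : δ ≤ 1) (hv : AEStronglyMeasurable v)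
    (hF : ∀ x ∈ Metric.ball (0 : Space n) R,
      ‖F x‖ₑ ≤ M * ENNReal.ofReal (δ⁻¹ ^ n) * ∫⁻ y in Metric.closedBall x δ, ‖v y‖ₑ) :
    eLpNorm F 2 (volume.restrict (Metric.ball (0 : Space n) R)) ≤
      M * volume (Metric.closedBall (0 : Space n) 1) *
        eLpNorm v 2 (volume.restrict (Metric.ball (0 : Space n) (R + 2))) := by
  set V := volume (Metric.closedBall (0 : Space n) 1) with hV
  have hvol : ∀ x : Space n, volume (Metric.closedBall x δ) = ENNReal.ofReal (δ ^ n) * V := by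
    intro x
    rw [Measure.addHaar_closedBall' _ _ hδ.le]
    simp [hV]
  have hδδ : ENNReal.ofReal (δ⁻¹ ^ n) * ENNReal.ofReal (δ ^ n) = 1 := by
    rw [← ENNReal.ofReal_mul (by positivity), ← mul_pow, inv_mul_cancel₀ hδ.ne', one_pow,
      ENNReal.ofReal_one]
  have hsq : ∀ (f : Space n → ℝ) (s : Set (Space n)),
      eLpNorm f 2 (volume.restrict s) ^ 2 = ∫⁻ x in s, ‖f x‖ₑ ^ 2 := by
    intro f s
    have := eLpNorm_nnreal_pow_eq_lintegral (f := f) (p := 2) (μ := volume.restrict s) two_ne_zero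
    simpa using this
  -- Cauchy-Schwarz on a ball
  have hCS : ∀ x : Space n, (∫⁻ y in Metric.closedBall x δ, ‖v y‖ₑ) ^ 2 ≤
      ENNReal.ofReal (δ ^ n) * V * ∫⁻ y in Metric.closedBall x δ, ‖v y‖ₑ ^ 2 := by
    intro x
    have h1 := eLpNorm_le_eLpNorm_mul_rpow_measure_univ (p := 1) (q := 2) (by norm_num)
      (hv.restrict (s := Metric.closedBall x δ))
    rw [eLpNorm_one_eq_lintegral_enorm, Measure.restrict_apply_univ, hvol] at h1
    calc _ ≤ _ := pow_le_pow_left' h1 2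
      _ = _ := by
          rw [mul_pow, hsq, ← ENNReal.rpow_natCast, ← ENNReal.rpow_mul, mul_comm]
          norm_num
  have hmeas : AEMeasurable (fun q : Space n × Space n =>
      {q : Space n × Space n | dist q.2 q.1 ≤ δ}.indicator (fun q => ‖v q.2‖ₑ ^ 2) q)
      ((volume.restrict (Metric.ball (0 : Space n) R)).prod volume) := by
    refine AEMeasurable.indicator ?_ ?_
    · exact (hv.comp_snd).enorm.pow_const 2
    · exact (isClosed_le (continuous_snd.dist continuous_fst) continuous_const).measurableSet
  have hfub : ∫⁻ x in Metric.ball (0 : Space n) R, ∫⁻ y in Metric.closedBall x δ, ‖v y‖ₑ ^ 2 ≤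
      ENNReal.ofReal (δ ^ n) * V * ∫⁻ y in Metric.ball (0 : Space n) (R + 2), ‖v y‖ₑ ^ 2 := by
    calc _ = ∫⁻ x in Metric.ball (0 : Space n) R, ∫⁻ y,
          {q : Space n × Space n | dist q.2 q.1 ≤ δ}.indicator (fun q => ‖v q.2‖ₑ ^ 2) (x, y) := by
          refine lintegral_congr fun x => ?_
          rw [← lintegral_indicator Metric.isClosed_closedBall.measurableSet]
          rfl
      _ = ∫⁻ y, ∫⁻ x in Metric.ball (0 : Space n) R,
          {q : Space n × Space n | dist q.2 q.1 ≤ δ}.indicator (fun q => ‖v q.2‖ₑ ^ 2) (x, y) :=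
          lintegral_lintegral_swap hmeas
      _ ≤ ∫⁻ y, (Metric.ball (0 : Space n) (R + 2)).indicator
            (fun y => ENNReal.ofReal (δ ^ n) * V * ‖v y‖ₑ ^ 2) y := by
          refine lintegral_mono fun y => ?_
          by_cases hy : y ∈ Metric.ball (0 : Space n) (R + 2)
          · rw [indicator_of_mem hy]
            calc _ ≤ ∫⁻ x, {q : Space n × Space n | dist q.2 q.1 ≤ δ}.indicator
                  (fun q => ‖v q.2‖ₑ ^ 2) (x, y) := setLIntegral_le_lintegral _ _
              _ = ∫⁻ x, (Metric.closedBall y δ).indicator (fun _ => ‖v y‖ₑ ^ 2) x := by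
                  refine lintegral_congr fun x => ?_
                  simp only [indicator, mem_ofPred_eq, Metric.mem_closedBall, dist_comm]
              _ = _ := by
                  rw [lintegral_indicator Metric.isClosed_closedBall.measurableSet,
                    setLIntegral_const, hvol, mul_comm]
          · rw [indicator_of_notMem hy]
            refine le_of_eq ?_
            rw [setLIntegral_congr_fun (g := fun _ => 0) Metric.isOpen_ball.measurableSet]
            · simp
            · intro x hx
              refine indicator_of_notMem ?_ _
              simp only [mem_ofPred_eq, not_le]
              by_contra! h
              refine hy ?_
              have := dist_triangle y x 0
              simp only [Metric.mem_ball] at hx ⊢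
              linarith
      _ = _ := by
          rw [lintegral_indicator Metric.isOpen_ball.measurableSet, lintegral_const_mul'']
          exact hv.restrict.enorm.pow_const 2
  have hfin : eLpNorm F 2 (volume.restrict (Metric.ball (0 : Space n) R)) ^ 2 ≤
      (M * V * eLpNorm v 2 (volume.restrict (Metric.ball (0 : Space n) (R + 2)))) ^ 2 := by
    rw [hsq, mul_pow, hsq]
    calc _ ≤ ∫⁻ x in Metric.ball (0 : Space n) R, (M * ENNReal.ofReal (δ⁻¹ ^ n)) ^ 2 *
          (ENNReal.ofReal (δ ^ n) * V) * ∫⁻ y in Metric.closedBall x δ, ‖v y‖ₑ ^ 2 := by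
          refine setLIntegral_mono' Metric.isOpen_ball.measurableSet fun x hx => ?_
          calc _ ≤ _ := pow_le_pow_left' (hF x hx) 2
            _ ≤ _ := by
              rw [mul_pow, mul_assoc _ (ENNReal.ofReal (δ ^ n) * V)]
              gcongr
              exact hCS x
      _ = (M * ENNReal.ofReal (δ⁻¹ ^ n)) ^ 2 * (ENNReal.ofReal (δ ^ n) * V) *
          ∫⁻ x in Metric.ball (0 : Space n) R, ∫⁻ y in Metric.closedBall x δ, ‖v y‖ₑ ^ 2 := by
          refine lintegral_const_mul'' _ ?_
          have := hmeas.lintegral_prod_right'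
          refine this.congr (ae_of_all _ fun x => ?_)
          simp only
          rw [← lintegral_indicator Metric.isClosed_closedBall.measurableSet]
          rfl
      _ ≤ (M * ENNReal.ofReal (δ⁻¹ ^ n)) ^ 2 * (ENNReal.ofReal (δ ^ n) * V) *
          (ENNReal.ofReal (δ ^ n) * V * ∫⁻ y in Metric.ball (0 : Space n) (R + 2), ‖v y‖ₑ ^ 2) := by
          gcongr
      _ = (M * V) ^ 2 * (ENNReal.ofReal (δ⁻¹ ^ n) * ENNReal.ofReal (δ ^ n)) ^ 2 *
          ∫⁻ y in Metric.ball (0 : Space n) (R + 2), ‖v y‖ₑ ^ 2 := by ring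
      _ = _ := by rw [hδδ, one_pow, mul_one]
  exact (ENNReal.pow_le_pow_left_iff two_ne_zero).1 hfin

end Mollifier

/-! ### Friedrichs commutators -/

section Friedrichs

variable {n : ℕ}

/-- `v ∈ L²_loc(ℝⁿ)`. -/
def MemL2Loc (v : Space n → ℝ) : Prop :=
  ∀ R : ℝ, MemLp v 2 (volume.restrict (Metric.ball (0 : Space n) R))

theorem exists_ball_subset_of_isCompact {K : Set (Space n)} (hK : IsCompact K) :
    ∃ R : ℝ, K ⊆ Metric.ball 0 R := by
  obtain ⟨R, hR⟩ := hK.isBounded.subset_ball (0 : Space n)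
  exact ⟨R, hR⟩

theorem MemL2Loc.locallyIntegrable {v : Space n → ℝ} (hv : MemL2Loc v) : LocallyIntegrable v := by
  rw [locallyIntegrable_iff]
  intro K hK
  obtain ⟨R, hR⟩ := exists_ball_subset_of_isCompact hK
  have : IsFiniteMeasure (volume.restrict (Metric.ball (0 : Space n) R)) :=
    ⟨by simpa using measure_ball_lt_top⟩
  have h1 : IntegrableOn v (Metric.ball 0 R) := (hv R).integrable (by norm_num)
  exact h1.mono_set hR

theorem MemL2Loc.aestronglyMeasurable {v : Space n → ℝ} (hv : MemL2Loc v) :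
    AEStronglyMeasurable v := hv.locallyIntegrable.aestronglyMeasurable

theorem memL2Loc_of_continuous {v : Space n → ℝ} (hv : Continuous v) : MemL2Loc v := fun R => by
  obtain ⟨A, hA⟩ := (isCompact_closedBall (0 : Space n) R).exists_bound_of_continuousOn
    hv.continuousOn
  have : IsFiniteMeasure (volume.restrict (Metric.ball (0 : Space n) R)) :=
    ⟨by simpa using measure_ball_lt_top⟩
  refine MemLp.of_bound hv.aestronglyMeasurable A ?_
  filter_upwards [ae_restrict_mem Metric.isOpen_ball.measurableSet] with x hx
    using hA x (Metric.ball_subset_closedBall hx)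

theorem MemL2Loc.sub {v w : Space n → ℝ} (hv : MemL2Loc v) (hw : MemL2Loc w) : MemL2Loc (v - w) :=
  fun R => (hv R).sub (hw R)

theorem MemL2Loc.add {v w : Space n → ℝ} (hv : MemL2Loc v) (hw : MemL2Loc w) :
    MemL2Loc (fun x => v x + w x) :=
  fun R => (hv R).add (hw R)

theorem MemL2Loc.sum {ι : Type*} {s : Finset ι} {v : ι → Space n → ℝ}
    (hv : ∀ i ∈ s, MemL2Loc (v i)) : MemL2Loc (fun x => ∑ i ∈ s, v i x) :=
  fun R => memLp_finsetSum s fun i hi => hv i hi R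

/-- Multiplication by a continuous function is bounded in `L²` of a ball. -/
theorem exists_eLpNorm_mul_le {a : Space n → ℝ} (ha : Continuous a) (R : ℝ) :
    ∃ C : ℝ≥0, ∀ v : Space n → ℝ,
      eLpNorm (fun x => a x * v x) 2 (volume.restrict (Metric.ball (0 : Space n) R)) ≤
        C * eLpNorm v 2 (volume.restrict (Metric.ball (0 : Space n) R)) := by
  obtain ⟨A, hA⟩ := (isCompact_closedBall (0 : Space n) R).exists_bound_of_continuousOn
    ha.continuousOn
  refine ⟨A.toNNReal, fun v => ?_⟩
  refine eLpNorm_le_nnreal_smul_eLpNorm_of_ae_le_mul (c := A.toNNReal) (f := fun x => a x * v x)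
    ?_ 2
  filter_upwards [ae_restrict_mem Metric.isOpen_ball.measurableSet] with x hx
  rw [nnnorm_mul]
  gcongr
  exact NNReal.le_toNNReal_of_coe_le (hA x (Metric.ball_subset_closedBall hx))

theorem MemL2Loc.continuous_mul {a v : Space n → ℝ} (ha : Continuous a) (hv : MemL2Loc v) :
    MemL2Loc (fun x => a x * v x) := fun R => by
  obtain ⟨C, hC⟩ := exists_eLpNorm_mul_le ha R
  refine ⟨ha.aestronglyMeasurable.mul (hv R).aestronglyMeasurable, (hC v).trans_lt ?_⟩
  exact ENNReal.mul_lt_top ENNReal.coe_lt_top (hv R).eLpNorm_lt_top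

/-- The density argument: operators that are bounded uniformly in `δ` and tend to zero on smooth
compactly supported functions tend to zero on `L²_loc`. -/
theorem tendsto_eLpNorm_of_tendsto_smooth {T : ℝ → (Space n → ℝ) → Space n → ℝ} {R : ℝ}
    {C : ℝ≥0}
    (hsub : ∀ δ, 0 < δ → ∀ v g, MemL2Loc v → ContDiff ℝ ∞ g → HasCompactSupport g →
      T δ v = T δ (v - g) + T δ g)
    (hmeas : ∀ δ, 0 < δ → ∀ v, MemL2Loc v → AEStronglyMeasurable (T δ v))
    (hbound : ∀ δ, 0 < δ → δ ≤ 1 → ∀ v, MemL2Loc v →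
      eLpNorm (T δ v) 2 (volume.restrict (Metric.ball (0 : Space n) R)) ≤
        C * eLpNorm v 2 (volume.restrict (Metric.ball (0 : Space n) (R + 2))))
    (hsmooth : ∀ g, ContDiff ℝ ∞ g → HasCompactSupport g → ∃ K : ℝ, ∀ δ, 0 < δ →
      ∀ x ∈ Metric.ball (0 : Space n) R, |T δ g x| ≤ K * δ)
    {v : Space n → ℝ} (hv : MemL2Loc v) :
    Tendsto (fun δ => eLpNorm (T δ v) 2 (volume.restrict (Metric.ball (0 : Space n) R)))
      (𝓝[>] 0) (𝓝 0) := by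
  set μ := volume.restrict (Metric.ball (0 : Space n) R) with hμ
  have hlim : ∀ g, ContDiff ℝ ∞ g → HasCompactSupport g →
      Tendsto (fun δ => eLpNorm (T δ g) 2 μ) (𝓝[>] 0) (𝓝 0) := by
    intro g hg hgc
    obtain ⟨K, hK⟩ := hsmooth g hg hgc
    have hfin : μ univ ≠ ⊤ := by simp [hμ, measure_ball_lt_top.ne]
    have h1 : Tendsto (fun δ : ℝ => μ univ ^ (2 : ℝ≥0∞).toReal⁻¹ * ENNReal.ofReal (K * δ)) (𝓝[>] 0)
        (𝓝 (μ univ ^ (2 : ℝ≥0∞).toReal⁻¹ * ENNReal.ofReal (K * 0))) := by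
      refine ENNReal.Tendsto.const_mul ?_ (Or.inr (ENNReal.rpow_ne_top_of_nonneg (by simp) hfin))
      refine ENNReal.tendsto_ofReal ?_
      exact ((continuous_const.mul continuous_id).tendsto 0).mono_left nhdsWithin_le_nhds
    rw [mul_zero, ENNReal.ofReal_zero, mul_zero] at h1
    refine tendsto_of_tendsto_of_tendsto_of_le_of_le' tendsto_const_nhds h1
      (Eventually.of_forall fun _ => zero_le) ?_
    filter_upwards [self_mem_nhdsWithin] with δ hδ
    refine eLpNorm_le_of_ae_bound ?_
    filter_upwards [ae_restrict_mem Metric.isOpen_ball.measurableSet] with x hx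
    exact hK δ hδ x hx
  rw [ENNReal.tendsto_nhds_zero]
  intro ε hε
  rcases eq_or_ne ε ⊤ with rfl | hεt
  · exact Eventually.of_forall fun _ => le_top
  set η := (ε / 2 / (C + 1)).toReal with hη
  have hne : ε / 2 / (C + 1) ≠ ⊤ := ENNReal.div_ne_top (ENNReal.div_ne_top hεt (by simp)) (by simp)
  have hη0 : 0 < η := ENNReal.toReal_pos
    (ENNReal.div_pos (ENNReal.div_pos hε.ne' (by simp)).ne' (by simp)).ne' hne
  obtain ⟨g, hgc, hg, hgle⟩ := (hv (R + 2)).exist_eLpNorm_sub_le (by norm_num) (by norm_num) hη0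
  rw [hη, ENNReal.ofReal_toReal hne] at hgle
  have hε2 : 0 < ε / 2 := ENNReal.div_pos hε.ne' (by simp)
  have hvg := hv.sub (memL2Loc_of_continuous hg.continuous)
  filter_upwards [ENNReal.tendsto_nhds_zero.1 (hlim g hg hgc) (ε / 2) hε2,
    Ioc_mem_nhdsGT (zero_lt_one' ℝ)] with δ hδ hδ1
  rw [hsub δ hδ1.1 v g hv hg hgc]
  calc eLpNorm (T δ (v - g) + T δ g) 2 μ ≤ eLpNorm (T δ (v - g)) 2 μ + eLpNorm (T δ g) 2 μ :=
        eLpNorm_add_le (hmeas δ hδ1.1 _ hvg).restrict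
          (hmeas δ hδ1.1 _ (memL2Loc_of_continuous hg.continuous)).restrict (by norm_num)
    _ ≤ C * (ε / 2 / (C + 1)) + ε / 2 := by
        gcongr
        exact (hbound δ hδ1.1 hδ1.2 _ hvg).trans (by gcongr)
    _ ≤ ε / 2 + ε / 2 := by
        gcongr
        calc C * (ε / 2 / (C + 1)) ≤ (C + 1) * (ε / 2 / (C + 1)) := by gcongr; exact le_self_add
          _ ≤ ε / 2 := ENNReal.mul_div_le
    _ = ε := ENNReal.add_halves ε

theorem enorm_integral_mul_le {v k : Space n → ℝ} {κ δ : ℝ} {x : Space n}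
    (hk : ∀ y ∈ Metric.closedBall x δ, |k y| ≤ κ) (hk0 : ∀ y ∉ Metric.closedBall x δ, k y = 0) :
    ‖∫ y, v y * k y‖ₑ ≤ ENNReal.ofReal κ * ∫⁻ y in Metric.closedBall x δ, ‖v y‖ₑ := by
  refine (enorm_integral_le_lintegral_enorm _).trans ?_
  rw [← lintegral_const_mul' _ _ ENNReal.ofReal_ne_top,
    ← lintegral_indicator Metric.isClosed_closedBall.measurableSet]
  refine lintegral_mono fun y => ?_
  by_cases hy : y ∈ Metric.closedBall x δ
  · rw [indicator_of_mem hy, enorm_mul, mul_comm]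
    gcongr
    rw [Real.enorm_eq_ofReal_abs]
    exact ENNReal.ofReal_le_ofReal (hk y hy)
  · simp [hk0 y hy]

theorem mollifier_sub_eq_zero {δ : ℝ} (hδ : 0 < δ) {x y : Space n} (hy : y ∉ Metric.closedBall x δ) :
    mollifier n δ (x - y) = 0 :=
  mollifier_eq_zero hδ (by simpa [dist_eq_norm, norm_sub_rev] using hy)

theorem spacePartial_mollifier_sub_eq_zero {δ : ℝ} (hδ : 0 < δ) {x y : Space n}
    (hy : y ∉ Metric.closedBall x δ) (j : Fin n) : spacePartial (mollifier n δ) j (x - y) = 0 :=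
  spacePartial_mollifier_eq_zero hδ (by simpa [dist_eq_norm, norm_sub_rev] using hy) j

theorem exists_eLpNorm_conv_le (n : ℕ) : ∃ C : ℝ≥0, ∀ R δ : ℝ, 0 < δ → δ ≤ 1 →
    ∀ v : Space n → ℝ, MemL2Loc v →
      eLpNorm (conv v (mollifier n δ)) 2 (volume.restrict (Metric.ball (0 : Space n) R)) ≤
        C * eLpNorm v 2 (volume.restrict (Metric.ball (0 : Space n) (R + 2))) := by
  obtain ⟨M, hM0, hM⟩ := exists_mollifier_bound n
  set V := volume (Metric.closedBall (0 : Space n) 1) with hV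
  have hVt : V ≠ ⊤ := measure_closedBall_lt_top.ne
  refine ⟨(ENNReal.ofReal M * V).toNNReal, fun R δ hδ hδ1 v hv => ?_⟩
  rw [ENNReal.coe_toNNReal (ENNReal.mul_ne_top ENNReal.ofReal_ne_top hVt)]
  refine eLpNorm_le_of_le_average hδ hδ1 hv.aestronglyMeasurable fun x _ => ?_
  rw [← ENNReal.ofReal_mul hM0]
  exact enorm_integral_mul_le (fun y _ => (hM δ hδ _).1) fun y hy => mollifier_sub_eq_zero hδ hy

/-- Mollifications converge in `L²_loc`. -/
theorem tendsto_conv_mollifier {v : Space n → ℝ} (hv : MemL2Loc v) (R : ℝ) :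
    Tendsto (fun δ => eLpNorm (conv v (mollifier n δ) - v) 2
      (volume.restrict (Metric.ball (0 : Space n) R))) (𝓝[>] 0) (𝓝 0) := by
  obtain ⟨C, hC⟩ := exists_eLpNorm_conv_le n
  have hsm : ∀ δ, 0 < δ → ∀ v : Space n → ℝ, MemL2Loc v →
      AEStronglyMeasurable (conv v (mollifier n δ)) := fun δ hδ v hv =>
    (contDiff_conv hv.locallyIntegrable (contDiff_mollifier δ)
      (hasCompactSupport_mollifier hδ)).continuous.aestronglyMeasurable
  refine tendsto_eLpNorm_of_tendsto_smooth (T := fun δ v => conv v (mollifier n δ) - v)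
    (C := C + 1) ?_ ?_ ?_ ?_ hv
  · intro δ hδ v g hv hg _
    rw [conv_sub hv.locallyIntegrable hg.continuous.locallyIntegrable
      (contDiff_mollifier δ).continuous (hasCompactSupport_mollifier hδ)]
    abel
  · intro δ hδ v hv
    exact (hsm δ hδ v hv).sub hv.aestronglyMeasurable
  · intro δ hδ hδ1 v hv
    refine (eLpNorm_sub_le (hsm δ hδ v hv).restrict hv.aestronglyMeasurable.restrict
      (by norm_num)).trans ?_
    rw [ENNReal.coe_add, add_mul, ENNReal.coe_one, one_mul]
    refine add_le_add (hC R δ hδ hδ1 v hv) (eLpNorm_mono_measure _ (Measure.restrict_mono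
      (Metric.ball_subset_ball (by linarith)) le_rfl))
  · intro g hg hgc
    obtain ⟨L, hL⟩ := ContDiff.lipschitzWith_of_hasCompactSupport hgc hg (by simp)
    exact ⟨L, fun δ hδ x _ => abs_conv_mollifier_sub_le hL hδ x⟩

/-- The commutator of mollification with the multiplication by `a`. -/
def commutator (a : Space n → ℝ) (δ : ℝ) (v : Space n → ℝ) (x : Space n) : ℝ :=
  conv (fun y => a y * v y) (mollifier n δ) x - a x * conv v (mollifier n δ) x

/-- The partial derivative of `commutator`. -/
def commutatorPartial (a : Space n → ℝ) (j : Fin n) (δ : ℝ) (v : Space n → ℝ) (x : Space n) : ℝ :=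
  conv (fun y => a y * v y) (spacePartial (mollifier n δ) j) x
    - (spacePartial a j x * conv v (mollifier n δ) x
      + a x * conv v (spacePartial (mollifier n δ) j) x)

theorem contDiff_commutator {a v : Space n → ℝ} (ha : ContDiff ℝ ∞ a) (hv : MemL2Loc v)
    {δ : ℝ} (hδ : 0 < δ) : ContDiff ℝ ∞ (commutator a δ v) :=
  (contDiff_conv (hv.continuous_mul ha.continuous).locallyIntegrable (contDiff_mollifier δ)
    (hasCompactSupport_mollifier hδ)).sub (ha.mul (contDiff_conv hv.locallyIntegrable
      (contDiff_mollifier δ) (hasCompactSupport_mollifier hδ)))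

theorem spacePartial_commutator {a v : Space n → ℝ} (ha : ContDiff ℝ ∞ a) (hv : MemL2Loc v)
    {δ : ℝ} (hδ : 0 < δ) (j : Fin n) :
    spacePartial (commutator a δ v) j = commutatorPartial a j δ v := by
  funext x
  have h1 := contDiff_conv (hv.continuous_mul ha.continuous).locallyIntegrable
    (contDiff_mollifier δ) (hasCompactSupport_mollifier hδ)
  have h2 := contDiff_conv hv.locallyIntegrable (contDiff_mollifier δ)
    (hasCompactSupport_mollifier hδ)
  have : commutator a δ v = fun x => conv (fun y => a y * v y) (mollifier n δ) x
    - a x * conv v (mollifier n δ) x := rfl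
  rw [this, spacePartial_sub (h1.differentiable (by simp) x)
    ((ha.differentiable (by simp) x).fun_mul (h2.differentiable (by simp) x)),
    spacePartial_mul (ha.differentiable (by simp) x) (h2.differentiable (by simp) x),
    spacePartial_conv (hv.continuous_mul ha.continuous).locallyIntegrable (contDiff_mollifier δ)
      (hasCompactSupport_mollifier hδ),
    spacePartial_conv hv.locallyIntegrable (contDiff_mollifier δ) (hasCompactSupport_mollifier hδ)]
  rfl

theorem continuous_commutatorPartial {a v : Space n → ℝ} (ha : ContDiff ℝ ∞ a) (hv : MemL2Loc v)
    {δ : ℝ} (hδ : 0 < δ) (j : Fin n) : Continuous (commutatorPartial a j δ v) := by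
  rw [← spacePartial_commutator ha hv hδ]
  exact continuous_spacePartial ((contDiff_commutator ha hv hδ).of_le (by norm_cast)) j

/-- The commutator is bounded from `L²` to `H¹`, uniformly in the mollification parameter: the
factor `a(y) - a(x)` in its kernel compensates the derivative of the mollifier. -/
theorem exists_eLpNorm_commutatorPartial_le {a : Space n → ℝ} (ha : ContDiff ℝ ∞ a) (j : Fin n)
    (R : ℝ) : ∃ C : ℝ≥0, ∀ δ : ℝ, 0 < δ → δ ≤ 1 → ∀ v : Space n → ℝ, MemL2Loc v →
      eLpNorm (commutatorPartial a j δ v) 2 (volume.restrict (Metric.ball (0 : Space n) R)) ≤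
        C * eLpNorm v 2 (volume.restrict (Metric.ball (0 : Space n) (R + 2))) := by
  obtain ⟨M, hM0, hM⟩ := exists_mollifier_bound n
  obtain ⟨L, hL⟩ := (isCompact_closedBall (0 : Space n) (R + 1)).exists_bound_of_continuousOn
    (ha.continuous_fderiv (by simp)).continuousOn
  set L' := max L 0 with hL'
  have hL0 : 0 ≤ L' := le_max_right _ _
  have hLle : ∀ x ∈ Metric.closedBall (0 : Space n) (R + 1), ‖fderiv ℝ a x‖ ≤ L' := fun x hx =>
    (hL x hx).trans (le_max_left _ _)
  set V := volume (Metric.closedBall (0 : Space n) 1) with hV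
  have hVt : V ≠ ⊤ := measure_closedBall_lt_top.ne
  refine ⟨(ENNReal.ofReal (2 * L' * M) * V).toNNReal, fun δ hδ hδ1 v hv => ?_⟩
  rw [ENNReal.coe_toNNReal (ENNReal.mul_ne_top ENNReal.ofReal_ne_top hVt)]
  refine eLpNorm_le_of_le_average hδ hδ1 hv.aestronglyMeasurable fun x hx => ?_
  have hx' : ‖x‖ < R := by simpa using hx
  have hmC := contDiff_mollifier (n := n) δ
  have hmc := hasCompactSupport_mollifier (n := n) hδ
  have hdC := (contDiff_spacePartial hmC j).continuous
  have hdc := hasCompactSupport_spacePartial hmc j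
  have h1 := integrable_conv_integrand (hv.continuous_mul ha.continuous).locallyIntegrable hdC hdc x
  have h2 := integrable_conv_integrand hv.locallyIntegrable hmC.continuous hmc x
  have h3 := integrable_conv_integrand hv.locallyIntegrable hdC hdc x
  have hker : commutatorPartial a j δ v x = ∫ y, v y *
      ((a y - a x) * spacePartial (mollifier n δ) j (x - y)
        - spacePartial a j x * mollifier n δ (x - y)) := by
    rw [commutatorPartial, conv_apply, conv_apply, conv_apply, ← integral_const_mul,
      ← integral_const_mul, ← integral_add (h2.const_mul _) (h3.const_mul _),
      ← integral_sub h1 ((h2.const_mul _).fun_add (h3.const_mul _))]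
    exact integral_congr_ae (ae_of_all _ fun y => by simp only; ring)
  rw [hker, ← ENNReal.ofReal_mul (by positivity)]
  refine enorm_integral_mul_le (fun y hy => ?_) fun y hy => by
    rw [mollifier_sub_eq_zero hδ hy, spacePartial_mollifier_sub_eq_zero hδ hy]; ring
  have hyx : ‖y - x‖ ≤ δ := by simpa [dist_eq_norm] using hy
  have hy1 : y ∈ Metric.closedBall (0 : Space n) (R + 1) := by
    have : ‖y‖ ≤ ‖y - x‖ + ‖x‖ := by simpa using norm_add_le (y - x) x
    simp; linarith
  have hx1 : x ∈ Metric.closedBall (0 : Space n) (R + 1) := by simp; linarith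
  have hdiff : |a y - a x| ≤ L' * δ := by
    have := (convex_closedBall (0 : Space n) (R + 1)).norm_image_sub_le_of_norm_fderiv_le
      (𝕜 := ℝ) (f := a) (fun z _ => ha.differentiable (by simp) z) hLle hx1 hy1
    exact this.trans (by gcongr)
  have hpart : |spacePartial a j x| ≤ L' := by
    refine ((fderiv ℝ a x).le_opNorm _).trans ?_
    simpa using hLle x hx1
  obtain ⟨hm, hd⟩ := hM δ hδ (x - y)
  calc _ ≤ |a y - a x| * |spacePartial (mollifier n δ) j (x - y)|
        + |spacePartial a j x| * |mollifier n δ (x - y)| := by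
        rw [← abs_mul, ← abs_mul]; exact abs_sub _ _
    _ ≤ (L' * δ) * (M * δ⁻¹ ^ (n + 1)) + L' * (M * δ⁻¹ ^ n) := by
        gcongr
        exact hd j
    _ = 2 * L' * M * δ⁻¹ ^ n := by
        rw [pow_succ]; field_simp; ring

theorem conv_spacePartial {g φ : Space n → ℝ} (hg : ContDiff ℝ ∞ g) (hgc : HasCompactSupport g)
    (hφ : ContDiff ℝ ∞ φ) (hc : HasCompactSupport φ) (j : Fin n) :
    conv g (spacePartial φ j) = conv (spacePartial g j) φ := by
  rw [← spacePartial_conv hg.continuous.locallyIntegrable hφ hc]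
  funext x
  have h := hgc.hasFDerivAt_convolution_left (ContinuousLinearMap.mul ℝ ℝ)
    (hg.of_le (by norm_cast)) (hφ.continuous.locallyIntegrable (μ := volume)) x
  rw [spacePartial, conv, h.fderiv]
  have hi : Integrable fun y =>
      (ContinuousLinearMap.mul ℝ ℝ).precompL (Space n) (fderiv ℝ g y) (φ (x - y)) :=
    hc.convolutionExists_right _ ((hg.continuous_fderiv (by simp)).locallyIntegrable)
      hφ.continuous x
  rw [convolution_def, ContinuousLinearMap.integral_apply hi]
  rfl

/-- **Friedrichs' lemma**: the derivatives of the commutator tend to zero in `L²_loc`. -/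
theorem tendsto_commutatorPartial {a v : Space n → ℝ} (ha : ContDiff ℝ ∞ a) (hv : MemL2Loc v)
    (j : Fin n) (R : ℝ) :
    Tendsto (fun δ => eLpNorm (commutatorPartial a j δ v) 2
      (volume.restrict (Metric.ball (0 : Space n) R))) (𝓝[>] 0) (𝓝 0) := by
  obtain ⟨C, hC⟩ := exists_eLpNorm_commutatorPartial_le ha j R
  refine tendsto_eLpNorm_of_tendsto_smooth (T := fun δ v => commutatorPartial a j δ v) (C := C)
    ?_ ?_ hC ?_ hv
  · intro δ hδ v g hv hg _
    have hmC := contDiff_mollifier (n := n) δ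
    have hmc := hasCompactSupport_mollifier (n := n) hδ
    have hdC := (contDiff_spacePartial hmC j).continuous
    have hdc := hasCompactSupport_spacePartial hmc j
    have hgL := memL2Loc_of_continuous hg.continuous
    have e : (fun y => a y * (v - g) y) = (fun y => a y * v y) - fun y => a y * g y := by
      funext y; simp [mul_sub]
    funext x
    simp only [commutatorPartial, Pi.add_apply]
    rw [e, conv_sub (hv.continuous_mul ha.continuous).locallyIntegrable
      (hgL.continuous_mul ha.continuous).locallyIntegrable hdC hdc,
      conv_sub hv.locallyIntegrable hgL.locallyIntegrable hmC.continuous hmc,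
      conv_sub hv.locallyIntegrable hgL.locallyIntegrable hdC hdc]
    simp only [Pi.sub_apply]
    ring
  · intro δ hδ v hv
    exact (continuous_commutatorPartial ha hv hδ j).aestronglyMeasurable
  · intro g hg hgc
    have hag : ContDiff ℝ ∞ fun y => a y * g y := ha.mul hg
    have hagc : HasCompactSupport fun y => a y * g y := hgc.mul_left
    have lip : ∀ h : Space n → ℝ, ContDiff ℝ ∞ h → HasCompactSupport h →
        ∃ L : ℝ≥0, LipschitzWith L h := fun h hh hhc =>
      ContDiff.lipschitzWith_of_hasCompactSupport hhc hh (by simp)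
    obtain ⟨L₁, hL₁⟩ := lip _ (contDiff_spacePartial hag j) (hasCompactSupport_spacePartial hagc j)
    obtain ⟨L₂, hL₂⟩ := lip _ hg hgc
    obtain ⟨L₃, hL₃⟩ := lip _ (contDiff_spacePartial hg j) (hasCompactSupport_spacePartial hgc j)
    obtain ⟨A, hA⟩ := (isCompact_closedBall (0 : Space n) R).exists_bound_of_continuousOn
      ha.continuous.continuousOn
    obtain ⟨A', hA'⟩ := (isCompact_closedBall (0 : Space n) R).exists_bound_of_continuousOn
      (contDiff_spacePartial ha j).continuous.continuousOn
    refine ⟨L₁ + A' * L₂ + A * L₃, fun δ hδ x hx => ?_⟩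
    have hmC := contDiff_mollifier (n := n) δ
    have hmc := hasCompactSupport_mollifier (n := n) hδ
    have hxc := Metric.ball_subset_closedBall hx
    have b1 := abs_conv_mollifier_sub_le hL₁ hδ x
    have b2 := abs_conv_mollifier_sub_le hL₂ hδ x
    have b3 := abs_conv_mollifier_sub_le hL₃ hδ x
    have hAx : |a x| ≤ A := hA x hxc
    have hA'x : |spacePartial a j x| ≤ A' := hA' x hxc
    have hid : commutatorPartial a j δ g x =
        (conv (spacePartial (fun y => a y * g y) j) (mollifier n δ) x
          - spacePartial (fun y => a y * g y) j x)
        - spacePartial a j x * (conv g (mollifier n δ) x - g x)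
        - a x * (conv (spacePartial g j) (mollifier n δ) x - spacePartial g j x) := by
      rw [commutatorPartial, conv_spacePartial hag hagc hmC hmc, conv_spacePartial hg hgc hmC hmc,
        spacePartial_mul (ha.differentiable (by simp) x) (hg.differentiable (by simp) x)]
      ring
    rw [hid]
    calc _ ≤ L₁ * δ + A' * (L₂ * δ) + A * (L₃ * δ) := by
          refine (abs_sub _ _).trans (add_le_add ((abs_sub _ _).trans (add_le_add b1 ?_)) ?_)
          · rw [abs_mul]
            exact mul_le_mul hA'x b2 (abs_nonneg _) ((abs_nonneg _).trans hA'x)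
          · rw [abs_mul]
            exact mul_le_mul hAx b3 (abs_nonneg _) ((abs_nonneg _).trans hAx)
      _ = _ := by ring

theorem tendsto_commutator {a v : Space n → ℝ} (ha : Continuous a) (hv : MemL2Loc v) (R : ℝ) :
    Tendsto (fun δ => eLpNorm (commutator a δ v) 2
      (volume.restrict (Metric.ball (0 : Space n) R))) (𝓝[>] 0) (𝓝 0) := by
  obtain ⟨C, hC⟩ := exists_eLpNorm_mul_le ha R
  have h1 := tendsto_conv_mollifier (hv.continuous_mul ha) R
  have h2 := ENNReal.Tendsto.const_mul (a := C) (tendsto_conv_mollifier hv R)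
    (Or.inr ENNReal.coe_ne_top)
  have h3 := h1.add h2
  rw [mul_zero, add_zero] at h3
  refine tendsto_of_tendsto_of_tendsto_of_le_of_le' tendsto_const_nhds h3
    (Eventually.of_forall fun _ => zero_le) ?_
  filter_upwards [self_mem_nhdsWithin] with δ hδ
  have hcont : ∀ {w : Space n → ℝ}, MemL2Loc w →
      AEStronglyMeasurable (conv w (mollifier n δ) - w) := fun hw =>
    (contDiff_conv hw.locallyIntegrable (contDiff_mollifier δ)
      (hasCompactSupport_mollifier hδ)).continuous.aestronglyMeasurable.sub hw.aestronglyMeasurable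
  have e : commutator a δ v = (conv (fun y => a y * v y) (mollifier n δ) - fun y => a y * v y)
      - fun x => a x * (conv v (mollifier n δ) - v) x := by
    funext x
    simp only [commutator, Pi.sub_apply]
    ring
  rw [e]
  refine (eLpNorm_sub_le (hcont (hv.continuous_mul ha)).restrict
    (ha.aestronglyMeasurable.mul (hcont hv)).restrict (by norm_num)).trans ?_
  exact add_le_add le_rfl (hC _)

theorem exists_eLpNorm_commutator_le {a : Space n → ℝ} (ha : Continuous a) (R : ℝ) :
    ∃ C : ℝ≥0, ∀ δ : ℝ, 0 < δ → δ ≤ 1 → ∀ v : Space n → ℝ, MemL2Loc v →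
      eLpNorm (commutator a δ v) 2 (volume.restrict (Metric.ball (0 : Space n) R)) ≤
        C * eLpNorm v 2 (volume.restrict (Metric.ball (0 : Space n) (R + 2))) := by
  obtain ⟨C₁, hC₁⟩ := exists_eLpNorm_mul_le ha R
  obtain ⟨C₂, hC₂⟩ := exists_eLpNorm_mul_le ha (R + 2)
  obtain ⟨C, hC⟩ := exists_eLpNorm_conv_le n
  refine ⟨C * C₂ + C₁ * C, fun δ hδ hδ1 v hv => ?_⟩
  have hcont : ∀ {w : Space n → ℝ}, MemL2Loc w →
      AEStronglyMeasurable (conv w (mollifier n δ)) := fun hw =>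
    (contDiff_conv hw.locallyIntegrable (contDiff_mollifier δ)
      (hasCompactSupport_mollifier hδ)).continuous.aestronglyMeasurable
  refine (eLpNorm_sub_le (f := conv (fun y => a y * v y) (mollifier n δ))
    (g := fun x => a x * conv v (mollifier n δ) x) (hcont (hv.continuous_mul ha)).restrict
    (ha.aestronglyMeasurable.mul (hcont hv)).restrict (by norm_num)).trans ?_
  push_cast
  rw [add_mul]
  refine add_le_add ?_ ?_
  · rw [mul_assoc]
    exact (hC R δ hδ hδ1 _ (hv.continuous_mul ha)).trans (by gcongr; exact hC₂ v)
  · rw [mul_assoc]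
    exact (hC₁ _).trans (by gcongr; exact hC R δ hδ hδ1 v hv)

end Friedrichs

/-! ### Mollification of time dependent functions -/

section TimeDependent

variable {n : ℕ} {I : Set ℝ}

theorem norm_state_le (z : State n) : ‖z‖ ≤ ‖z.1‖ + ‖z.2.1‖ + ∑ j, ‖z.2.2 j‖ := by
  have h0 : 0 ≤ ∑ j, ‖z.2.2 j‖ := Finset.sum_nonneg fun j _ => norm_nonneg _
  have h2 := norm_nonneg z.1
  have h3 := norm_nonneg z.2.1
  rw [Prod.norm_def, Prod.norm_def]
  refine max_le ?_ (max_le ?_ ((pi_norm_le_iff_of_nonneg (by positivity)).2 fun j => ?_))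
  · linarith
  · linarith
  · have h4 : ‖z.2.2 j‖ ≤ ∑ j, ‖z.2.2 j‖ :=
      Finset.single_le_sum (f := fun j => ‖z.2.2 j‖) (fun j _ => norm_nonneg _) (Finset.mem_univ j)
    linarith

theorem ContinuousL2Loc.memL2Loc {f : ℝ → Space n → ℝ} (hf : ContinuousL2Loc I f) {t : ℝ}
    (ht : t ∈ I) : MemL2Loc (f t) := hf.memLp t ht

theorem ContinuousL2Loc.exists_bound {f : ℝ → Space n → ℝ} (hf : ContinuousL2Loc I f)
    (hI : IsCompact I) (R : ℝ) : ∃ C : ℝ≥0, ∀ t ∈ I,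
      eLpNorm (f t) 2 (volume.restrict (Metric.ball (0 : Space n) R)) ≤ C := by
  refine hI.induction_on (p := fun s => ∃ C : ℝ≥0, ∀ t ∈ s, t ∈ I →
      eLpNorm (f t) 2 (volume.restrict (Metric.ball (0 : Space n) R)) ≤ C)
    ⟨0, by simp⟩ ?_ ?_ ?_ |>.imp fun C hC t ht => hC t ht ht
  · rintro s s' hs ⟨C, hC⟩
    exact ⟨C, fun t ht => hC t (hs ht)⟩
  · rintro s s' ⟨C, hC⟩ ⟨C', hC'⟩
    refine ⟨max C C', ?_⟩
    rintro t (ht | ht) htI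
    · exact (hC t ht htI).trans (by exact_mod_cast le_max_left _ _)
    · exact (hC' t ht htI).trans (by exact_mod_cast le_max_right _ _)
  · intro t ht
    have h1 := (ENNReal.tendsto_nhds_zero.1 (hf.tendsto t ht R)) 1 one_pos
    refine ⟨_, inter_mem h1 self_mem_nhdsWithin, (eLpNorm (f t) 2
      (volume.restrict (Metric.ball (0 : Space n) R))).toNNReal + 1, ?_⟩
    rintro s ⟨hs, hsI⟩ -
    push_cast
    rw [ENNReal.coe_toNNReal (hf.memLp t ht R).eLpNorm_ne_top, add_comm]
    have e : f s = (f s - f t) + f t := by abel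
    calc _ = eLpNorm ((f s - f t) + f t) 2 (volume.restrict (Metric.ball (0 : Space n) R)) := by
          rw [← e]
      _ ≤ _ := eLpNorm_add_le ((hf.memLp s hsI R).sub (hf.memLp t ht R)).aestronglyMeasurable
        (hf.memLp t ht R).aestronglyMeasurable (by norm_num)
      _ ≤ _ := by gcongr; exact hs

/-- Convolution with a fixed test function is controlled pointwise by a local `L²` norm. -/
theorem exists_enorm_conv_le {φ : Space n → ℝ} (hφ : Continuous φ) (hc : HasCompactSupport φ)
    (R : ℝ) : ∃ (C : ℝ≥0) (R' : ℝ), ∀ v : Space n → ℝ, MemL2Loc v →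
      ∀ x ∈ Metric.ball (0 : Space n) R,
        ‖conv v φ x‖ₑ ≤ C * eLpNorm v 2 (volume.restrict (Metric.ball (0 : Space n) R')) := by
  obtain ⟨A, hA⟩ := hc.exists_bound_of_continuous hφ
  obtain ⟨r, hr⟩ := exists_ball_subset_of_isCompact hc
  set μ := volume.restrict (Metric.ball (0 : Space n) (R + r)) with hμ
  have hfin : μ univ ≠ ⊤ := by simp [hμ, measure_ball_lt_top.ne]
  refine ⟨(ENNReal.ofReal A * μ univ ^ (1 / (1 : ℝ≥0∞).toReal - 1 / (2 : ℝ≥0∞).toReal)).toNNReal,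
    R + r, fun v hv x hx => ?_⟩
  rw [ENNReal.coe_toNNReal (ENNReal.mul_ne_top ENNReal.ofReal_ne_top
    (ENNReal.rpow_ne_top_of_nonneg (by norm_num) hfin))]
  have h1 : ‖conv v φ x‖ₑ ≤ ENNReal.ofReal A * ∫⁻ y in Metric.ball (0 : Space n) (R + r), ‖v y‖ₑ := by
    rw [conv_apply]
    refine (enorm_integral_le_lintegral_enorm _).trans ?_
    rw [← lintegral_const_mul' _ _ ENNReal.ofReal_ne_top,
      ← lintegral_indicator Metric.isOpen_ball.measurableSet]
    refine lintegral_mono fun y => ?_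
    by_cases hy : y ∈ Metric.ball (0 : Space n) (R + r)
    · rw [indicator_of_mem hy, enorm_mul, mul_comm]
      gcongr
      rw [Real.enorm_eq_ofReal_abs]
      exact ENNReal.ofReal_le_ofReal (hA _)
    · have : φ (x - y) = 0 := by
        by_contra h
        have h2 : x - y ∈ Metric.ball (0 : Space n) r := hr (subset_tsupport φ h)
        have h3 : ‖y‖ ≤ ‖x‖ + ‖x - y‖ := by simpa using norm_sub_le x (x - y)
        simp only [Metric.mem_ball, dist_zero_right] at hy hx h2
        linarith
      simp [this]
  refine h1.trans ?_
  have h2 := eLpNorm_le_eLpNorm_mul_rpow_measure_univ (p := 1) (q := 2) (by norm_num)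
    ((hv (R + r)).aestronglyMeasurable)
  rw [eLpNorm_one_eq_lintegral_enorm] at h2
  rw [mul_assoc]
  gcongr
  rw [mul_comm]
  exact h2

theorem ContinuousL2Loc.continuousOn_conv {f : ℝ → Space n → ℝ} (hf : ContinuousL2Loc I f)
    {φ : Space n → ℝ} (hφ : ContDiff ℝ ∞ φ) (hc : HasCompactSupport φ) :
    ContinuousOn (fun q : ℝ × Space n => conv (f q.1) φ q.2) (I ×ˢ univ) := by
  rintro ⟨t, x⟩ ⟨ht, -⟩
  obtain ⟨C, R', hC⟩ := exists_enorm_conv_le hφ.continuous hc (‖x‖ + 1)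
  have hfst : Tendsto (fun q : ℝ × Space n => q.1) (𝓝[I ×ˢ univ] (t, x)) (𝓝[I] t) :=
    tendsto_nhdsWithin_of_tendsto_nhds_of_eventually_within _
      (continuous_fst.continuousAt.tendsto.mono_left nhdsWithin_le_nhds)
      (by filter_upwards [self_mem_nhdsWithin] with q hq using hq.1)
  have h1 : Tendsto (fun q : ℝ × Space n => conv (f q.1 - f t) φ q.2) (𝓝[I ×ˢ univ] (t, x))
      (𝓝 0) := by
    rw [tendsto_zero_iff_enorm_tendsto_zero]
    have h2 := ENNReal.Tendsto.const_mul (a := C) ((hf.tendsto t ht R').comp hfst)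
      (Or.inr ENNReal.coe_ne_top)
    rw [mul_zero] at h2
    refine tendsto_of_tendsto_of_tendsto_of_le_of_le' tendsto_const_nhds h2
      (Eventually.of_forall fun _ => zero_le) ?_
    have hx : ∀ᶠ q : ℝ × Space n in 𝓝[I ×ˢ univ] (t, x), q.2 ∈ Metric.ball (0 : Space n) (‖x‖ + 1) :=
      mem_nhdsWithin_of_mem_nhds (continuous_snd.continuousAt
        (Metric.isOpen_ball.mem_nhds (by simp)))
    filter_upwards [hx, self_mem_nhdsWithin] with q hq hqI
    exact hC _ ((hf.memL2Loc hqI.1).sub (hf.memL2Loc ht)) _ hq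
  have h3 : Tendsto (fun q : ℝ × Space n => conv (f t) φ q.2) (𝓝[I ×ˢ univ] (t, x))
      (𝓝 (conv (f t) φ x)) :=
    ((contDiff_conv (hf.memL2Loc ht).locallyIntegrable hφ hc).continuous.comp
      continuous_snd).continuousAt.tendsto.mono_left nhdsWithin_le_nhds
  have h4 := h1.add h3
  rw [zero_add] at h4
  refine h4.congr' ?_
  filter_upwards [self_mem_nhdsWithin] with q hq
  rw [conv_sub (hf.memL2Loc hq.1).locallyIntegrable (hf.memL2Loc ht).locallyIntegrable
    hφ.continuous hc, Pi.sub_apply, sub_add_cancel]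

theorem HasDerivL2Loc.hasDerivAt_conv {f f' : ℝ → Space n → ℝ} (h : HasDerivL2Loc I f f')
    (hf : ContinuousL2Loc I f) (hf' : ContinuousL2Loc I f') {φ : Space n → ℝ}
    (hφ : ContDiff ℝ ∞ φ) (hc : HasCompactSupport φ) {t : ℝ} (ht : I ∈ 𝓝 t) (x : Space n) :
    HasDerivAt (fun s => conv (f s) φ x) (conv (f' t) φ x) t := by
  have htI : t ∈ I := mem_of_mem_nhds ht
  obtain ⟨C, R', hC⟩ := exists_enorm_conv_le hφ.continuous hc (‖x‖ + 1)
  have hN : 𝓝[I \ {t}] t = 𝓝[≠] t := by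
    rw [sdiff_eq, inter_comm, nhdsWithin_inter_of_mem']
    exact mem_nhdsWithin_of_mem_nhds ht
  rw [hasDerivAt_iff_tendsto_slope, ← tendsto_sub_nhds_zero_iff, tendsto_zero_iff_enorm_tendsto_zero]
  have h2 := ENNReal.Tendsto.const_mul (a := C) (h t htI R') (Or.inr ENNReal.coe_ne_top)
  rw [mul_zero, hN] at h2
  refine tendsto_of_tendsto_of_tendsto_of_le_of_le' tendsto_const_nhds h2
    (Eventually.of_forall fun _ => zero_le) ?_
  filter_upwards [mem_nhdsWithin_of_mem_nhds ht] with s hs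
  have hd := (hf.memL2Loc hs).sub (hf.memL2Loc htI)
  have hq : MemL2Loc ((s - t)⁻¹ • (f s - f t)) := fun R => (hd R).const_smul _
  have := hC _ (hq.sub (hf'.memL2Loc htI)) x (by simp)
  rw [conv_sub hq.locallyIntegrable (hf'.memL2Loc htI).locallyIntegrable hφ.continuous hc,
    conv_smul, conv_sub (hf.memL2Loc hs).locallyIntegrable (hf.memL2Loc htI).locallyIntegrable
      hφ.continuous hc] at this
  simpa [slope_def_field, div_eq_inv_mul] using this

theorem ContinuousL2Loc.continuous_mul {f : ℝ → Space n → ℝ} (hf : ContinuousL2Loc I f)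
    {a : Space n → ℝ} (ha : Continuous a) : ContinuousL2Loc I fun t x => a x * f t x where
  memLp t ht := (hf.memL2Loc ht).continuous_mul ha
  tendsto t ht R := by
    obtain ⟨C, hC⟩ := exists_eLpNorm_mul_le ha R
    have h2 := ENNReal.Tendsto.const_mul (a := C) (hf.tendsto t ht R) (Or.inr ENNReal.coe_ne_top)
    rw [mul_zero] at h2
    refine tendsto_of_tendsto_of_tendsto_of_le_of_le tendsto_const_nhds h2 (fun _ => zero_le)
      fun s => ?_
    refine le_trans (le_of_eq ?_) (hC (f s - f t))
    congr 1
    funext x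
    simp [mul_sub]

theorem ContinuousL2Loc.add {f f' : ℝ → Space n → ℝ} (hf : ContinuousL2Loc I f)
    (hf' : ContinuousL2Loc I f') : ContinuousL2Loc I fun t x => f t x + f' t x where
  memLp t ht := (hf.memL2Loc ht).add (hf'.memL2Loc ht)
  tendsto t ht R := by
    have h2 := (hf.tendsto t ht R).add (hf'.tendsto t ht R)
    rw [add_zero] at h2
    refine tendsto_of_tendsto_of_tendsto_of_le_of_le' tendsto_const_nhds h2
      (Eventually.of_forall fun _ => zero_le) ?_
    filter_upwards [self_mem_nhdsWithin] with s hs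
    refine le_trans (le_of_eq ?_) (eLpNorm_add_le
      ((hf.memLp s hs R).sub (hf.memLp t ht R)).aestronglyMeasurable
      ((hf'.memLp s hs R).sub (hf'.memLp t ht R)).aestronglyMeasurable (by norm_num))
    congr 1
    funext x
    simp only [Pi.sub_apply, Pi.add_apply]
    ring

theorem continuousL2Loc_zero : ContinuousL2Loc I fun _ (_ : Space n) => (0 : ℝ) where
  memLp _ _ := memL2Loc_of_continuous continuous_const
  tendsto t _ R := by
    have : ((fun _ => (0 : ℝ)) - fun _ => 0 : Space n → ℝ) = 0 := sub_self _
    simp only [this, eLpNorm_zero]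
    exact tendsto_const_nhds

theorem ContinuousL2Loc.sum {ι : Type*} {s : Finset ι} {f : ι → ℝ → Space n → ℝ}
    (hf : ∀ i ∈ s, ContinuousL2Loc I (f i)) : ContinuousL2Loc I fun t x => ∑ i ∈ s, f i t x := by
  classical
  induction s using Finset.induction_on with
  | empty => simpa using continuousL2Loc_zero
  | insert i s hi ih =>
    simp only [Finset.sum_insert hi]
    exact (hf i (Finset.mem_insert_self _ _)).add
      (ih fun k hk => hf k (Finset.mem_insert_of_mem hk))

/-- A family of functions of `x`, indexed by the mollification parameter and the time, that tends
to zero in `L²` of the ball of radius `R` for every time, and is bounded uniformly in time. -/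
structure Negligible {F : Type*} [NormedAddCommGroup F] (I : Set ℝ) (R : ℝ)
    (f : ℝ → ℝ → Space n → F) : Prop where
  meas : ∀ δ, 0 < δ → ∀ s ∈ I, AEStronglyMeasurable (f δ s)
  tendsto : ∀ s ∈ I, Tendsto (fun δ =>
    eLpNorm (f δ s) 2 (volume.restrict (Metric.ball (0 : Space n) R))) (𝓝[>] 0) (𝓝 0)
  bound : ∃ C : ℝ≥0, ∀ δ, 0 < δ → δ ≤ 1 → ∀ s ∈ I,
    eLpNorm (f δ s) 2 (volume.restrict (Metric.ball (0 : Space n) R)) ≤ C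

namespace Negligible

variable {F : Type*} [NormedAddCommGroup F] {R : ℝ}

theorem of_le {f : ℝ → ℝ → Space n → F} {g : ℝ → ℝ → Space n → ℝ} (hg : Negligible I R g)
    (hm : ∀ δ, 0 < δ → ∀ s ∈ I, AEStronglyMeasurable (f δ s))
    (hle : ∀ δ, 0 < δ → ∀ s ∈ I, ∀ x, ‖f δ s x‖ ≤ ‖g δ s x‖) : Negligible I R f where
  meas := hm
  tendsto s hs := by
    refine tendsto_of_tendsto_of_tendsto_of_le_of_le' tendsto_const_nhds (hg.tendsto s hs)
      (Eventually.of_forall fun _ => zero_le) ?_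
    filter_upwards [self_mem_nhdsWithin] with δ hδ
    exact eLpNorm_mono (hle δ hδ s hs)
  bound := by
    obtain ⟨C, hC⟩ := hg.bound
    exact ⟨C, fun δ hδ hδ1 s hs => (eLpNorm_mono (hle δ hδ s hs)).trans (hC δ hδ hδ1 s hs)⟩

theorem congr {f g : ℝ → ℝ → Space n → F} (hf : Negligible I R f)
    (he : ∀ δ, 0 < δ → ∀ s ∈ I, f δ s = g δ s) : Negligible I R g where
  meas δ hδ s hs := he δ hδ s hs ▸ hf.meas δ hδ s hs
  tendsto s hs := by
    refine (hf.tendsto s hs).congr' ?_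
    filter_upwards [self_mem_nhdsWithin] with δ hδ
    rw [he δ hδ s hs]
  bound := by
    obtain ⟨C, hC⟩ := hf.bound
    exact ⟨C, fun δ hδ hδ1 s hs => he δ hδ s hs ▸ hC δ hδ hδ1 s hs⟩

theorem add {f g : ℝ → ℝ → Space n → F} (hf : Negligible I R f) (hg : Negligible I R g) :
    Negligible I R fun δ s x => f δ s x + g δ s x where
  meas δ hδ s hs := (hf.meas δ hδ s hs).add (hg.meas δ hδ s hs)
  tendsto s hs := by
    have h2 := (hf.tendsto s hs).add (hg.tendsto s hs)
    rw [add_zero] at h2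
    refine tendsto_of_tendsto_of_tendsto_of_le_of_le' tendsto_const_nhds h2
      (Eventually.of_forall fun _ => zero_le) ?_
    filter_upwards [self_mem_nhdsWithin] with δ hδ
    exact eLpNorm_add_le (hf.meas δ hδ s hs).restrict (hg.meas δ hδ s hs).restrict (by norm_num)
  bound := by
    obtain ⟨C, hC⟩ := hf.bound
    obtain ⟨C', hC'⟩ := hg.bound
    refine ⟨C + C', fun δ hδ hδ1 s hs => ?_⟩
    push_cast
    exact (eLpNorm_add_le (hf.meas δ hδ s hs).restrict (hg.meas δ hδ s hs).restrict
      (by norm_num)).trans (add_le_add (hC δ hδ hδ1 s hs) (hC' δ hδ hδ1 s hs))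

theorem zero : Negligible I R fun _ _ (_ : Space n) => (0 : F) where
  meas _ _ _ _ := aestronglyMeasurable_const
  tendsto s _ := by
    have : (fun _ => 0 : Space n → F) = 0 := rfl
    simp only [this, eLpNorm_zero]
    exact tendsto_const_nhds
  bound := ⟨0, fun δ _ _ s _ => by
    have : (fun _ => 0 : Space n → F) = 0 := rfl
    simp [this]⟩

theorem sum {ι : Type*} {s : Finset ι} {f : ι → ℝ → ℝ → Space n → F}
    (hf : ∀ i ∈ s, Negligible I R (f i)) : Negligible I R fun δ t x => ∑ i ∈ s, f i δ t x := by
  classical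
  induction s using Finset.induction_on with
  | empty => simpa using zero
  | insert i s hi ih =>
    simp only [Finset.sum_insert hi]
    exact (hf i (Finset.mem_insert_self _ _)).add
      (ih fun k hk => hf k (Finset.mem_insert_of_mem hk))

theorem norm {f : ℝ → ℝ → Space n → F} (hf : Negligible I R f) :
    Negligible I R fun δ s x => ‖f δ s x‖ where
  meas δ hδ s hs := (hf.meas δ hδ s hs).norm
  tendsto s hs := by simpa only [eLpNorm_norm] using hf.tendsto s hs
  bound := by simpa only [eLpNorm_norm] using hf.bound

/-- A family of states is negligible as soon as all its components are. -/
theorem state {r q : ℝ → ℝ → Space n → ℝ} {p : Fin n → ℝ → ℝ → Space n → ℝ}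
    (hr : Negligible I R r) (hq : Negligible I R q) (hp : ∀ j, Negligible I R (p j)) :
    Negligible I R fun δ s x => ((r δ s x, q δ s x, fun j => p j δ s x) : State n) := by
  refine of_le ((hr.norm.add hq.norm).add (Negligible.sum (s := Finset.univ)
    fun j _ => (hp j).norm)) (fun δ hδ s hs => ?_) fun δ hδ s hs x => ?_
  · exact (hr.meas δ hδ s hs).prodMk ((hq.meas δ hδ s hs).prodMk
      (aemeasurable_pi_lambda _ fun j => ((hp j).meas δ hδ s hs).aemeasurable).aestronglyMeasurable)
  · exact (norm_state_le _).trans (le_abs_self _)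

end Negligible

theorem ContinuousL2Loc.negligible_commutator {f : ℝ → Space n → ℝ} (hf : ContinuousL2Loc I f)
    (hI : IsCompact I) {a : Space n → ℝ} (ha : ContDiff ℝ ∞ a) (R : ℝ) :
    Negligible I R fun δ s => commutator a δ (f s) where
  meas _ hδ _ hs := (contDiff_commutator ha (hf.memL2Loc hs) hδ).continuous.aestronglyMeasurable
  tendsto _ hs := tendsto_commutator ha.continuous (hf.memL2Loc hs) R
  bound := by
    obtain ⟨C, hC⟩ := exists_eLpNorm_commutator_le ha.continuous R
    obtain ⟨C', hC'⟩ := hf.exists_bound hI (R + 2)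
    refine ⟨C * C', fun δ hδ hδ1 s hs => (hC δ hδ hδ1 _ (hf.memL2Loc hs)).trans ?_⟩
    push_cast
    gcongr
    exact hC' s hs

theorem ContinuousL2Loc.negligible_commutatorPartial {f : ℝ → Space n → ℝ}
    (hf : ContinuousL2Loc I f) (hI : IsCompact I) {a : Space n → ℝ} (ha : ContDiff ℝ ∞ a)
    (j : Fin n) (R : ℝ) : Negligible I R fun δ s => commutatorPartial a j δ (f s) where
  meas _ hδ _ hs := (continuous_commutatorPartial ha (hf.memL2Loc hs) hδ j).aestronglyMeasurable
  tendsto _ hs := tendsto_commutatorPartial ha (hf.memL2Loc hs) j R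
  bound := by
    obtain ⟨C, hC⟩ := exists_eLpNorm_commutatorPartial_le ha j R
    obtain ⟨C', hC'⟩ := hf.exists_bound hI (R + 2)
    refine ⟨C * C', fun δ hδ hδ1 s hs => (hC δ hδ hδ1 _ (hf.memL2Loc hs)).trans ?_⟩
    push_cast
    gcongr
    exact hC' s hs

theorem ContinuousL2Loc.negligible_conv_sub {f : ℝ → Space n → ℝ} (hf : ContinuousL2Loc I f)
    (hI : IsCompact I) (R : ℝ) :
    Negligible I R fun δ s => conv (f s) (mollifier n δ) - f s where
  meas _ hδ _ hs := (contDiff_conv (hf.memL2Loc hs).locallyIntegrable (contDiff_mollifier _)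
    (hasCompactSupport_mollifier hδ)).continuous.aestronglyMeasurable.sub
      (hf.memL2Loc hs).aestronglyMeasurable
  tendsto _ hs := tendsto_conv_mollifier (hf.memL2Loc hs) R
  bound := by
    obtain ⟨C, hC⟩ := exists_eLpNorm_conv_le n
    obtain ⟨C', hC'⟩ := hf.exists_bound hI (R + 2)
    obtain ⟨C'', hC''⟩ := hf.exists_bound hI R
    refine ⟨C * C' + C'', fun δ hδ hδ1 s hs => ?_⟩
    refine (eLpNorm_sub_le (contDiff_conv (hf.memL2Loc hs).locallyIntegrable (contDiff_mollifier _)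
      (hasCompactSupport_mollifier hδ)).continuous.aestronglyMeasurable
      (hf.memL2Loc hs).aestronglyMeasurable.restrict (by norm_num)).trans ?_
    push_cast
    refine add_le_add ((hC R δ hδ hδ1 _ (hf.memL2Loc hs)).trans ?_) (hC'' s hs)
    gcongr
    exact hC' s hs

end TimeDependent

/-! ### Weak solutions of the first order system -/

section WeakSystem

variable {n : ℕ}

/-- The state `(u, m, p)` assembled from its components. -/
def weakState (u m : ℝ → Space n → ℝ) (p : Fin n → ℝ → Space n → ℝ) (t : ℝ) (x : Space n) :
    State n :=
  (u t x, m t x, fun j => p j t x)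

/-- `(u, m)` is a weak solution on `[t₀, T]` of `u_t = b m + N·∇u`, `m_t = div (N m + e ∇u)` with
`ut = u_t` and `p = ∇u`; the second equation is tested with functions of `x` only. -/
structure IsWeakSystem (a : WaveCoeff n) (t₀ T : ℝ) (u m ut : ℝ → Space n → ℝ)
    (p : Fin n → ℝ → Space n → ℝ) : Prop where
  continuous_u : ContinuousL2Loc (Icc t₀ T) u
  continuous_m : ContinuousL2Loc (Icc t₀ T) m
  continuous_ut : ContinuousL2Loc (Icc t₀ T) ut
  continuous_p : ∀ j, ContinuousL2Loc (Icc t₀ T) (p j)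
  deriv_u : HasDerivL2Loc (Icc t₀ T) u ut
  grad_u : ∀ t ∈ Icc t₀ T, ∀ φ : Space n → ℝ, ContDiff ℝ ∞ φ → HasCompactSupport φ → ∀ j,
    ∫ x, u t x * spacePartial φ j x = -∫ x, p j t x * φ x
  ut_eq : ∀ t ∈ Icc t₀ T, ∀ x, ut t x = velocity (a.val x) (weakState u m p t x)
  deriv_m : ∀ t ∈ Ioo t₀ T, ∀ φ : Space n → ℝ, ContDiff ℝ ∞ φ → HasCompactSupport φ →
    HasDerivAt (fun s => ∫ x, m s x * φ x)
      (-∑ j, ∫ x, momentumFlux (a.val x) (weakState u m p t x) j * spacePartial φ j x) t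

/-- Mollification in the space variables, at every time. -/
def mollify (δ : ℝ) (f : ℝ → Space n → ℝ) (t : ℝ) : Space n → ℝ := conv (f t) (mollifier n δ)

variable {a : WaveCoeff n} {t₀ T : ℝ} {u m ut : ℝ → Space n → ℝ} {p : Fin n → ℝ → Space n → ℝ}

theorem spacePartial_comp_sub_left {φ : Space n → ℝ} (hφ : ContDiff ℝ ∞ φ) (x : Space n)
    (j : Fin n) (y : Space n) :
    spacePartial (fun z => φ (x - z)) j y = -spacePartial φ j (x - y) := by
  have h := (hφ.differentiable (by simp) (x - y)).hasFDerivAt.comp y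
    ((hasFDerivAt_id y).const_sub x)
  have h2 : fderiv ℝ (fun z => φ (x - z)) y = _ := h.fderiv
  rw [spacePartial, h2]
  simp [spacePartial]

theorem hasCompactSupport_comp_sub_left {φ : Space n → ℝ} (hc : HasCompactSupport φ)
    (x : Space n) : HasCompactSupport fun z => φ (x - z) :=
  hc.comp_homeomorph (Homeomorph.subLeft x)

namespace IsWeakSystem

/-- The time derivative of the mollification of `m`. -/
def mollifiedDeriv (a : WaveCoeff n) (u m : ℝ → Space n → ℝ) (p : Fin n → ℝ → Space n → ℝ)
    (δ t : ℝ) (x : Space n) : ℝ :=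
  ∑ j, conv (fun y => momentumFlux (a.val y) (weakState u m p t y) j)
    (spacePartial (mollifier n δ) j) x

theorem conv_spacePartial_eq (h : IsWeakSystem a t₀ T u m ut p) {t : ℝ} (ht : t ∈ Icc t₀ T)
    {φ : Space n → ℝ} (hφ : ContDiff ℝ ∞ φ) (hc : HasCompactSupport φ) (j : Fin n) :
    conv (u t) (spacePartial φ j) = conv (p j t) φ := by
  funext x
  have h1 := h.grad_u t ht (fun z => φ (x - z)) (hφ.comp (contDiff_const.sub contDiff_id))
    (hasCompactSupport_comp_sub_left hc x) j
  simp only [spacePartial_comp_sub_left hφ, mul_neg, integral_neg, neg_inj] at h1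
  exact h1

theorem spacePartial_mollify (h : IsWeakSystem a t₀ T u m ut p) {t : ℝ} (ht : t ∈ Icc t₀ T)
    {δ : ℝ} (hδ : 0 < δ) (j : Fin n) : spacePartial (mollify δ u t) j = mollify δ (p j) t := by
  rw [mollify, spacePartial_conv (h.continuous_u.memL2Loc ht).locallyIntegrable
    (contDiff_mollifier δ) (hasCompactSupport_mollifier hδ),
    h.conv_spacePartial_eq ht (contDiff_mollifier δ) (hasCompactSupport_mollifier hδ)]
  rfl

theorem continuous_momentumFlux (h : IsWeakSystem a t₀ T u m ut p) (ha : a.IsSmooth) (j : Fin n) :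
    ContinuousL2Loc (Icc t₀ T)
      fun t x => momentumFlux (a.val x) (weakState u m p t x) j :=
  (h.continuous_m.continuous_mul (ha.N j).continuous).add
    (ContinuousL2Loc.sum (s := Finset.univ) fun k _ =>
      (h.continuous_p k).continuous_mul (ha.e j k).continuous)

theorem isRegularPair (h : IsWeakSystem a t₀ T u m ut p) (ha : a.IsSmooth) {δ : ℝ} (hδ : 0 < δ) :
    IsRegularPair t₀ T (mollify δ u) (mollify δ m) (mollify δ ut) (mollifiedDeriv a u m p δ) := by
  have hC := contDiff_mollifier (n := n) δ
  have hc := hasCompactSupport_mollifier (n := n) hδ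
  have hsm : ∀ {f : ℝ → Space n → ℝ}, ContinuousL2Loc (Icc t₀ T) f → ∀ t ∈ Icc t₀ T,
      ContDiff ℝ ∞ (mollify δ f t) := fun hf t ht =>
    contDiff_conv (hf.memL2Loc ht).locallyIntegrable hC hc
  have hco : ∀ {f : ℝ → Space n → ℝ}, ContinuousL2Loc (Icc t₀ T) f →
      ContinuousOn (fun q : ℝ × Space n => mollify δ f q.1 q.2) (Icc t₀ T ×ˢ univ) := fun hf =>
    hf.continuousOn_conv hC hc
  have hmt : ContinuousOn (fun q : ℝ × Space n => mollifiedDeriv a u m p δ q.1 q.2)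
      (Icc t₀ T ×ˢ univ) := continuousOn_finsetSum _ fun j _ =>
    (h.continuous_momentumFlux ha j).continuousOn_conv (contDiff_spacePartial hC j)
      (hasCompactSupport_spacePartial hc j)
  refine ⟨hsm h.continuous_u, hsm h.continuous_m, hsm h.continuous_ut, fun t ht => ?_,
    hco h.continuous_u, hco h.continuous_m, hco h.continuous_ut, hmt, fun j => ?_, fun j => ?_,
    fun t ht x => ?_, fun t ht x => ?_, fun t ht j x => ?_⟩
  · have h1 : ContinuousOn (fun x : Space n => ((t, x) : ℝ × Space n)) univ :=
      (continuous_const.prodMk continuous_id).continuousOn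
    have h2 := hmt.comp h1 fun x _ => ⟨ht, mem_univ x⟩
    exact continuousOn_univ.1 h2
  · refine (hco (h.continuous_p j)).congr fun q hq => ?_
    simp only [h.spacePartial_mollify hq.1 hδ]
  · refine (h.continuous_ut.continuousOn_conv (contDiff_spacePartial hC j)
      (hasCompactSupport_spacePartial hc j)).congr fun q hq => ?_
    change spacePartial (conv _ _) j _ = _
    rw [spacePartial_conv (h.continuous_ut.memL2Loc hq.1).locallyIntegrable hC hc]
  · exact h.deriv_u.hasDerivAt_conv h.continuous_u h.continuous_ut hC hc
      (Icc_mem_nhds ht.1 ht.2) x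
  · have h1 := h.deriv_m t ht (fun z => mollifier n δ (x - z))
      (hC.comp (contDiff_const.sub contDiff_id)) (hasCompactSupport_comp_sub_left hc x)
    simp only [spacePartial_comp_sub_left hC, mul_neg, integral_neg, Finset.sum_neg_distrib,
      neg_neg] at h1
    exact h1
  · have hI := Icc_mem_nhds ht.1 ht.2
    have h1 := h.deriv_u.hasDerivAt_conv h.continuous_u h.continuous_ut
      (contDiff_spacePartial hC j) (hasCompactSupport_spacePartial hc j) hI x
    have h2 : spacePartial (mollify δ ut t) j x = conv (ut t) (spacePartial (mollifier n δ) j) x := by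
      rw [mollify, spacePartial_conv
        (h.continuous_ut.memL2Loc (mem_of_mem_nhds hI)).locallyIntegrable hC hc]
    rw [h2]
    refine h1.congr_of_eventuallyEq ?_
    filter_upwards [hI] with s hs
    rw [mollify, spacePartial_conv (h.continuous_u.memL2Loc hs).locallyIntegrable hC hc]

/-- The residuals of the mollified solution are commutators. -/
theorem residual_eq (h : IsWeakSystem a t₀ T u m ut p) (ha : a.IsSmooth) {δ : ℝ} (hδ : 0 < δ)
    {t : ℝ} (ht : t ∈ Icc t₀ T) (x : Space n) :
    residual a (mollify δ u) (mollify δ m) (mollify δ ut) (mollifiedDeriv a u m p δ) t x =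
      (commutator a.b δ (m t) x + ∑ k, commutator (a.N k) δ (p k t) x,
        ∑ j, (commutatorPartial (a.N j) j δ (m t) x
          + ∑ k, commutatorPartial (a.e j k) j δ (p k t) x),
        fun j => commutatorPartial a.b j δ (m t) x
          + ∑ k, commutatorPartial (a.N k) j δ (p k t) x) := by
  have hC := contDiff_mollifier (n := n) δ
  have hc := hasCompactSupport_mollifier (n := n) hδ
  have hm := h.continuous_m.memL2Loc ht
  have hp := fun k => (h.continuous_p k).memL2Loc ht
  have hst : ∀ y, stateOf (mollify δ u) (mollify δ m) t y =
      (mollify δ u t y, mollify δ m t y, fun k => mollify δ (p k) t y) := by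
    intro y
    simp only [stateOf, h.spacePartial_mollify ht hδ]
  have hr : ∀ y, mollify δ ut t y
      - velocity (a.val y) (stateOf (mollify δ u) (mollify δ m) t y) =
      commutator a.b δ (m t) y + ∑ k, commutator (a.N k) δ (p k t) y := by
    intro y
    have h1 : ut t = fun y => a.b y * m t y + ∑ k, a.N k y * p k t y :=
      funext fun y => h.ut_eq t ht y
    have h2 : mollify δ ut t y = conv (fun y => a.b y * m t y) (mollifier n δ) y
        + ∑ k, conv (fun y => a.N k y * p k t y) (mollifier n δ) y := by
      rw [mollify, h1, conv_add (hm.continuous_mul ha.b.continuous).locallyIntegrable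
        (MemL2Loc.sum fun k _ => (hp k).continuous_mul (ha.N k).continuous).locallyIntegrable
        hC.continuous hc, conv_sum (fun k _ =>
          ((hp k).continuous_mul (ha.N k).continuous).locallyIntegrable) hC.continuous hc]
    rw [h2, hst]
    simp only [velocity, shiftDeriv, WaveCoeff.val, commutator, Finset.sum_sub_distrib, mollify]
    ring
  have hreg := h.isRegularPair ha hδ
  have hz := hreg.contDiff_stateOf ht
  have hdc : ∀ {b : Space n → ℝ} {v : Space n → ℝ}, ContDiff ℝ ∞ b → MemL2Loc v →
      DifferentiableAt ℝ (commutator b δ v) x := fun hb hv =>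
    (contDiff_commutator hb hv hδ).differentiable (by simp) x
  rw [residual, Prod.mk.injEq, Prod.mk.injEq]
  refine ⟨hr x, ?_, funext fun j => ?_⟩
  · rw [mollifiedDeriv, ← Finset.sum_sub_distrib]
    refine Finset.sum_congr rfl fun j _ => ?_
    have hdm : ∀ {v : Space n → ℝ}, MemL2Loc v →
        DifferentiableAt ℝ (conv v (mollifier n δ)) x := fun hv =>
      (contDiff_conv hv.locallyIntegrable hC hc).differentiable (by simp) x
    have h1 : (fun y => momentumFlux (a.val y) (stateOf (mollify δ u) (mollify δ m) t y) j) =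
        fun y => a.N j y * conv (m t) (mollifier n δ) y
          + ∑ k, a.e j k y * conv (p k t) (mollifier n δ) y := by
      funext y
      rw [hst]
      rfl
    have h2 : (fun y => momentumFlux (a.val y) (weakState u m p t y) j) =
        fun y => a.N j y * m t y + ∑ k, a.e j k y * p k t y := rfl
    have hN := (ha.N j).differentiable (by simp) x
    have he := fun k => (ha.e j k).differentiable (by simp) x
    rw [h1, spacePartial_add (hN.fun_mul (hdm hm))
      (DifferentiableAt.fun_sum fun k _ => (he k).fun_mul (hdm (hp k))),
      spacePartial_mul hN (hdm hm), spacePartial_sum fun k _ => (he k).fun_mul (hdm (hp k)),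
      Finset.sum_congr rfl fun k _ => spacePartial_mul (he k) (hdm (hp k)) j, h2,
      conv_add (hm.continuous_mul (ha.N j).continuous).locallyIntegrable
        (MemL2Loc.sum fun k _ => (hp k).continuous_mul (ha.e j k).continuous).locallyIntegrable
        (contDiff_spacePartial hC j).continuous (hasCompactSupport_spacePartial hc j),
      conv_sum (fun k _ => ((hp k).continuous_mul (ha.e j k).continuous).locallyIntegrable)
        (contDiff_spacePartial hC j).continuous (hasCompactSupport_spacePartial hc j),
      spacePartial_conv hm.locallyIntegrable hC hc]
    simp only [commutatorPartial, Finset.sum_sub_distrib,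
      spacePartial_conv (hp _).locallyIntegrable hC hc]
    ring
  · rw [← spacePartial_sub ((hreg.contDiff_ut t ht).differentiable (by simp) x)
      ((contDiff_velocity ha hz).differentiable (by simp) x), funext hr,
      spacePartial_add (hdc ha.b hm) (DifferentiableAt.fun_sum fun k _ => hdc (ha.N k) (hp k)),
      spacePartial_sum fun k _ => hdc (ha.N k) (hp k), spacePartial_commutator ha.b hm hδ]
    congr 1
    exact Finset.sum_congr rfl fun k _ => by rw [spacePartial_commutator (ha.N k) (hp k) hδ]

theorem negligible_residual (h : IsWeakSystem a t₀ T u m ut p) (ha : a.IsSmooth) (R : ℝ) :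
    Negligible (Icc t₀ T) R fun δ => residual a (mollify δ u) (mollify δ m) (mollify δ ut)
      (mollifiedDeriv a u m p δ) := by
  have hI : IsCompact (Icc t₀ T) := isCompact_Icc
  have hm := h.continuous_m
  have hp := h.continuous_p
  have h1 := Negligible.state (R := R)
    ((hm.negligible_commutator hI ha.b R).add (Negligible.sum (s := Finset.univ) fun k _ =>
      (hp k).negligible_commutator hI (ha.N k) R))
    (Negligible.sum (s := Finset.univ) fun j _ =>
      (hm.negligible_commutatorPartial hI (ha.N j) j R).add
        (Negligible.sum (s := Finset.univ) fun k _ =>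
          (hp k).negligible_commutatorPartial hI (ha.e j k) j R))
    (fun j => (hm.negligible_commutatorPartial hI ha.b j R).add
      (Negligible.sum (s := Finset.univ) fun k _ =>
        (hp k).negligible_commutatorPartial hI (ha.N k) j R))
  have he : ∀ δ, 0 < δ → ∀ s ∈ Icc t₀ T, _ = residual a (mollify δ u) (mollify δ m) (mollify δ ut)
      (mollifiedDeriv a u m p δ) s := fun δ hδ s hs =>
    funext fun x => (h.residual_eq ha hδ hs x).symm
  exact h1.congr he

theorem negligible_stateOf_sub (h : IsWeakSystem a t₀ T u m ut p) (R : ℝ) :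
    Negligible (Icc t₀ T) R fun δ t =>
      stateOf (mollify δ u) (mollify δ m) t - weakState u m p t := by
  have hI : IsCompact (Icc t₀ T) := isCompact_Icc
  refine (Negligible.state (R := R) (h.continuous_u.negligible_conv_sub hI R)
    (h.continuous_m.negligible_conv_sub hI R)
    (fun j => (h.continuous_p j).negligible_conv_sub hI R)).congr fun δ hδ s hs => ?_
  funext x
  simp only [stateOf, weakState, Pi.sub_apply, h.spacePartial_mollify hs hδ]
  rfl

end IsWeakSystem

end WeakSystem

/-! ### The energy estimate for weak solutions -/

section Norms

variable {α F : Type*} [MeasurableSpace α] [NormedAddCommGroup F] {μ : Measure α} {f : α → F}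

theorem eLpNorm_two_sq (f : α → F) (μ : Measure α) :
    eLpNorm f 2 μ ^ 2 = ∫⁻ x, ‖f x‖ₑ ^ 2 ∂μ := by
  have h := eLpNorm_nnreal_pow_eq_lintegral (μ := μ) (f := f) (p := 2) two_ne_zero
  have h2 : ((2 : ℝ≥0) : ℝ) = ((2 : ℕ) : ℝ) := by norm_num
  rw [h2] at h
  simpa only [ENNReal.rpow_natCast, ENNReal.coe_ofNat] using h

theorem ofReal_integral_norm_sq (hf : MemLp f 2 μ) :
    ENNReal.ofReal (∫ x, ‖f x‖ ^ 2 ∂μ) = eLpNorm f 2 μ ^ 2 := by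
  have hf' : MemLp f ((2 : ℕ) : ℝ≥0∞) μ := by exact_mod_cast hf
  rw [ofReal_integral_eq_lintegral_ofReal (hf'.integrable_norm_pow two_ne_zero)
    (ae_of_all _ fun x => sq_nonneg _), eLpNorm_two_sq]
  refine lintegral_congr fun x => ?_
  rw [ENNReal.ofReal_pow (norm_nonneg _), ofReal_norm]

theorem tendsto_eLpNorm_of_tendsto_sub {ι : Type*} {l : Filter ι} {g : ι → α → F}
    (hf : MemLp f 2 μ) (hg : ∀ᶠ i in l, AEStronglyMeasurable (g i) μ)
    (h : Tendsto (fun i => eLpNorm (g i - f) 2 μ) l (𝓝 0)) :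
    Tendsto (fun i => eLpNorm (g i) 2 μ) l (𝓝 (eLpNorm f 2 μ)) := by
  have h1 := ENNReal.Tendsto.sub (tendsto_const_nhds (x := eLpNorm f 2 μ)) h
    (Or.inl hf.eLpNorm_ne_top)
  have h2 := (tendsto_const_nhds (x := eLpNorm f 2 μ)).add h
  rw [tsub_zero] at h1
  rw [add_zero] at h2
  refine tendsto_of_tendsto_of_tendsto_of_le_of_le' h1 h2 ?_ ?_
  · filter_upwards [hg] with i hi
    rw [tsub_le_iff_right]
    have e : f = g i - (g i - f) := by abel
    calc eLpNorm f 2 μ = eLpNorm (g i - (g i - f)) 2 μ := by rw [← e]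
      _ ≤ _ := eLpNorm_sub_le hi (hi.sub hf.1) (by norm_num)
  · filter_upwards [hg] with i hi
    have e : g i = f + (g i - f) := by abel
    calc eLpNorm (g i) 2 μ = eLpNorm (f + (g i - f)) 2 μ := by rw [← e]
      _ ≤ _ := eLpNorm_add_le hf.1 (hi.sub hf.1) (by norm_num)

end Norms

section WeakEstimate

variable {n : ℕ} {a : WaveCoeff n} {t₀ T : ℝ} {u m ut : ℝ → Space n → ℝ}
  {p : Fin n → ℝ → Space n → ℝ} {S₀ : Space n → ℝ}

theorem memLp_closedBall_of_continuous {F : Type*} [NormedAddCommGroup F] {f : Space n → F}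
    (hf : Continuous f) (R : ℝ) (hm : AEStronglyMeasurable f) :
    MemLp f 2 (volume.restrict (Metric.closedBall (0 : Space n) R)) := by
  obtain ⟨A, hA⟩ := (isCompact_closedBall (0 : Space n) R).exists_bound_of_continuousOn
    hf.continuousOn
  have : IsFiniteMeasure (volume.restrict (Metric.closedBall (0 : Space n) R)) :=
    ⟨by simpa using measure_closedBall_lt_top⟩
  refine MemLp.of_bound hm.restrict A ?_
  filter_upwards [ae_restrict_mem Metric.isClosed_closedBall.measurableSet] with x hx using hA x hx

theorem ContinuousL2Loc.continuousOn_commutator {f : ℝ → Space n → ℝ} {I : Set ℝ}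
    (hf : ContinuousL2Loc I f) {b : Space n → ℝ} (hb : ContDiff ℝ ∞ b) {δ : ℝ} (hδ : 0 < δ) :
    ContinuousOn (fun q : ℝ × Space n => commutator b δ (f q.1) q.2) (I ×ˢ univ) := by
  have hC := contDiff_mollifier (n := n) δ
  have hc := hasCompactSupport_mollifier (n := n) hδ
  exact ((hf.continuous_mul hb.continuous).continuousOn_conv hC hc).sub
    ((hb.continuous.comp continuous_snd).continuousOn.mul (hf.continuousOn_conv hC hc))

theorem ContinuousL2Loc.continuousOn_commutatorPartial {f : ℝ → Space n → ℝ} {I : Set ℝ}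
    (hf : ContinuousL2Loc I f) {b : Space n → ℝ} (hb : ContDiff ℝ ∞ b) (j : Fin n) {δ : ℝ}
    (hδ : 0 < δ) :
    ContinuousOn (fun q : ℝ × Space n => commutatorPartial b j δ (f q.1) q.2) (I ×ˢ univ) := by
  have hC := contDiff_mollifier (n := n) δ
  have hc := hasCompactSupport_mollifier (n := n) hδ
  have hC' := contDiff_spacePartial hC j
  have hc' := hasCompactSupport_spacePartial hc j
  exact ((hf.continuous_mul hb.continuous).continuousOn_conv hC' hc').sub
    ((((contDiff_spacePartial hb j).continuous.comp continuous_snd).continuousOn.mul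
      (hf.continuousOn_conv hC hc)).add
    ((hb.continuous.comp continuous_snd).continuousOn.mul (hf.continuousOn_conv hC' hc')))

namespace IsWeakSystem

theorem continuousOn_residual (h : IsWeakSystem a t₀ T u m ut p) (ha : a.IsSmooth) {δ : ℝ}
    (hδ : 0 < δ) :
    ContinuousOn (fun q : ℝ × Space n => residual a (mollify δ u) (mollify δ m) (mollify δ ut)
      (mollifiedDeriv a u m p δ) q.1 q.2) (Icc t₀ T ×ˢ univ) := by
  have hm := h.continuous_m
  have hp := h.continuous_p
  refine ContinuousOn.congr ?_ fun q hq => h.residual_eq ha hδ hq.1 q.2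
  refine ((hm.continuousOn_commutator ha.b hδ).add (continuousOn_finsetSum _ fun k _ =>
    (hp k).continuousOn_commutator (ha.N k) hδ)).prodMk (ContinuousOn.prodMk
    (continuousOn_finsetSum _ fun j _ => ?_) (continuousOn_pi.2 fun j => ?_))
  · exact (hm.continuousOn_commutatorPartial (ha.N j) j hδ).add (continuousOn_finsetSum _ fun k _ =>
      (hp k).continuousOn_commutatorPartial (ha.e j k) j hδ)
  · exact (hm.continuousOn_commutatorPartial ha.b j hδ).add (continuousOn_finsetSum _ fun k _ =>
      (hp k).continuousOn_commutatorPartial (ha.N k) j hδ)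

/-- The squared local norm of the residual of the mollified solution. -/
def residualSq (a : WaveCoeff n) (u m ut : ℝ → Space n → ℝ) (p : Fin n → ℝ → Space n → ℝ)
    (R δ s : ℝ) : ℝ :=
  ∫ x in Metric.closedBall (0 : Space n) R, ‖residual a (mollify δ u) (mollify δ m) (mollify δ ut)
    (mollifiedDeriv a u m p δ) s x‖ ^ 2

theorem integrableOn_residualSq (h : IsWeakSystem a t₀ T u m ut p) (ha : a.IsSmooth) (R : ℝ)
    {δ : ℝ} (hδ : 0 < δ) : IntegrableOn (residualSq a u m ut p R δ) (Icc t₀ T) := by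
  refine Integrable.integral_prod_left (f := fun q : ℝ × Space n =>
    ‖residual a (mollify δ u) (mollify δ m) (mollify δ ut) (mollifiedDeriv a u m p δ) q.1 q.2‖ ^ 2)
    (μ := volume.restrict (Icc t₀ T))
    (ν := volume.restrict (Metric.closedBall (0 : Space n) R)) ?_
  rw [Measure.prod_restrict]
  exact (((h.continuousOn_residual ha hδ).mono (prod_mono_right (subset_univ _))).norm.pow
    2).integrableOn_compact (isCompact_Icc.prod (isCompact_closedBall (0 : Space n) R))

theorem residualSq_nonneg (R δ s : ℝ) : 0 ≤ residualSq a u m ut p R δ s :=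
  integral_nonneg fun _ => sq_nonneg _

theorem ofReal_residualSq_le (h : IsWeakSystem a t₀ T u m ut p) (ha : a.IsSmooth) (R : ℝ)
    {δ : ℝ} (hδ : 0 < δ) {s : ℝ} (hs : s ∈ Icc t₀ T) :
    ENNReal.ofReal (residualSq a u m ut p R δ s) ≤
      eLpNorm (residual a (mollify δ u) (mollify δ m) (mollify δ ut) (mollifiedDeriv a u m p δ) s) 2
        (volume.restrict (Metric.ball (0 : Space n) (R + 1))) ^ 2 := by
  rw [residualSq, ofReal_integral_norm_sq (memLp_closedBall_of_continuous
    ((h.isRegularPair ha hδ).continuous_residual ha hs) R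
      ((h.negligible_residual ha R).meas δ hδ s hs))]
  have hB : Metric.closedBall (0 : Space n) R ⊆ Metric.ball 0 (R + 1) :=
    Metric.closedBall_subset_ball (lt_add_one R)
  gcongr

theorem tendsto_integral_residualSq (h : IsWeakSystem a t₀ T u m ut p) (ha : a.IsSmooth) (R : ℝ) :
    Tendsto (fun δ => ∫ s in Icc t₀ T, residualSq a u m ut p R δ s) (𝓝[>] 0) (𝓝 0) := by
  have hN := h.negligible_residual ha (R + 1)
  obtain ⟨C, hC⟩ := hN.bound
  have h1 : Tendsto (fun δ => ∫ s in Icc t₀ T, residualSq a u m ut p R δ s) (𝓝[>] 0)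
      (𝓝 (∫ _ in Icc t₀ T, (0 : ℝ))) := by
    refine tendsto_integral_filter_of_dominated_convergence (fun _ => (C : ℝ) ^ 2) ?_ ?_ ?_ ?_
    · filter_upwards [self_mem_nhdsWithin] with δ hδ
      exact (h.integrableOn_residualSq ha R hδ).aestronglyMeasurable
    · filter_upwards [Ioc_mem_nhdsGT one_pos] with δ hδ
      filter_upwards [ae_restrict_mem measurableSet_Icc] with s hs
      rw [Real.norm_of_nonneg (residualSq_nonneg R δ s)]
      rw [← ENNReal.ofReal_le_ofReal_iff (by positivity)]
      refine (h.ofReal_residualSq_le ha R hδ.1 hs).trans ?_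
      rw [ENNReal.ofReal_pow C.coe_nonneg, ENNReal.ofReal_coe_nnreal]
      gcongr
      exact hC δ hδ.1 hδ.2 s hs
    · exact integrable_const _
    · filter_upwards [ae_restrict_mem measurableSet_Icc] with s hs
      have h2 := ENNReal.Tendsto.pow (n := 2) (hN.tendsto s hs)
      rw [zero_pow two_ne_zero] at h2
      have h3 : Tendsto (fun δ => ENNReal.ofReal (residualSq a u m ut p R δ s)) (𝓝[>] 0) (𝓝 0) := by
        refine tendsto_of_tendsto_of_tendsto_of_le_of_le' tendsto_const_nhds h2
          (Eventually.of_forall fun _ => zero_le) ?_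
        filter_upwards [self_mem_nhdsWithin] with δ hδ using h.ofReal_residualSq_le ha R hδ hs
      have h4 := (ENNReal.tendsto_toReal ENNReal.zero_ne_top).comp h3
      refine h4.congr fun δ => ?_
      simp [residualSq_nonneg]
  simpa using h1

theorem aestronglyMeasurable_weakState (h : IsWeakSystem a t₀ T u m ut p) {t : ℝ}
    (ht : t ∈ Icc t₀ T) : AEStronglyMeasurable (weakState u m p t) :=
  (h.continuous_u.memL2Loc ht).aestronglyMeasurable.prodMk
    ((h.continuous_m.memL2Loc ht).aestronglyMeasurable.prodMk
      (aemeasurable_pi_lambda _ fun j =>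
        ((h.continuous_p j).memL2Loc ht).aestronglyMeasurable.aemeasurable).aestronglyMeasurable)

theorem memLp_weakState (h : IsWeakSystem a t₀ T u m ut p) {t : ℝ} (ht : t ∈ Icc t₀ T) (R : ℝ) :
    MemLp (weakState u m p t) 2 (volume.restrict (Metric.ball (0 : Space n) R)) := by
  have h1 := ((h.continuous_u.memLp t ht R).norm.add (h.continuous_m.memLp t ht R).norm).add
    (memLp_finsetSum Finset.univ fun j _ => ((h.continuous_p j).memLp t ht R).norm)
  refine h1.of_le (h.aestronglyMeasurable_weakState ht).restrict (ae_of_all _ fun x => ?_)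
  exact (norm_state_le _).trans (le_abs_self _)

/-- The mollified states converge in `L²` of bounded sets. -/
theorem tendsto_eLpNorm_stateOf (h : IsWeakSystem a t₀ T u m ut p) (ha : a.IsSmooth) {t : ℝ}
    (ht : t ∈ Icc t₀ T) {R : ℝ} {B : Set (Space n)} (hB : B ⊆ Metric.ball 0 R) :
    Tendsto (fun δ => eLpNorm (stateOf (mollify δ u) (mollify δ m) t) 2 (volume.restrict B)) (𝓝[>] 0)
      (𝓝 (eLpNorm (weakState u m p t) 2 (volume.restrict B))) := by
  have hμ : volume.restrict B ≤ volume.restrict (Metric.ball (0 : Space n) R) :=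
    Measure.restrict_mono hB le_rfl
  refine tendsto_eLpNorm_of_tendsto_sub ((h.memLp_weakState ht R).mono_measure hμ) ?_ ?_
  · filter_upwards [self_mem_nhdsWithin] with δ hδ
    exact ((h.isRegularPair ha hδ).contDiff_stateOf ht).continuous.aestronglyMeasurable
  · exact tendsto_of_tendsto_of_tendsto_of_le_of_le tendsto_const_nhds
      ((h.negligible_stateOf_sub R).tendsto t ht) (fun _ => zero_le)
      fun δ => eLpNorm_mono_measure _ hμ

end IsWeakSystem

/-- The energy estimate for weak solutions in the exterior of `S₀ = 0`. It is obtained from the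
estimate for regular functions by mollification, the residuals being commutators that tend to
zero, and then letting the radius of the ball tend to infinity. -/
theorem WaveCoeff.IsAdmissible.weak_energy_estimate (ha : a.IsAdmissible S₀)
    (hS : ContDiff ℝ ∞ S₀) (t₀ T : ℝ) :
    ∃ C : ℝ≥0, ∀ (u m ut : ℝ → Space n → ℝ) (p : Fin n → ℝ → Space n → ℝ),
      IsWeakSystem a t₀ T u m ut p → ∀ t ∈ Icc t₀ T,
        eLpNorm (weakState u m p t) 2 (volume.restrict (exterior S₀)) ^ 2 ≤
          C * eLpNorm (weakState u m p t₀) 2 (volume.restrict (exterior S₀)) ^ 2 := by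
  obtain ⟨C, hC0, ℓ, hℓ, hC⟩ := ha.energy_estimate hS t₀ T
  refine ⟨C.toNNReal, fun u m ut p h t ht => ?_⟩
  have hsm := ha.toIsSmooth
  have ht₀ : t₀ ∈ Icc t₀ T := ⟨le_rfl, ht.1.trans ht.2⟩
  have hR : ∀ R : ℝ, eLpNorm (weakState u m p t) 2
      (volume.restrict (Metric.closedBall 0 R ∩ exterior S₀)) ^ 2 ≤
      C.toNNReal * eLpNorm (weakState u m p t₀) 2 (volume.restrict (exterior S₀)) ^ 2 := by
    intro R
    have hsub : ∀ r : ℝ, Metric.closedBall (0 : Space n) r ∩ exterior S₀ ⊆ Metric.ball 0 (r + 1) :=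
      fun r => inter_subset_left.trans (Metric.closedBall_subset_ball (by linarith))
    have hmem : ∀ δ, 0 < δ → ∀ s ∈ Icc t₀ T, ∀ r : ℝ,
        MemLp (stateOf (mollify δ u) (mollify δ m) s) 2
          (volume.restrict (Metric.closedBall (0 : Space n) r ∩ exterior S₀)) := by
      intro δ hδ s hs r
      have hc := ((h.isRegularPair hsm hδ).contDiff_stateOf hs).continuous
      exact (memLp_closedBall_of_continuous hc r hc.aestronglyMeasurable).mono_measure
        (Measure.restrict_mono inter_subset_left le_rfl)
    have hlim1 := ENNReal.Tendsto.pow (n := 2) (h.tendsto_eLpNorm_stateOf hsm ht (hsub R))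
    have hlim2 := ENNReal.Tendsto.const_mul (a := (C.toNNReal : ℝ≥0∞))
      ((ENNReal.Tendsto.pow (n := 2) (h.tendsto_eLpNorm_stateOf hsm ht₀ (hsub (R + ℓ)))).add
        (ENNReal.tendsto_ofReal (h.tendsto_integral_residualSq hsm (R + ℓ))))
      (Or.inr ENNReal.coe_ne_top)
    rw [ENNReal.ofReal_zero, add_zero] at hlim2
    refine (le_of_tendsto_of_tendsto hlim1 hlim2 ?_).trans ?_
    · filter_upwards [self_mem_nhdsWithin] with δ hδ
      have h1 := hC R _ _ _ _ (h.isRegularPair hsm hδ) _ (h.integrableOn_residualSq hsm (R + ℓ) hδ)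
        (fun s _ => le_rfl) t ht
      have h2 := ENNReal.ofReal_le_ofReal h1
      rw [ofReal_integral_norm_sq (hmem δ hδ t ht R), ENNReal.ofReal_mul hC0, ENNReal.ofReal_add
        (integral_nonneg fun _ => sq_nonneg _)
        (integral_nonneg fun s => IsWeakSystem.residualSq_nonneg _ _ _),
        ofReal_integral_norm_sq (hmem δ hδ t₀ ht₀ (R + ℓ))] at h2
      exact h2
    · gcongr
      exact inter_subset_right
  have hU : ⋃ k : ℕ, Metric.closedBall (0 : Space n) k ∩ exterior S₀ = exterior S₀ := by
    rw [← iUnion_inter, Metric.iUnion_closedBall_nat, univ_inter]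
  rw [eLpNorm_two_sq, ← hU, setLIntegral_iUnion_of_directed, hU]
  · refine iSup_le fun k => ?_
    exact (eLpNorm_two_sq (weakState u m p t) _).symm.trans_le (hR k)
  · refine Monotone.directed_le fun k l hkl => inter_subset_inter_left _ ?_
    exact Metric.closedBall_subset_closedBall (by exact_mod_cast hkl)

end WeakEstimate

/-! ### Weak derivatives of continuous functions of time -/

section Time

variable {a b : ℝ}

theorem exists_Icc_of_isCompact_subset_Ioo (hab : a < b) {K : Set ℝ} (hK : IsCompact K)
    (hsub : K ⊆ Ioo a b) : ∃ c d, a < c ∧ d < b ∧ K ⊆ Icc c d := by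
  have hK' : IsCompact (insert ((a + b) / 2) K) := hK.insert _
  have hsub' : insert ((a + b) / 2) K ⊆ Ioo a b :=
    insert_subset ⟨by linarith, by linarith⟩ hsub
  obtain ⟨c, hc⟩ := hK'.exists_isLeast (insert_nonempty _ _)
  obtain ⟨d, hd⟩ := hK'.exists_isGreatest (insert_nonempty _ _)
  exact ⟨c, d, (hsub' hc.1).1, (hsub' hd.1).2, fun x hx =>
    ⟨hc.2 (mem_insert_of_mem _ hx), hd.2 (mem_insert_of_mem _ hx)⟩⟩

/-- A test function on `(a, b)` with integral zero is the derivative of a test function. -/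
theorem exists_primitive_of_integral_eq_zero (hab : a < b) {ζ : ℝ → ℝ} (hζ : ContDiff ℝ ∞ ζ)
    (hc : HasCompactSupport ζ) (hsub : tsupport ζ ⊆ Ioo a b) (h0 : ∫ t, ζ t = 0) :
    ∃ η : ℝ → ℝ, ContDiff ℝ ∞ η ∧ HasCompactSupport η ∧ tsupport η ⊆ Ioo a b ∧ deriv η = ζ := by
  obtain ⟨c, d, hac, hdb, hcd⟩ := exists_Icc_of_isCompact_subset_Ioo hab hc hsub
  have hζ0 : ∀ t, t ∉ Icc c d → ζ t = 0 := fun t ht =>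
    image_eq_zero_of_notMem_tsupport fun h => ht (hcd h)
  set η : ℝ → ℝ := fun t => ∫ s in a..t, ζ s with hη
  have hd : ∀ t, HasDerivAt η (ζ t) t := fun t =>
    intervalIntegral.integral_hasDerivAt_right (hζ.continuous.intervalIntegrable _ _)
      hζ.continuous.aestronglyMeasurable.stronglyMeasurableAtFilter hζ.continuous.continuousAt
  have hderiv : deriv η = ζ := funext fun t => (hd t).deriv
  have hz : ∀ t, t ∉ Icc c d → η t = 0 := by
    intro t ht
    rw [mem_Icc, not_and_or, not_le, not_le] at ht
    rcases ht with ht | ht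
    · refine intervalIntegral.integral_zero_ae (ae_of_all _ fun s hs => hζ0 s fun h => ?_)
      have : s ≤ max a t := hs.2
      exact absurd (this.trans_lt (max_lt hac ht)) (not_lt.2 h.1)
    · rw [← h0]
      refine intervalIntegral.integral_eq_integral_of_support_subset fun s hs => ?_
      have := hcd (subset_tsupport ζ hs)
      exact ⟨hac.trans_le this.1, this.2.trans ht.le⟩
  have hsupp : tsupport η ⊆ Icc c d := closure_minimal
    (fun t ht => by by_contra h; exact ht (hz t h)) isClosed_Icc
  refine ⟨η, ?_, HasCompactSupport.intro isCompact_Icc hz,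
    hsupp.trans (Icc_subset_Ioo hac hdb), hderiv⟩
  rw [contDiff_infty_iff_deriv, hderiv]
  exact ⟨fun t => (hd t).differentiableAt, hζ⟩

theorem exists_test_integral_eq_one (hab : a < b) : ∃ ζ : ℝ → ℝ, ContDiff ℝ ∞ ζ ∧
    HasCompactSupport ζ ∧ tsupport ζ ⊆ Ioo a b ∧ ∫ t, ζ t = 1 := by
  let φ : ContDiffBump ((a + b) / 2) := ⟨(b - a) / 8, (b - a) / 4, by linarith, by linarith⟩
  refine ⟨φ.normed volume, φ.contDiff_normed, φ.hasCompactSupport_normed, ?_, φ.integral_normed⟩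
  rw [ContDiffBump.tsupport_normed_eq, Real.closedBall_eq_Icc]
  have h1 : φ.rOut = (b - a) / 4 := rfl
  rw [h1]
  exact Icc_subset_Ioo (by linarith) (by linarith)

/-- A continuous function with a continuous weak derivative is differentiable. -/
theorem hasDerivAt_of_weak_deriv {f A : ℝ → ℝ} (hf : ContinuousOn f (Icc a b))
    (hA : ContinuousOn A (Icc a b))
    (h : ∀ η : ℝ → ℝ, ContDiff ℝ ∞ η → HasCompactSupport η → tsupport η ⊆ Ioo a b →
      ∫ t in Ioo a b, (deriv η t * f t + η t * A t) = 0) {t : ℝ} (ht : t ∈ Ioo a b) :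
    HasDerivAt f (A t) t := by
  have hab : a < b := ht.1.trans ht.2
  have hu : uIcc a b = Icc a b := uIcc_of_le hab.le
  set G : ℝ → ℝ := fun t => ∫ s in a..t, A s with hG
  have hAi : IntervalIntegrable A volume a b := hA.intervalIntegrable_of_Icc hab.le
  have hGd : ∀ t ∈ Ioo a b, HasDerivAt G (A t) t := fun t ht =>
    intervalIntegral.integral_hasDerivAt_right
      ((hA.mono (Icc_subset_Icc_right ht.2.le)).intervalIntegrable_of_Icc ht.1.le)
      ((hA.mono Ioo_subset_Icc_self).stronglyMeasurableAtFilter isOpen_Ioo t ht)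
      (hA.continuousAt (Icc_mem_nhds ht.1 ht.2))
  have hGc : ContinuousOn G (Icc a b) := by
    have := intervalIntegral.continuousOn_primitive_interval (μ := volume) (f := A) (a := a) (b := b)
      (by rw [hu]; exact hA.integrableOn_Icc)
    rwa [hu] at this
  -- `f - G` has vanishing weak derivative.
  have hk : ∀ η : ℝ → ℝ, ContDiff ℝ ∞ η → HasCompactSupport η → tsupport η ⊆ Ioo a b →
      ∫ t in Ioo a b, deriv η t * (f t - G t) = 0 := by
    intro η hη hc hsub
    have hηz : ∀ t, t ∉ Ioo a b → η t = 0 := fun t ht =>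
      image_eq_zero_of_notMem_tsupport fun h => ht (hsub h)
    have hηd : ∀ t, HasDerivAt η (deriv η t) t := fun t =>
      (hη.differentiable (by simp) t).hasDerivAt
    have hη' : Continuous (deriv η) := (contDiff_infty_iff_deriv.1 hη).2.continuous
    have hparts := intervalIntegral.integral_deriv_mul_eq_sub_of_hasDerivAt (u := η) (v := G)
      (u' := deriv η) (v' := A) (a := a) (b := b) hη.continuous.continuousOn (by rwa [hu])
      (fun x _ => hηd x) (fun x hx => hGd x (by
        rwa [min_eq_left hab.le, max_eq_right hab.le] at hx))
      (hη'.intervalIntegrable _ _) hAi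
    rw [hηz a (by simp), hηz b (by simp), zero_mul, zero_mul, sub_zero,
      intervalIntegral.integral_of_le hab.le, integral_Ioc_eq_integral_Ioo] at hparts
    have hi1 : IntegrableOn (fun t => deriv η t * f t + η t * A t) (Ioo a b) :=
      (((hη'.continuousOn.mul hf).add (hη.continuous.continuousOn.mul hA)).integrableOn_Icc).mono_set
        Ioo_subset_Icc_self
    have hi2 : IntegrableOn (fun t => deriv η t * G t + η t * A t) (Ioo a b) :=
      (((hη'.continuousOn.mul hGc).add (hη.continuous.continuousOn.mul hA)).integrableOn_Icc).mono_set
        Ioo_subset_Icc_self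
    have := integral_sub hi1 hi2
    rw [h η hη hc hsub, hparts, sub_zero] at this
    rw [← this]
    exact integral_congr_ae (ae_of_all _ fun t => by ring)
  -- a test function minus a suitable multiple of `ζ₀` has integral zero, hence is a derivative;
  -- so `f - G - c` is orthogonal to all test functions
  obtain ⟨ζ₀, hζ₀, hc₀, hsub₀, h₀⟩ := exists_test_integral_eq_one hab
  set c := ∫ t in Ioo a b, ζ₀ t * (f t - G t) with hcdef
  have hfG : ContinuousOn (fun t => f t - G t - c) (Icc a b) :=
    (hf.sub hGc).sub continuousOn_const
  have hae := isOpen_Ioo.ae_eq_zero_of_integral_contDiff_smul_eq_zero (U := Ioo a b)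
    (f := fun t => f t - G t - c) (μ := volume)
    (hfG.integrableOn_Icc.mono_set Ioo_subset_Icc_self).locallyIntegrableOn (by
      intro ζ hζ hcζ hsub
      have hd0 : ∫ t, (ζ t - (∫ s, ζ s) * ζ₀ t) = 0 := by
        rw [integral_sub (hζ.continuous.integrable_of_hasCompactSupport hcζ)
          ((hζ₀.continuous.integrable_of_hasCompactSupport hc₀).const_mul _), integral_const_mul,
          h₀, mul_one, sub_self]
      have hsubd : tsupport (fun t => ζ t - (∫ s, ζ s) * ζ₀ t) ⊆ tsupport ζ ∪ tsupport ζ₀ := by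
        refine closure_minimal (fun t ht => ?_)
          ((isClosed_tsupport ζ).union (isClosed_tsupport ζ₀))
        by_contra hn
        rw [mem_union, not_or] at hn
        exact ht (by simp [image_eq_zero_of_notMem_tsupport hn.1,
          image_eq_zero_of_notMem_tsupport hn.2])
      obtain ⟨η, hη, hcη, hsη, hdη⟩ := exists_primitive_of_integral_eq_zero hab
        (hζ.sub (contDiff_const.mul hζ₀))
        (HasCompactSupport.of_support_subset_isCompact (hcζ.union hc₀)
          ((subset_tsupport _).trans hsubd))
        (hsubd.trans (union_subset hsub hsub₀)) hd0
      have h1 := hk η hη hcη hsη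
      rw [hdη] at h1
      have hi : ∀ {ξ : ℝ → ℝ}, Continuous ξ →
          IntegrableOn (fun t => ξ t * (f t - G t)) (Ioo a b) := fun hξ =>
        ((hξ.continuousOn.mul (hf.sub hGc)).integrableOn_Icc).mono_set Ioo_subset_Icc_self
      have h2 : ∫ t in Ioo a b, (ζ t - (∫ s, ζ s) * ζ₀ t) * (f t - G t) =
          (∫ t in Ioo a b, ζ t * (f t - G t)) - (∫ s, ζ s) * c := by
        rw [hcdef, ← integral_const_mul, ← integral_sub (hi hζ.continuous)
          ((hi hζ₀.continuous).const_mul _)]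
        exact integral_congr_ae (ae_of_all _ fun t => by ring)
      have h3 : ∫ t in Ioo a b, ζ t = ∫ s, ζ s :=
        setIntegral_eq_integral_of_forall_compl_eq_zero fun t ht =>
          image_eq_zero_of_notMem_tsupport fun h => ht (hsub h)
      rw [h2] at h1
      rw [← setIntegral_eq_integral_of_forall_compl_eq_zero (s := Ioo a b) fun t ht => by
        rw [image_eq_zero_of_notMem_tsupport fun h => ht (hsub h), zero_smul]]
      have h4 : ∀ t, ζ t • (f t - G t - c) = ζ t * (f t - G t) - ζ t * c := fun t => by
        rw [smul_eq_mul]; ring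
      simp only [h4]
      rw [integral_sub (hi hζ.continuous)
        ((hζ.continuous.integrable_of_hasCompactSupport hcζ).integrableOn.mul_const c),
        integral_mul_const, h3]
      exact h1)
  have heq : EqOn (fun t => f t - G t - c) (fun _ => 0) (Ioo a b) :=
    Measure.eqOn_open_of_ae_eq (μ := volume)
      ((ae_restrict_iff' measurableSet_Ioo).2 hae) isOpen_Ioo
      (hfG.mono Ioo_subset_Icc_self) continuousOn_const
  refine ((hGd t ht).add_const c).congr_of_eventuallyEq ?_
  filter_upwards [Ioo_mem_nhds ht.1 ht.2] with s hs
  have := heq hs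
  simp only at this
  linarith

end Time

/-! ### Lorentz forms -/

section Lorentz

variable {n : ℕ} {A : Matrix (Fin (n + 1)) (Fin (n + 1)) ℝ}

open Matrix in
theorem det_minkowski (n : ℕ) : (minkowski n).det = (-1) ^ n := by
  simp [minkowski, Fin.prod_univ_succ]

open Matrix in
theorem minkowski_mul_self (n : ℕ) : minkowski n * minkowski n = 1 := by
  rw [minkowski, diagonal_mul_diagonal, ← diagonal_one]
  congr 1
  funext i
  refine Fin.cases ?_ (fun i => ?_) i <;> simp

open Matrix in
theorem dotProduct_minkowski_mulVec (y z : Fin (n + 1) → ℝ) :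
    y ⬝ᵥ minkowski n *ᵥ z = y 0 * z 0 - ∑ j : Fin n, y j.succ * z j.succ := by
  simp [dotProduct, minkowski, mulVec_diagonal, Fin.sum_univ_succ, sub_eq_add_neg]

open Matrix in
/-- A matrix whose inverse has Lorentz signature is congruent to the Minkowski matrix. -/
theorem exists_eq_of_hasLorentzSignature_inv (h : HasLorentzSignature A⁻¹) :
    ∃ P : Matrix (Fin (n + 1)) (Fin (n + 1)) ℝ, IsUnit P.det ∧ A = P * minkowski n * Pᵀ := by
  obtain ⟨P, hP, h⟩ := h
  have hdet : (A⁻¹).det ≠ 0 := by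
    intro h0
    have := congrArg Matrix.det h
    rw [det_mul, det_mul, h0, mul_zero, zero_mul, det_minkowski] at this
    exact pow_ne_zero n (neg_ne_zero.2 one_ne_zero) this.symm
  have hA : IsUnit A.det := by
    rw [← isUnit_nonsing_inv_det_iff]
    exact isUnit_iff_ne_zero.2 hdet
  refine ⟨P, hP, ?_⟩
  have h1 : P * minkowski n * Pᵀ * A⁻¹ * P = P := by
    calc P * minkowski n * Pᵀ * A⁻¹ * P = P * minkowski n * (Pᵀ * A⁻¹ * P) := by
          simp only [Matrix.mul_assoc]
      _ = P := by rw [h, Matrix.mul_assoc, minkowski_mul_self, Matrix.mul_one]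
  have h2 : P * minkowski n * Pᵀ * A⁻¹ = 1 := by
    have := congrArg (· * P⁻¹) h1
    simpa only [Matrix.mul_assoc, mul_nonsing_inv P hP, Matrix.mul_one] using this
  have h3 := congrArg (· * A) h2
  simpa only [Matrix.mul_assoc, nonsing_inv_mul A hA, Matrix.mul_one, Matrix.one_mul] using h3.symm

open Matrix in
theorem isSymm_of_hasLorentzSignature_inv (h : HasLorentzSignature A⁻¹) (j k : Fin (n + 1)) :
    A j k = A k j := by
  obtain ⟨P, -, rfl⟩ := exists_eq_of_hasLorentzSignature_inv h
  have : (P * minkowski n * Pᵀ)ᵀ = P * minkowski n * Pᵀ := by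
    rw [transpose_mul, transpose_mul, transpose_transpose, minkowski, diagonal_transpose,
      Matrix.mul_assoc]
  exact congrFun (congrFun this k) j

open Matrix in
theorem neg_one_pow_mul_det_inv_pos (h : HasLorentzSignature A⁻¹) :
    0 < (-1) ^ n * (A⁻¹).det := by
  obtain ⟨P, hP, h⟩ := h
  have h1 := congrArg Matrix.det h
  rw [det_mul, det_mul, det_transpose, det_minkowski] at h1
  have h2 : (-1 : ℝ) ^ n * (-1) ^ n = 1 := by rw [← mul_pow]; simp
  have h3 : P.det ≠ 0 := isUnit_iff_ne_zero.1 hP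
  have h4 : ((-1) ^ n * (A⁻¹).det) * P.det ^ 2 = 1 := by
    linear_combination (-1) ^ n * h1 + h2
  by_contra hn
  have : ((-1) ^ n * (A⁻¹).det) * P.det ^ 2 ≤ 0 :=
    mul_nonpos_of_nonpos_of_nonneg (not_lt.1 hn) (sq_nonneg _)
  linarith

open Matrix in
/-- The reversed Cauchy–Schwarz inequality: a Lorentz form is negative definite on the orthogonal
complement of a timelike vector. -/
theorem lorentz_neg_of_orthogonal (h : HasLorentzSignature A⁻¹) {τ p : Fin (n + 1) → ℝ}
    (hτ : 0 < τ ⬝ᵥ A *ᵥ τ) (hpτ : p ⬝ᵥ A *ᵥ τ = 0) (hp : p ≠ 0) : p ⬝ᵥ A *ᵥ p < 0 := by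
  obtain ⟨P, hP, rfl⟩ := exists_eq_of_hasLorentzSignature_inv h
  have key : ∀ ξ ζ : Fin (n + 1) → ℝ, ξ ⬝ᵥ (P * minkowski n * Pᵀ) *ᵥ ζ =
      (Pᵀ *ᵥ ξ) 0 * (Pᵀ *ᵥ ζ) 0
        - ∑ j : Fin n, (Pᵀ *ᵥ ξ) j.succ * (Pᵀ *ᵥ ζ) j.succ := by
    intro ξ ζ
    rw [← dotProduct_minkowski_mulVec, ← mulVec_mulVec, ← mulVec_mulVec, dotProduct_mulVec,
      mulVec_transpose P ξ]
  rw [key] at hτ hpτ ⊢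
  have hy : Pᵀ *ᵥ p ≠ 0 := by
    intro h0
    refine hp ?_
    have : (Pᵀ)⁻¹ *ᵥ (Pᵀ *ᵥ p) = p := by
      rw [mulVec_mulVec, nonsing_inv_mul _ (by rwa [det_transpose]), one_mulVec]
    rw [← this, h0, mulVec_zero]
  generalize Pᵀ *ᵥ p = y at *
  generalize Pᵀ *ᵥ τ = w at *
  have hcs := Finset.sum_mul_sq_le_sq_mul_sq Finset.univ (fun j : Fin n => y j.succ)
    (fun j => w j.succ)
  simp only [← pow_two] at hτ ⊢
  set Y := ∑ j : Fin n, y j.succ ^ 2 with hY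
  set W := ∑ j : Fin n, w j.succ ^ 2 with hW
  have hY0 : 0 ≤ Y := Finset.sum_nonneg fun _ _ => sq_nonneg _
  have hW0 : 0 ≤ W := Finset.sum_nonneg fun _ _ => sq_nonneg _
  have hw0 : 0 < w 0 ^ 2 := by linarith
  rw [← sub_eq_zero.1 hpτ] at hcs
  have h1 : y 0 ^ 2 * w 0 ^ 2 ≤ Y * W := by nlinarith
  rcases hY0.eq_or_lt with h0 | h0
  · exfalso
    refine hy (funext fun i => ?_)
    have h2 : y 0 ^ 2 = 0 := by
      rw [← h0, zero_mul] at h1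
      nlinarith [sq_nonneg (y 0)]
    refine Fin.cases (by simpa using h2) (fun j => ?_) i
    have := (Finset.sum_eq_zero_iff_of_nonneg fun _ _ => sq_nonneg _).1 (hY.symm.trans h0.symm) j
      (Finset.mem_univ j)
    simpa using this
  · by_contra hn
    rw [not_lt, sub_nonneg] at hn
    nlinarith [mul_le_mul_of_nonneg_right hn hw0.le, mul_lt_mul_of_pos_left hτ h0]

/-- The form `g^{j0} g^{0k} / g^{00} - g^{jk}` on the space covectors is positive definite. -/
theorem spatialForm_pos (h : HasLorentzSignature A⁻¹) (h0 : 0 < A 0 0) {ξ : Fin n → ℝ}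
    (hξ : ξ ≠ 0) : 0 < ∑ j : Fin n, (∑ k : Fin n,
      (A j.succ 0 * A 0 k.succ / A 0 0 - A j.succ k.succ) * ξ k) * ξ j := by
  have hs := isSymm_of_hasLorentzSignature_inv h
  set q := ∑ k : Fin n, A 0 k.succ * ξ k with hq
  set p : Fin (n + 1) → ℝ := Fin.cons (-q / A 0 0) ξ with hp
  have hneg := lorentz_neg_of_orthogonal h (τ := Pi.single 0 1) (p := p) ?_ ?_ ?_
  · have e1 : ∑ j : Fin n, ξ j * A j.succ 0 = q :=
      Finset.sum_congr rfl fun j _ => by rw [hs j.succ 0, mul_comm]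
    have e2 : ∑ j : Fin n, (∑ k : Fin n,
        (A j.succ 0 * A 0 k.succ / A 0 0 - A j.succ k.succ) * ξ k) * ξ j =
        q * q / A 0 0 - ∑ j : Fin n, ξ j * ∑ k : Fin n, A j.succ k.succ * ξ k := by
      have : ∀ j : Fin n, (∑ k : Fin n,
          (A j.succ 0 * A 0 k.succ / A 0 0 - A j.succ k.succ) * ξ k) * ξ j =
          (ξ j * A j.succ 0) * (q / A 0 0) - ξ j * ∑ k : Fin n, A j.succ k.succ * ξ k := by
        intro j
        have h3 : ∑ k : Fin n, (A j.succ 0 * A 0 k.succ / A 0 0 - A j.succ k.succ) * ξ k =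
            A j.succ 0 / A 0 0 * q - ∑ k : Fin n, A j.succ k.succ * ξ k := by
          rw [hq, Finset.mul_sum, ← Finset.sum_sub_distrib]
          exact Finset.sum_congr rfl fun k _ => by ring
        rw [h3]; ring
      rw [Finset.sum_congr rfl fun j _ => this j, Finset.sum_sub_distrib, ← Finset.sum_mul, e1,
        mul_div_assoc]
    have e3 : dotProduct p (A.mulVec p) =
        -(q * q / A 0 0) + ∑ j : Fin n, ξ j * ∑ k : Fin n, A j.succ k.succ * ξ k := by
      have : ∀ j : Fin n, ξ j * (A j.succ 0 * (-q / A 0 0) + ∑ k : Fin n, A j.succ k.succ * ξ k) =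
          (ξ j * A j.succ 0) * (-q / A 0 0) + ξ j * ∑ k : Fin n, A j.succ k.succ * ξ k :=
        fun j => by ring
      simp only [dotProduct, Matrix.mulVec, Fin.sum_univ_succ, hp, Fin.cons_zero, Fin.cons_succ,
        ← hq, this, Finset.sum_add_distrib, ← Finset.sum_mul, e1]
      field_simp
      ring
    rw [e2]
    linarith [e3]
  · simpa [dotProduct, Matrix.mulVec, Fin.sum_univ_succ] using h0
  · have e1 : ∑ j : Fin n, ξ j * A j.succ 0 = q :=
      Finset.sum_congr rfl fun j _ => by rw [hs j.succ 0, mul_comm]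
    simp [dotProduct, Matrix.mulVec, Fin.sum_univ_succ, hp, e1, h0.ne']
  · intro h1
    refine hξ (funext fun j => ?_)
    have := congrFun h1 j.succ
    simpa [hp] using this

end Lorentz

/-! ### The coefficients of the first order system -/

section Coefficients

variable {n : ℕ} {g : Space n → Matrix (Fin (n + 1)) (Fin (n + 1)) ℝ} {S₀ : Space n → ℝ}

/-- The coefficients of the first order system that is equivalent to the wave equation: with
`a^{jk} = √((-1)ⁿ g) g^{jk}` and the momentum `m = a^{00} u_t + a^{0k} ∂_k u`, the wave equation is
`u_t = b m + N·∇u`, `m_t = div (N m + e ∇u)`. -/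
def waveCoeff (g : Space n → Matrix (Fin (n + 1)) (Fin (n + 1)) ℝ) (ψ : Space n → ℝ) :
    WaveCoeff n where
  b x := (volDensity g x * g x 0 0)⁻¹
  N j x := -(g x j.succ 0 / g x 0 0)
  e j k x := volDensity g x * (g x j.succ 0 * g x 0 k.succ / g x 0 0 - g x j.succ k.succ)
  ψ := ψ

namespace IsStationaryMetric

theorem symm (hg : IsStationaryMetric g) (x : Space n) (j k : Fin (n + 1)) : g x j k = g x k j :=
  isSymm_of_hasLorentzSignature_inv (hg.lorentz x) j k

theorem volDensity_pos (hg : IsStationaryMetric g) (x : Space n) : 0 < volDensity g x :=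
  Real.sqrt_pos.2 (neg_one_pow_mul_det_inv_pos (hg.lorentz x))

theorem contDiff_volDensity (hg : IsStationaryMetric g) : ContDiff ℝ ∞ (volDensity g) := by
  have h0 : ∀ x, 0 < (-1) ^ n * ((g x)⁻¹).det := fun x =>
    neg_one_pow_mul_det_inv_pos (hg.lorentz x)
  have hdet : ContDiff ℝ ∞ fun x => (g x).det := by
    simp only [Matrix.det_apply']
    exact ContDiff.sum fun σ _ => contDiff_const.mul (contDiff_prod fun i _ => hg.smooth _ _)
  have h1 : ∀ x, ((g x)⁻¹).det = ((g x).det)⁻¹ := fun x => by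
    rw [Matrix.det_nonsing_inv, Ring.inverse_eq_inv']
  refine ContDiff.sqrt ?_ fun x => (h0 x).ne'
  simp only [h1]
  refine contDiff_const.mul (hdet.inv fun x hx => ?_)
  have := h0 x
  rw [h1, hx, inv_zero, mul_zero] at this
  exact lt_irrefl _ this

theorem isSmooth_waveCoeff (hg : IsStationaryMetric g) {ψ : Space n → ℝ} (hψ : ContDiff ℝ ∞ ψ) :
    (waveCoeff g ψ).IsSmooth where
  b := (hg.contDiff_volDensity.mul (hg.smooth 0 0)).inv fun x =>
    (mul_pos (hg.volDensity_pos x) (hg.time_pos x)).ne'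
  N j := ((hg.smooth _ _).div (hg.smooth 0 0) fun x => (hg.time_pos x).ne').neg
  e j k := hg.contDiff_volDensity.mul ((((hg.smooth _ _).mul (hg.smooth _ _)).div (hg.smooth 0 0)
    fun x => (hg.time_pos x).ne').sub (hg.smooth _ _))
  ψ := hψ
  symm j k x := by
    simp only [waveCoeff, hg.symm x j.succ 0, hg.symm x k.succ 0, hg.symm x j.succ k.succ]
    ring

theorem tendsto_metric (hg : IsStationaryMetric g) :
    Tendsto g (Bornology.cobounded (Space n)) (𝓝 (minkowski n)) := by
  have h0 : Tendsto (fun x : Space n => ‖x‖⁻¹) (Bornology.cobounded (Space n)) (𝓝 0) :=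
    tendsto_inv_atTop_zero.comp tendsto_norm_cobounded_atTop
  refine tendsto_pi_nhds.2 fun j => tendsto_pi_nhds.2 fun k => ?_
  exact tendsto_sub_nhds_zero_iff.1 ((hg.asymptotic j k).trans_tendsto h0)

theorem tendsto_volDensity (hg : IsStationaryMetric g) :
    Tendsto (volDensity g) (Bornology.cobounded (Space n)) (𝓝 1) := by
  have hdet : Tendsto (fun x => (g x).det) (Bornology.cobounded (Space n)) (𝓝 ((-1) ^ n)) := by
    rw [← det_minkowski n]
    exact (continuous_id.matrix_det.tendsto (minkowski n)).comp hg.tendsto_metric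
  have h1 := ((hdet.inv₀ (by simp)).const_mul ((-1) ^ n)).sqrt
  rw [mul_inv_cancel₀ (by simp), Real.sqrt_one] at h1
  refine h1.congr fun x => ?_
  rw [volDensity, Matrix.det_nonsing_inv, Ring.inverse_eq_inv']

theorem tendsto_waveCoeff (hg : IsStationaryMetric g) {ψ : Space n → ℝ}
    (hψ : ∀ᶠ x in Bornology.cobounded (Space n), ψ x = 1) :
    Tendsto (waveCoeff g ψ).val (Bornology.cobounded (Space n)) (𝓝 (flatCoeff n)) := by
  have hG : ∀ j k, Tendsto (fun x => g x j k) (Bornology.cobounded (Space n))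
      (𝓝 (minkowski n j k)) := fun j k =>
    tendsto_pi_nhds.1 (tendsto_pi_nhds.1 hg.tendsto_metric j) k
  have h00 : minkowski n 0 0 = 1 := by simp [minkowski]
  have hj0 : ∀ j : Fin n, minkowski n j.succ 0 = 0 := fun j => by
    simp [minkowski]
  have h0 := hG 0 0
  have hv := hg.tendsto_volDensity
  rw [h00] at h0
  refine Tendsto.prodMk_nhds ?_ (Tendsto.prodMk_nhds (tendsto_pi_nhds.2 fun j => ?_)
    (Tendsto.prodMk_nhds (tendsto_pi_nhds.2 fun j => tendsto_pi_nhds.2 fun k => ?_) ?_))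
  · have := (hv.mul h0).inv₀ (by simp)
    rw [one_mul, inv_one] at this
    exact this
  · have := ((hG j.succ 0).div h0 one_ne_zero).neg
    rw [hj0, zero_div, neg_zero] at this
    exact this
  · have := hv.mul ((((hG j.succ 0).mul (hG 0 k.succ)).div h0 one_ne_zero).sub (hG j.succ k.succ))
    have e : 1 * (minkowski n j.succ 0 * minkowski n 0 k.succ / 1 - minkowski n j.succ k.succ) =
        if j = k then 1 else 0 := by
      rw [hj0]
      by_cases h : j = k <;> simp [minkowski, h]
    rw [e] at this
    exact this
  · exact tendsto_const_nhds.congr' (hψ.mono fun x hx => hx.symm)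

theorem ellipticPart_waveCoeff (ψ : Space n → ℝ) (x : Space n) (z : State n) (j : Fin n) :
    ellipticPart ((waveCoeff g ψ).val x) z j = volDensity g x * ∑ k : Fin n,
      (g x j.succ 0 * g x 0 k.succ / g x 0 0 - g x j.succ k.succ) * z.2.2 k := by
  simp only [ellipticPart, WaveCoeff.val, waveCoeff, Finset.mul_sum, mul_assoc]

theorem ellipticPart_pos (hg : IsStationaryMetric g) (ψ : Space n → ℝ) (x : Space n)
    {z : State n} (hz : z.2.2 ≠ 0) :
    0 < ∑ j, ellipticPart ((waveCoeff g ψ).val x) z j * z.2.2 j := by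
  simp only [ellipticPart_waveCoeff, mul_assoc, ← Finset.mul_sum]
  exact mul_pos (hg.volDensity_pos x) (spatialForm_pos (hg.lorentz x) (hg.time_pos x) hz)

theorem ellipticPart_nonneg (hg : IsStationaryMetric g) (ψ : Space n → ℝ) (x : Space n)
    (z : State n) : 0 ≤ ∑ j, ellipticPart ((waveCoeff g ψ).val x) z j * z.2.2 j := by
  by_cases hz : z.2.2 = 0
  · simp [hz]
  · exact (hg.ellipticPart_pos ψ x hz).le

theorem b_pos (hg : IsStationaryMetric g) (ψ : Space n → ℝ) (x : Space n) :
    0 < ((waveCoeff g ψ).val x).1 :=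
  inv_pos.2 (mul_pos (hg.volDensity_pos x) (hg.time_pos x))

/-- The energy of the normal multiplier `∂_t - N·∇` is positive definite. -/
theorem normalEnergy_pos (hg : IsStationaryMetric g) (ψ : Space n → ℝ) (x : Space n)
    {z : State n} (hz : z.2 ≠ 0) : 0 < normalEnergy ((waveCoeff g ψ).val x) z := by
  have hb := hg.b_pos ψ x
  rw [normalEnergy]
  by_cases h : z.2.2 = 0
  · have hm : z.2.1 ≠ 0 := fun hm => hz (Prod.ext hm h)
    have := hg.ellipticPart_nonneg ψ x z
    positivity
  · have := hg.ellipticPart_pos ψ x h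
    positivity

end IsStationaryMetric

/-- By compactness of the unit sphere, the energy is positive definite for all coefficients close
to the flat ones. -/
theorem eventually_energy_pos_flatCoeff (n : ℕ) :
    ∀ᶠ c in 𝓝 (flatCoeff n), ∀ z : State n, z ≠ 0 → 0 < energy c z := by
  have h := (isCompact_sphere (0 : State n) 1).eventually_forall_of_forall_eventually
    (x₀ := flatCoeff n) (P := fun c z => 0 < energy c z) fun z hz => by
      have h1 : 0 < energy (flatCoeff n) z := energy_flatCoeff_pos fun h0 => by simp [h0] at hz
      exact (continuous_energy continuous_fst continuous_snd).continuousAt.eventually_const_lt h1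
  filter_upwards [h] with c hc z hz
  have hz' : 0 < ‖z‖ := norm_pos_iff.2 hz
  have h2 := hc (‖z‖⁻¹ • z) (by simp [norm_smul, hz'.ne'])
  rw [energy_smul] at h2
  exact pos_of_mul_pos_right h2 (sq_nonneg _)

/-- The energy is affine in the weight `ψ` of the multiplier `∂_t`. -/
theorem energy_eq_interpolate (c : CoeffValue n) (z : State n) :
    energy c z = (1 - c.2.2.2) * (z.1 ^ 2 / 2 + normalEnergy c z)
      + c.2.2.2 * energy (c.1, c.2.1, c.2.2.1, 1) z := by
  simp only [energy, normalEnergy, ellipticPart, shiftDeriv]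
  ring

/-- A radius outside of which the Killing field `∂_t` has positive definite energy, and such that
the ball of this radius contains the obstacle. -/
theorem exists_radius (hg : IsStationaryMetric g) (hS : IsClosedSurface S₀) :
    ∃ r, (∀ x, S₀ x ≤ 0 → ‖x‖ < r) ∧
      ∀ x, r ≤ ‖x‖ → ∀ z, z ≠ 0 → 0 < energy ((waveCoeff g fun _ => 1).val x) z := by
  have h1 := (hg.tendsto_waveCoeff (ψ := fun _ => 1) (Eventually.of_forall fun _ => rfl)).eventually
    (eventually_energy_pos_flatCoeff n)
  rw [← comap_norm_atTop, eventually_comap] at h1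
  obtain ⟨r₁, h1⟩ := eventually_atTop.1 h1
  have hb : Bornology.IsBounded {x | S₀ x ≤ 0} :=
    (hS.isBounded_interior.union hS.isCompact_zero.isBounded).subset fun x hx =>
      (lt_or_eq_of_le (show S₀ x ≤ 0 from hx)).imp id id
  obtain ⟨r₂, h2⟩ := hb.subset_ball (0 : Space n)
  refine ⟨max r₁ r₂, fun x hx => ?_, fun x hx z hz => ?_⟩
  · have : ‖x‖ < r₂ := by simpa using h2 hx
    exact this.trans_le (le_max_right _ _)
  · exact h1 ‖x‖ ((le_max_left _ _).trans hx) x rfl z hz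

/-- The weight of the multiplier `∂_t`: zero in the ball of radius `r`, one far away. -/
def killingWeight (n : ℕ) (r : ℝ) (x : Space n) : ℝ := Real.smoothTransition (‖x‖ ^ 2 - r ^ 2)

theorem contDiff_killingWeight (r : ℝ) : ContDiff ℝ ∞ (killingWeight n r) :=
  Real.smoothTransition.contDiff.comp ((contDiff_norm_sq ℝ).sub contDiff_const)

theorem killingWeight_eq_zero {r : ℝ} {x : Space n} (hx : ‖x‖ ≤ r) : killingWeight n r x = 0 :=
  Real.smoothTransition.zero_of_nonpos (by nlinarith [norm_nonneg x])

theorem killingWeight_eventually_eq_one (r : ℝ) :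
    ∀ᶠ x in Bornology.cobounded (Space n), killingWeight n r x = 1 := by
  rw [← comap_norm_atTop, eventually_comap]
  filter_upwards [eventually_ge_atTop (r ^ 2 + 1)] with s hs x hx
  refine Real.smoothTransition.one_of_one_le ?_
  rw [hx]
  nlinarith [sq_nonneg r]

theorem energy_pos_waveCoeff (hg : IsStationaryMetric g) {r : ℝ}
    (hr : ∀ x, r ≤ ‖x‖ → ∀ z, z ≠ 0 → 0 < energy ((waveCoeff g fun _ => 1).val x) z)
    (x : Space n) {z : State n} (hz : z ≠ 0) :
    0 < energy ((waveCoeff g (killingWeight n r)).val x) z := by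
  have hn : 0 < z.1 ^ 2 / 2 + normalEnergy ((waveCoeff g (killingWeight n r)).val x) z := by
    by_cases h : z.2 = 0
    · have h1 : z.1 ≠ 0 := fun h1 => hz (Prod.ext h1 h)
      have : normalEnergy ((waveCoeff g (killingWeight n r)).val x) z = 0 := by
        simp [normalEnergy, h]
      rw [this]
      positivity
    · have := hg.normalEnergy_pos (killingWeight n r) x h
      positivity
  rw [energy_eq_interpolate]
  change 0 < (1 - killingWeight n r x) * _ + killingWeight n r x * _
  rcases le_total ‖x‖ r with h | h
  · rw [killingWeight_eq_zero h]
    simpa using hn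
  · have h1 : 0 < energy ((waveCoeff g fun _ => 1).val x) z := hr x h z hz
    have h2 : 0 ≤ killingWeight n r x := Real.smoothTransition.nonneg _
    have h3 : killingWeight n r x ≤ 1 := Real.smoothTransition.le_one _
    rcases h2.eq_or_lt with h4 | h4
    · rw [← h4]
      simpa using hn
    · exact add_pos_of_nonneg_of_pos (mul_nonneg (by linarith) hn.le) (mul_pos h4 h1)

/-- The Cauchy–Schwarz inequality for the elliptic part. -/
theorem ellipticPart_sq_le {c : CoeffValue n} (hc : ∀ j k, c.2.2.1 j k = c.2.2.1 k j)
    (hpos : ∀ z : State n, 0 ≤ ∑ j, ellipticPart c z j * z.2.2 j) (s : Fin n → ℝ) (z : State n) :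
    (∑ j, s j * ellipticPart c z j) ^ 2 ≤
      (∑ j, s j * ellipticPart c (0, 0, s) j) * ∑ j, ellipticPart c z j * z.2.2 j := by
  have key : ∀ v w : Fin n → ℝ, Matrix.toBilin' (Matrix.of c.2.2.1) v w =
      ∑ j, v j * ellipticPart c (0, 0, w) j := by
    intro v w
    rw [Matrix.toBilin'_apply']
    simp only [dotProduct, Matrix.mulVec, ellipticPart, Matrix.of_apply]
  have hsym : (Matrix.toBilin' (Matrix.of c.2.2.1)).IsSymm :=
    Matrix.isSymm_toBilin'_iff_isSymm.2 (Matrix.IsSymm.ext fun j k => hc k j)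
  have h := LinearMap.BilinForm.apply_sq_le_of_symm (Matrix.toBilin' (Matrix.of c.2.2.1))
    (fun v => by
      rw [key]
      simpa only [mul_comm] using hpos (0, 0, v)) ⟨fun x y => hsym.eq x y⟩ s z.2.2
  simp only [key] at h
  have e : ∀ j, ellipticPart c (0, 0, z.2.2) j = ellipticPart c z j := fun j => rfl
  simp only [e, mul_comm (z.2.2 _)] at h
  exact h

/-- The algebra of the sign of the flux: `F` is the conormal derivative, `E` and `Es` are the
elliptic form at the gradient and at the normal, and `σ` is the normal component of the shift. -/
theorem flux_algebra {b m E Es F σ D : ℝ} (hb : 0 < b) (hE : 0 ≤ E) (hσ : 0 < σ)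
    (hD : 0 ≤ D) (hcs : F ^ 2 ≤ Es * E) (hd : b * Es ≤ σ ^ 2 + D) :
    -(D / σ * ((b * m ^ 2 + E) / 2)) ≤ b * m * F + σ * ((b * m ^ 2 + E) / 2) := by
  set H := (b * m ^ 2 + E) / 2 with hH
  have hm : 0 ≤ b * m ^ 2 := by positivity
  have hH0 : 0 ≤ H := by positivity
  have hκ : σ ^ 2 + D ≤ (σ + D / σ) ^ 2 := by
    have h1 : σ * (D / σ) = D := mul_div_cancel₀ _ hσ.ne'
    nlinarith [sq_nonneg (D / σ)]
  have h1 : (b * m * F) ^ 2 ≤ ((σ + D / σ) * H) ^ 2 := by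
    calc (b * m * F) ^ 2 = b * (b * m ^ 2) * F ^ 2 := by ring
      _ ≤ b * (b * m ^ 2) * (Es * E) := by gcongr
      _ = (b * m ^ 2 * E) * (b * Es) := by ring
      _ ≤ (b * m ^ 2 * E) * (σ ^ 2 + D) := by gcongr
      _ ≤ H ^ 2 * (σ + D / σ) ^ 2 := by
        have h2 : b * m ^ 2 * E ≤ H ^ 2 := by rw [hH]; nlinarith [sq_nonneg (b * m ^ 2 - E)]
        gcongr
      _ = _ := by ring
  have h2 := (abs_le.1 (abs_le_of_sq_le_sq h1 (by positivity))).1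
  linarith

/-- The surface `S₀ = 0` is characteristic, with the black hole sign: the flux through the nearby
level sets of `S₀` is nonnegative up to `O(S₀)`. -/
theorem flux_nonneg_waveCoeff (hg : IsStationaryMetric g) (hS : IsClosedSurface S₀)
    (hchar : IsCharacteristic g S₀) (hin : IsIngoing g S₀) {r : ℝ}
    (hr : ∀ x, S₀ x ≤ 0 → ‖x‖ < r) {x₀ : Space n} (hx₀ : S₀ x₀ = 0) :
    ∃ C, 0 ≤ C ∧ ∀ᶠ x in 𝓝 x₀, 0 < S₀ x → ∀ z, -(C * S₀ x * ‖z‖ ^ 2) ≤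
      ∑ j, spacePartial S₀ j x * flux ((waveCoeff g (killingWeight n r)).val x) z j := by
  set a := waveCoeff g (killingWeight n r) with ha
  have hsm : a.IsSmooth := hg.isSmooth_waveCoeff (contDiff_killingWeight r)
  set s : Fin n → Space n → ℝ := spacePartial S₀ with hs
  have hsC : ∀ j, ContDiff ℝ ∞ (s j) := fun j => contDiff_spacePartial hS.smooth j
  set σ : Space n → ℝ := fun x => ∑ j, s j x * a.N j x with hσ
  have hσC : ContDiff ℝ ∞ σ := ContDiff.sum fun j _ => (hsC j).mul (hsm.N j)
  -- `d` equals `-g^{jk} s_j s_k / g^{00}`, which vanishes on the surface as it is characteristic,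
  -- while `σ` is positive there by the ingoing condition
  set d : Space n → ℝ := fun x => a.b x * (∑ j, s j x * ellipticPart (a.val x) (0, 0, fun k => s k x) j)
    - σ x ^ 2 with hd
  have hdC : ContDiff ℝ ∞ d := (hsm.b.mul (ContDiff.sum fun j _ => (hsC j).mul
    (ContDiff.sum fun k _ => (hsm.e j k).mul (hsC k)))).sub (hσC.pow 2)
  have hdeq : ∀ x, d x = -(∑ j : Fin n, ∑ k : Fin n, g x j.succ k.succ * s j x * s k x) / g x 0 0 := by
    intro x
    have hv := (hg.volDensity_pos x).ne'
    have h0 := (hg.time_pos x).ne'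
    set q := ∑ j : Fin n, s j x * g x j.succ 0 with hq
    have e1 : σ x = -(q / g x 0 0) := by
      simp only [hσ, ha, waveCoeff, hq, Finset.sum_div, ← Finset.sum_neg_distrib]
      exact Finset.sum_congr rfl fun j _ => by ring
    have e2 : ∑ j, s j x * ellipticPart (a.val x) (0, 0, fun k => s k x) j =
        volDensity g x * (q * q / g x 0 0
          - ∑ j : Fin n, ∑ k : Fin n, g x j.succ k.succ * s j x * s k x) := by
      have e3 : q * q / g x 0 0 = ∑ j : Fin n, ∑ k : Fin n,
          s j x * g x j.succ 0 * (s k x * g x k.succ 0) / g x 0 0 := by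
        rw [hq, Finset.sum_mul_sum, Finset.sum_div]
        exact Finset.sum_congr rfl fun j _ => Finset.sum_div _ _ _
      rw [e3, ← Finset.sum_sub_distrib, Finset.mul_sum]
      refine Finset.sum_congr rfl fun j _ => ?_
      rw [ha, IsStationaryMetric.ellipticPart_waveCoeff, ← Finset.sum_sub_distrib, Finset.mul_sum,
        Finset.mul_sum, Finset.mul_sum]
      refine Finset.sum_congr rfl fun k _ => ?_
      rw [hg.symm x k.succ 0]
      ring
    simp only [hd]
    rw [e1, e2]
    simp only [ha, waveCoeff]
    field_simp
    ring
  obtain ⟨C₁, hC₁, h₁⟩ := exists_abs_le_mul_of_eq_zero (hS.smooth.of_le (by norm_cast))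
    (hdC.of_le (by norm_cast)) (fun x hx => by
      have := hchar x hx
      rw [hdeq, hs, this, neg_zero, zero_div]) hx₀ (hS.normal_ne_zero x₀ hx₀)
  obtain ⟨C₂, hC₂, h₂⟩ := exists_abs_le_of_homogeneous (isCompact_closedBall x₀ 1)
    (f := fun x (z : State n) => normalEnergy (a.val x) z)
    (continuous_normalEnergy (hsm.continuous_val.comp continuous_fst) continuous_snd)
    (fun x s z => normalEnergy_smul _ _ _)
  have hσ0 : 0 < σ x₀ := by
    have e1 : σ x₀ = -(∑ j : Fin n, g x₀ j.succ 0 * spacePartial S₀ j x₀) / g x₀ 0 0 := by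
      simp only [hσ, ha, waveCoeff, ← Finset.sum_neg_distrib, Finset.sum_div]
      exact Finset.sum_congr rfl fun j _ => by ring
    rw [e1]
    exact div_pos (neg_pos.2 (hin x₀ hx₀)) (hg.time_pos x₀)
  refine ⟨C₁ / (σ x₀ / 2) * C₂, by positivity, ?_⟩
  have hball : ∀ᶠ x in 𝓝 x₀, ‖x‖ < r :=
    continuous_norm.continuousAt.eventually_lt_const (hr x₀ hx₀.le)
  filter_upwards [h₁, Metric.closedBall_mem_nhds x₀ one_pos, hball,
    hσC.continuous.continuousAt.eventually_const_lt (half_lt_self hσ0)] with x hx1 hx2 hx3 hx4 hSx z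
  have hψ : killingWeight n r x = 0 := killingWeight_eq_zero hx3.le
  have hE : ∀ z : State n, 0 ≤ ∑ j, ellipticPart (a.val x) z j * z.2.2 j :=
    hg.ellipticPart_nonneg _ x
  have hσx : 0 < σ x := (half_pos hσ0).trans hx4
  have hflux : ∑ j, s j x * flux (a.val x) z j =
      a.b x * z.2.1 * (∑ j, s j x * ellipticPart (a.val x) z j)
        + σ x * normalEnergy (a.val x) z := by
    have e1 : ∀ j, s j x * flux (a.val x) z j = a.b x * z.2.1 * (s j x * ellipticPart (a.val x) z j)
        + s j x * a.N j x * normalEnergy (a.val x) z := by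
      intro j
      have e2 : (a.val x).2.2.2 = 0 := hψ
      rw [flux, e2, normalFlux]
      simp only [WaveCoeff.val]
      ring
    rw [Finset.sum_congr rfl fun j _ => e1 j, Finset.sum_add_distrib, ← Finset.mul_sum,
      ← Finset.sum_mul]
  have halg := flux_algebra (m := z.2.1) (D := C₁ * S₀ x) (hg.b_pos (killingWeight n r) x) (hE z) hσx
    (by positivity) (ellipticPart_sq_le (c := a.val x) (fun j k => hsm.symm j k x) hE
      (fun j => s j x) z) (by
        have := (abs_le.1 (hx1 hSx)).2
        simp only [hd] at this
        change a.b x * _ ≤ _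
        linarith)
  rw [hflux]
  refine le_trans ?_ halg
  have hH : normalEnergy (a.val x) z ≤ C₂ * ‖z‖ ^ 2 := (le_abs_self _).trans (h₂ x hx2 z)
  have hH0 : 0 ≤ normalEnergy (a.val x) z :=
    div_nonneg (add_nonneg (mul_nonneg (hg.b_pos _ x).le (sq_nonneg _)) (hE z)) two_pos.le
  change _ ≤ -(C₁ * S₀ x / σ x * normalEnergy (a.val x) z)
  rw [neg_le_neg_iff]
  calc C₁ * S₀ x / σ x * normalEnergy (a.val x) z
      ≤ C₁ * S₀ x / (σ x₀ / 2) * (C₂ * ‖z‖ ^ 2) := by gcongr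
    _ = _ := by ring

theorem exists_isAdmissible (hg : IsStationaryMetric g) (hS : IsClosedSurface S₀)
    (hchar : IsCharacteristic g S₀) (hin : IsIngoing g S₀) :
    ∃ ψ, (waveCoeff g ψ).IsAdmissible S₀ := by
  obtain ⟨r, h1, h2⟩ := exists_radius hg hS
  exact ⟨killingWeight n r,
    { hg.isSmooth_waveCoeff (contDiff_killingWeight r) with
      tendsto := hg.tendsto_waveCoeff (killingWeight_eventually_eq_one r)
      ψ_eq_one := killingWeight_eventually_eq_one r
      energy_pos := fun x z hz => energy_pos_waveCoeff hg h2 x hz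
      flux_nonneg := fun x₀ hx₀ => flux_nonneg_waveCoeff hg hS hchar hin h1 hx₀ }⟩

end Coefficients

/-! ### From the wave equation to the first order system -/

section FirstOrder

variable {n : ℕ} {g : Space n → Matrix (Fin (n + 1)) (Fin (n + 1)) ℝ}

theorem ContinuousL2Loc.component {I : Set ℝ} {w : ℝ → Space n → Space n}
    (hw : ContinuousL2Loc I w) (j : Fin n) : ContinuousL2Loc I fun t x => w t x j where
  memLp t ht R := by
    refine (hw.memLp t ht R).of_le ?_ (ae_of_all _ fun x => PiLp.norm_apply_le (w t x) j)
    exact (EuclideanSpace.proj (𝕜 := ℝ) j).continuous.comp_aestronglyMeasurable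
      (hw.memLp t ht R).aestronglyMeasurable
  tendsto t ht R := tendsto_of_tendsto_of_tendsto_of_le_of_le tendsto_const_nhds
    (hw.tendsto t ht R) (fun _ => zero_le)
      fun s => eLpNorm_mono fun x => PiLp.norm_apply_le (w s x - w t x) j

theorem integral_mul_eq_conv (v φ : Space n → ℝ) :
    ∫ x, v x * φ x = conv v (fun z => φ (0 - z)) 0 := by
  simp [conv_apply]

theorem integrable_mul_test {v φ : Space n → ℝ} (hv : MemL2Loc v) (hφ : Continuous φ)
    (hc : HasCompactSupport φ) : Integrable fun x => v x * φ x := by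
  have h := integrable_conv_integrand hv.locallyIntegrable (φ := fun z => φ (0 - z))
    (hφ.comp (continuous_const.sub continuous_id)) (hasCompactSupport_comp_sub_left hc 0) 0
  simpa using h

theorem ContinuousL2Loc.continuousOn_integral_mul {I : Set ℝ} {f : ℝ → Space n → ℝ}
    (hf : ContinuousL2Loc I f) {φ : Space n → ℝ} (hφ : ContDiff ℝ ∞ φ)
    (hc : HasCompactSupport φ) : ContinuousOn (fun t => ∫ x, f t x * φ x) I := by
  simp only [integral_mul_eq_conv]
  have h1 := hf.continuousOn_conv (φ := fun z => φ (0 - z))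
    (hφ.comp (contDiff_const.sub contDiff_id)) (hasCompactSupport_comp_sub_left hc 0)
  have h2 : ContinuousOn (fun t : ℝ => ((t, 0) : ℝ × Space n)) I :=
    (continuous_id.prodMk continuous_const).continuousOn
  exact h1.comp h2 fun t ht => ⟨ht, mem_univ _⟩

/-- The momentum `a^{00} u_t + a^{0k} ∂_k u`, where `a^{jk} = √((-1)ⁿ g) g^{jk}`. -/
def momentum (g : Space n → Matrix (Fin (n + 1)) (Fin (n + 1)) ℝ) (ut : ℝ → Space n → ℝ)
    (Du : ℝ → Space n → Space n) (t : ℝ) (x : Space n) : ℝ :=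
  volDensity g x * g x 0 0 * ut t x + ∑ k : Fin n, volDensity g x * g x 0 k.succ * Du t x k

theorem gradSpacetime_mul {η : ℝ → ℝ} {φ : Space n → ℝ} (hη : ContDiff ℝ ∞ η)
    (hφ : ContDiff ℝ ∞ φ) (t : ℝ) (x : Space n) :
    gradSpacetime (fun q : ℝ × Space n => η q.1 * φ q.2) (t, x) =
      Fin.cons (deriv η t * φ x) fun j => η t * spacePartial φ j x := by
  have h1 : HasFDerivAt (fun q : ℝ × Space n => η q.1) _ (t, x) :=
    ((hη.differentiable (by simp) t).hasDerivAt.hasFDerivAt).comp (t, x) hasFDerivAt_fst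
  have h2 : HasFDerivAt (fun q : ℝ × Space n => φ q.2) _ (t, x) :=
    ((hφ.differentiable (by simp) x).hasFDerivAt).comp (t, x) hasFDerivAt_snd
  have h3 := (h1.mul h2).fderiv
  funext i
  refine Fin.cases ?_ (fun j => ?_) i
  · rw [gradSpacetime]
    simp only [Fin.cons_zero]
    erw [h3]
    simp [mul_comm]
  · rw [gradSpacetime]
    simp only [Fin.cons_succ]
    erw [h3]
    simp [spacePartial]

/-- The vector `N m + e ∇u` is the spatial part of `-a^{jk} ∂_k u`. -/
theorem momentumFlux_waveCoeff (hg : IsStationaryMetric g) (ψ : Space n → ℝ)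
    (u ut : ℝ → Space n → ℝ) (Du : ℝ → Space n → Space n) (t : ℝ) (x : Space n) (j : Fin n) :
    momentumFlux ((waveCoeff g ψ).val x)
      (weakState u (momentum g ut Du) (fun k t x => Du t x k) t x) j =
    -(volDensity g x * g x j.succ 0 * ut t x
      + ∑ k : Fin n, volDensity g x * g x j.succ k.succ * Du t x k) := by
  have h0 := (hg.time_pos x).ne'
  rw [momentumFlux, IsStationaryMetric.ellipticPart_waveCoeff]
  simp only [WaveCoeff.val, waveCoeff, weakState, momentum, sub_mul, Finset.sum_sub_distrib]
  have e1 : ∑ k : Fin n, g x j.succ 0 * g x 0 k.succ / g x 0 0 * Du t x k =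
      g x j.succ 0 / g x 0 0 * ∑ k : Fin n, g x 0 k.succ * Du t x k := by
    rw [Finset.mul_sum]
    exact Finset.sum_congr rfl fun k _ => by ring
  simp only [mul_assoc, ← Finset.mul_sum] at e1 ⊢
  rw [e1]
  field_simp
  ring

theorem velocity_waveCoeff (hg : IsStationaryMetric g) (ψ : Space n → ℝ)
    (u ut : ℝ → Space n → ℝ) (Du : ℝ → Space n → Space n) (t : ℝ) (x : Space n) :
    velocity ((waveCoeff g ψ).val x)
      (weakState u (momentum g ut Du) (fun k t x => Du t x k) t x) = ut t x := by
  have h0 := (hg.time_pos x).ne'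
  have hv := (hg.volDensity_pos x).ne'
  have e1 : ∑ k : Fin n, -(g x k.succ 0 / g x 0 0) * Du t x k =
      -(∑ k : Fin n, g x 0 k.succ * Du t x k) / g x 0 0 := by
    rw [← Finset.sum_neg_distrib, Finset.sum_div]
    exact Finset.sum_congr rfl fun k _ => by rw [hg.symm x k.succ 0]; ring
  simp only [velocity, shiftDeriv, WaveCoeff.val, waveCoeff, weakState, momentum, mul_assoc,
    ← Finset.mul_sum]
  rw [e1]
  field_simp
  ring

theorem HasWeakGradient.integral_mul_spacePartial {v : Space n → ℝ} {w : Space n → Space n}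
    (h : HasWeakGradient univ v w) {φ : Space n → ℝ} (hφ : ContDiff ℝ ∞ φ)
    (hc : HasCompactSupport φ) (j : Fin n) :
    ∫ x, v x * spacePartial φ j x = -∫ x, w x j * φ x := by
  simpa using h.integral_eq φ hφ hc (subset_univ _) j

variable {t₀ T : ℝ} {u ut : ℝ → Space n → ℝ} {Du : ℝ → Space n → Space n}

theorem continuousL2Loc_momentum (hg : IsStationaryMetric g) {I : Set ℝ}
    (hut : ContinuousL2Loc I ut) (hDu : ContinuousL2Loc I Du) :
    ContinuousL2Loc I (momentum g ut Du) := by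
  have hv := hg.contDiff_volDensity.continuous
  exact (hut.continuous_mul (hv.mul (hg.smooth 0 0).continuous)).add
    (ContinuousL2Loc.sum (s := Finset.univ) fun k _ =>
      (hDu.component k).continuous_mul (hv.mul (hg.smooth 0 k.succ).continuous))

/-- A distributional solution of the wave equation is a weak solution of the first order system.
Testing with products `η(t) φ(x)` gives the weak time derivative of `∫ m φ`. -/
theorem isWeakSystem_of_isSolution (hg : IsStationaryMetric g) {ψ : Space n → ℝ}
    (hψ : ContDiff ℝ ∞ ψ)
    (hgrad : ∀ t ∈ Icc t₀ T, HasWeakGradient univ (u t) (Du t))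
    (hu : ContinuousL2Loc (Icc t₀ T) u) (hDu : ContinuousL2Loc (Icc t₀ T) Du)
    (hut : ContinuousL2Loc (Icc t₀ T) ut) (hd : HasDerivL2Loc (Icc t₀ T) u ut)
    (heq : ∀ φ : ℝ × Space n → ℝ, ContDiff ℝ ∞ φ → HasCompactSupport φ →
      tsupport φ ⊆ Ioo t₀ T ×ˢ univ →
      ∫ t in Ioo t₀ T, ∫ x, ∑ j : Fin (n + 1), ∑ k : Fin (n + 1),
        volDensity g x * g x j k * (Fin.cons (ut t x) (fun i => Du t x i) : Fin (n + 1) → ℝ) k *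
          gradSpacetime φ (t, x) j = 0) :
    IsWeakSystem (waveCoeff g ψ) t₀ T u (momentum g ut Du) ut (fun k t x => Du t x k) := by
  have hm := continuousL2Loc_momentum hg hut hDu
  set F : Fin n → ℝ → Space n → ℝ := fun j t x => momentumFlux ((waveCoeff g ψ).val x)
      (weakState u (momentum g ut Du) (fun k t x => Du t x k) t x) j with hF
  have hsm := hg.isSmooth_waveCoeff hψ
  have hFc : ∀ j, ContinuousL2Loc (Icc t₀ T) (F j) := fun j =>
    (hm.continuous_mul (hsm.N j).continuous).add
      (ContinuousL2Loc.sum (s := Finset.univ) fun k _ =>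
        (hDu.component k).continuous_mul (hsm.e j k).continuous)
  refine ⟨hu, hm, hut, fun k => hDu.component k, hd,
    fun t ht φ hφ hc j => (hgrad t ht).integral_mul_spacePartial hφ hc j,
    fun t ht x => (velocity_waveCoeff hg ψ u ut Du t x).symm, fun t ht φ hφ hc => ?_⟩
  refine hasDerivAt_of_weak_deriv (A := fun s => -∑ j, ∫ x, F j s x * spacePartial φ j x)
    (hm.continuousOn_integral_mul hφ hc)
    (continuousOn_finsetSum _ fun j _ => (hFc j).continuousOn_integral_mul
      (contDiff_spacePartial hφ j) (hasCompactSupport_spacePartial hc j)).neg ?_ ht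
  intro η hη hcη hsη
  have hts : tsupport (fun q : ℝ × Space n => η q.1 * φ q.2) ⊆ tsupport η ×ˢ tsupport φ := by
    refine closure_minimal (fun q hq => ?_) ((isClosed_tsupport η).prod (isClosed_tsupport φ))
    have hq' := mul_ne_zero_iff.1 hq
    exact ⟨subset_tsupport η hq'.1, subset_tsupport φ hq'.2⟩
  have h := heq (fun q => η q.1 * φ q.2) ((hη.comp contDiff_fst).mul (hφ.comp contDiff_snd))
    (HasCompactSupport.of_support_subset_isCompact (hcη.prod hc)
      ((subset_tsupport _).trans hts)) (hts.trans (prod_mono hsη (subset_univ _)))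
  rw [← h]
  refine setIntegral_congr_fun measurableSet_Ioo fun s hs => ?_
  have hs' : s ∈ Icc t₀ T := Ioo_subset_Icc_self hs
  have hpoint : ∀ x, ∑ j : Fin (n + 1), ∑ k : Fin (n + 1),
      volDensity g x * g x j k * (Fin.cons (ut s x) (fun i => Du s x i) : Fin (n + 1) → ℝ) k *
          gradSpacetime (fun q : ℝ × Space n => η q.1 * φ q.2) (s, x) j =
      deriv η s * (momentum g ut Du s x * φ x) - η s * ∑ j, F j s x * spacePartial φ j x := by
    intro x
    have e1 : ∑ j, F j s x * spacePartial φ j x = -∑ j : Fin n,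
        (volDensity g x * g x j.succ 0 * ut s x
          + ∑ k : Fin n, volDensity g x * g x j.succ k.succ * Du s x k) * spacePartial φ j x := by
      rw [← Finset.sum_neg_distrib]
      exact Finset.sum_congr rfl fun j _ => by
        rw [hF]; simp only [momentumFlux_waveCoeff hg]; ring
    rw [gradSpacetime_mul hη hφ, e1]
    simp only [Fin.sum_univ_succ, Fin.cons_zero, Fin.cons_succ, momentum, ← Finset.sum_mul]
    rw [mul_neg, sub_neg_eq_add, Finset.mul_sum]
    congr 1
    · ring
    · exact Finset.sum_congr rfl fun j _ => by ring
  simp only [hpoint]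
  have hi1 : Integrable fun x => momentum g ut Du s x * φ x :=
    integrable_mul_test (hm.memL2Loc hs') hφ.continuous hc
  have hi2 : ∀ j ∈ Finset.univ, Integrable fun x => F j s x * spacePartial φ j x := fun j _ =>
    integrable_mul_test ((hFc j).memL2Loc hs') (contDiff_spacePartial hφ j).continuous
      (hasCompactSupport_spacePartial hc j)
  rw [integral_sub (hi1.const_mul _) ((integrable_finsetSum _ hi2).const_mul _),
    integral_const_mul, integral_const_mul, integral_finsetSum _ hi2]
  ring

end FirstOrder

/-! ### Sobolev norms and the first order state -/

section SobolevNorms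

variable {n : ℕ} {Ω : Set (Space n)}

theorem locallyIntegrableOn_component {w : Space n → Space n} (hw : LocallyIntegrableOn w Ω)
    (j : Fin n) : LocallyIntegrableOn (fun x => w x j) Ω := fun x hx => by
  obtain ⟨s, hs, hi⟩ := hw x hx
  exact ⟨s, hs, (EuclideanSpace.proj (𝕜 := ℝ) j).integrable_comp hi⟩

theorem integrableOn_mul_test {v φ : Space n → ℝ} (hv : LocallyIntegrableOn v Ω)
    (hφ : Continuous φ) (hc : HasCompactSupport φ) (hsub : tsupport φ ⊆ Ω) :
    Integrable fun x => v x * φ x := by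
  have h1 : IntegrableOn (fun x => v x * φ x) (tsupport φ) :=
    (hv.integrableOn_compact_subset hsub hc).mul_continuousOn hφ.continuousOn hc
  have h2 := h1.integrable_of_forall_notMem_eq_zero fun x hx => by
    rw [image_eq_zero_of_notMem_tsupport hx, mul_zero]
  exact h2

theorem setIntegral_mul_eq_integral {v φ : Space n → ℝ} (hsub : tsupport φ ⊆ Ω) :
    ∫ x in Ω, v x * φ x = ∫ x, v x * φ x :=
  setIntegral_eq_integral_of_forall_compl_eq_zero fun x hx => by
    rw [image_eq_zero_of_notMem_tsupport fun h => hx (hsub h), mul_zero]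

theorem tsupport_spacePartial_subset (φ : Space n → ℝ) (j : Fin n) :
    tsupport (spacePartial φ j) ⊆ tsupport φ := by
  refine closure_minimal (fun x hx => ?_) (isClosed_tsupport φ)
  refine support_fderiv_subset ℝ fun h0 => hx ?_
  rw [spacePartial, h0]
  rfl

theorem HasWeakGradient.restrict {v : Space n → ℝ} {w : Space n → Space n}
    (h : HasWeakGradient univ v w) (Ω : Set (Space n)) : HasWeakGradient Ω v w where
  locallyIntegrable := h.locallyIntegrable.mono_set (subset_univ _)
  locallyIntegrable_grad := h.locallyIntegrable_grad.mono_set (subset_univ _)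
  integral_eq φ hφ hc hsub j := by
    rw [setIntegral_mul_eq_integral ((tsupport_spacePartial_subset φ j).trans hsub),
      setIntegral_mul_eq_integral hsub]
    exact h.integral_mul_spacePartial hφ hc j

/-- The weak gradient on an open set is unique almost everywhere. -/
theorem HasWeakGradient.ae_eq (hΩ : IsOpen Ω) {v : Space n → ℝ} {w w' : Space n → Space n}
    (h : HasWeakGradient Ω v w) (h' : HasWeakGradient Ω v w') :
    w =ᵐ[volume.restrict Ω] w' := by
  have hj : ∀ j : Fin n, ∀ᵐ x, x ∈ Ω → w x j - w' x j = 0 := by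
    intro j
    have hw := locallyIntegrableOn_component h.locallyIntegrable_grad j
    have hw' := locallyIntegrableOn_component h'.locallyIntegrable_grad j
    refine hΩ.ae_eq_zero_of_integral_contDiff_smul_eq_zero (hw.sub hw') fun φ hφ hc hsub => ?_
    have e1 := h.integral_eq φ hφ hc hsub j
    rw [h'.integral_eq φ hφ hc hsub j, neg_inj, setIntegral_mul_eq_integral hsub,
      setIntegral_mul_eq_integral hsub] at e1
    have e2 : ∀ x, φ x • (w x j - w' x j) = w x j * φ x - w' x j * φ x := fun x => by
      rw [smul_eq_mul]; ring
    simp only [e2]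
    rw [integral_sub (integrableOn_mul_test hw hφ.continuous hc hsub)
      (integrableOn_mul_test hw' hφ.continuous hc hsub), e1, sub_self]
  rw [Filter.EventuallyEq, ae_restrict_iff' hΩ.measurableSet]
  filter_upwards [ae_all_iff.2 hj] with x hx hxΩ
  ext j
  exact sub_eq_zero.1 (hx j hxΩ)

theorem normSqH1_eq (hΩ : IsOpen Ω) {v : Space n → ℝ} {w : Space n → Space n}
    (h : HasWeakGradient Ω v w) : normSqH1 Ω v = normSqL2 Ω v + normSqL2 Ω w := by
  refine le_antisymm (iInf₂_le w h) (le_iInf₂ fun w' h' => ?_)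
  rw [normSqL2, normSqL2, normSqL2, eLpNorm_congr_ae (h.ae_eq hΩ h')]

theorem isOpen_exterior {S₀ : Space n → ℝ} (hS : Continuous S₀) : IsOpen (exterior S₀) :=
  isOpen_lt continuous_const hS

/-- The square of the norm of `(u, u_t, ∇u)` as a quadratic form in the state `(u, m, ∇u)`. -/
def velocityForm (c : CoeffValue n) (z : State n) : ℝ :=
  z.1 ^ 2 + ∑ j, z.2.2 j ^ 2 + velocity c z ^ 2

theorem continuous_velocityForm :
    Continuous (Function.uncurry (velocityForm : CoeffValue n → State n → ℝ)) := by
  have := continuous_velocity (continuous_fst (X := CoeffValue n) (Y := State n)) continuous_snd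
  unfold velocityForm Function.uncurry
  fun_prop

theorem velocityForm_smul (c : CoeffValue n) (s : ℝ) (z : State n) :
    velocityForm c (s • z) = s ^ 2 * velocityForm c z := by
  simp only [velocityForm, velocity_smul, Prod.smul_fst, Prod.smul_snd, Pi.smul_apply, smul_eq_mul,
    mul_pow, ← Finset.mul_sum]
  ring

theorem velocityForm_pos {c : CoeffValue n} (hb : 0 < c.1) {z : State n} (hz : z ≠ 0) :
    0 < velocityForm c z := by
  have h0 : 0 ≤ ∑ j, z.2.2 j ^ 2 := Finset.sum_nonneg fun _ _ => sq_nonneg _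
  refine lt_of_le_of_ne (by unfold velocityForm; positivity) fun h1 => hz ?_
  unfold velocityForm at h1
  have e1 : z.1 = 0 := by nlinarith [sq_nonneg z.1, sq_nonneg (velocity c z)]
  have e2 : velocity c z = 0 := by nlinarith [sq_nonneg z.1, sq_nonneg (velocity c z)]
  have e3 : ∑ j, z.2.2 j ^ 2 = 0 := by nlinarith [sq_nonneg z.1, sq_nonneg (velocity c z)]
  have e4 : z.2.2 = 0 := by
    funext j
    have := (Finset.sum_eq_zero_iff_of_nonneg fun _ _ => sq_nonneg _).1 e3 j (Finset.mem_univ j)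
    simpa using this
  have e5 : z.2.1 = 0 := by
    simpa [velocity, shiftDeriv, e4, hb.ne'] using e2
  ext <;> simp [e1, e4, e5]

/-- The two ways to measure the state are equivalent, uniformly on the whole space, since the
limit of `b` at infinity is not zero. -/
theorem WaveCoeff.IsAdmissible.exists_velocityForm_bounds {a : WaveCoeff n} {S₀ : Space n → ℝ}
    (ha : a.IsAdmissible S₀) (hb : ∀ x, 0 < a.b x) :
    ∃ c C : ℝ, 0 < c ∧ 0 ≤ C ∧ ∀ x z, c * ‖z‖ ^ 2 ≤ velocityForm (a.val x) z ∧
      velocityForm (a.val x) z ≤ C * ‖z‖ ^ 2 := by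
  obtain ⟨c, hc, h1⟩ := exists_le_of_homogeneous ha.isCompact_values continuous_velocityForm
    velocityForm_smul (by
      rintro _ (rfl | ⟨y, rfl⟩) z hz
      · exact velocityForm_pos one_pos hz
      · exact velocityForm_pos (hb y) hz)
  obtain ⟨C, hC, h2⟩ := exists_abs_le_of_homogeneous ha.isCompact_values continuous_velocityForm
    velocityForm_smul
  exact ⟨c, C, hc, hC, fun x z => ⟨h1 _ (Or.inr ⟨x, rfl⟩) z,
    (le_abs_self _).trans (h2 _ (Or.inr ⟨x, rfl⟩) z)⟩⟩

variable {g : Space n → Matrix (Fin (n + 1)) (Fin (n + 1)) ℝ}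

theorem normSqL2_add_eq_lintegral (hg : IsStationaryMetric g) (ψ : Space n → ℝ)
    {u ut : ℝ → Space n → ℝ} {Du : ℝ → Space n → Space n} {t : ℝ}
    (hu : AEStronglyMeasurable (u t)) (hDu : AEStronglyMeasurable (Du t)) :
    normSqL2 Ω (u t) + normSqL2 Ω (Du t) + normSqL2 Ω (ut t) =
      ∫⁻ x in Ω, ENNReal.ofReal (velocityForm ((waveCoeff g ψ).val x)
        (weakState u (momentum g ut Du) (fun k t x => Du t x k) t x)) := by
  have hm : AEMeasurable (fun x => ‖u t x‖ₑ ^ 2 + ‖Du t x‖ₑ ^ 2) (volume.restrict Ω) :=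
    (hu.restrict.enorm.pow_const 2).add (hDu.restrict.enorm.pow_const 2)
  rw [normSqL2, normSqL2, normSqL2, eLpNorm_two_sq, eLpNorm_two_sq, eLpNorm_two_sq,
    ← lintegral_add_left' (hu.restrict.enorm.pow_const 2), ← lintegral_add_left' hm]
  refine lintegral_congr fun x => ?_
  have e : ∀ {F : Type} [NormedAddCommGroup F] (y : F), ‖y‖ₑ ^ 2 = ENNReal.ofReal (‖y‖ ^ 2) :=
    fun y => by rw [ENNReal.ofReal_pow (norm_nonneg _), ofReal_norm]
  rw [velocityForm, velocity_waveCoeff hg, e, e, e, ← ENNReal.ofReal_add (by positivity)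
    (by positivity), ← ENNReal.ofReal_add (by positivity) (by positivity), EuclideanSpace.norm_sq_eq]
  simp [weakState]

/-- The energy estimate for solutions of the wave equation. The norms of `(u, u_t, ∇u)` are
uniformly equivalent to that of the state of the first order system. -/
theorem exists_energy_bound {S₀ : Space n → ℝ} (hg : IsStationaryMetric g)
    (hS : IsClosedSurface S₀) (hchar : IsCharacteristic g S₀) (hin : IsIngoing g S₀) (t₀ T : ℝ) :
    ∃ C : ℝ≥0, ∀ u ut : ℝ → Space n → ℝ, IsSolution g t₀ T u ut → ∀ t ∈ Icc t₀ T,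
      normSqH1 (exterior S₀) (u t) + normSqL2 (exterior S₀) (ut t) ≤
        C * (normSqH1 (exterior S₀) (u t₀) + normSqL2 (exterior S₀) (ut t₀)) := by
  obtain ⟨ψ, ha⟩ := exists_isAdmissible hg hS hchar hin
  obtain ⟨c, C, hc, hC, hb⟩ := ha.exists_velocityForm_bounds (hg.b_pos ψ)
  obtain ⟨K, hK⟩ := ha.weak_energy_estimate hS.smooth t₀ T
  refine ⟨C.toNNReal * K * c⁻¹.toNNReal, fun u ut ⟨Du, hgrad, hu, hDu, hut, hd, heq⟩ t ht => ?_⟩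
  have hΩ := isOpen_exterior hS.smooth.continuous
  have hsys := isWeakSystem_of_isSolution hg ha.ψ hgrad hu hDu hut hd heq
  have ht₀ : t₀ ∈ Icc t₀ T := ⟨le_rfl, ht.1.trans ht.2⟩
  have hE : ∀ s ∈ Icc t₀ T, normSqH1 (exterior S₀) (u s) + normSqL2 (exterior S₀) (ut s) =
      ∫⁻ x in exterior S₀, ENNReal.ofReal (velocityForm ((waveCoeff g ψ).val x)
        (weakState u (momentum g ut Du) (fun k t x => Du t x k) s x)) := fun s hs => by
    rw [normSqH1_eq hΩ ((hgrad s hs).restrict _), normSqL2_add_eq_lintegral hg ψ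
      (hu.memL2Loc hs).aestronglyMeasurable
      (locallyIntegrableOn_univ.1 (hgrad s hs).locallyIntegrable_grad).aestronglyMeasurable]
  have e : ∀ (r : ℝ) (z : State n), 0 ≤ r →
      ENNReal.ofReal (r * ‖z‖ ^ 2) = r.toNNReal * ‖z‖ₑ ^ 2 := fun r z hr => by
    rw [ENNReal.ofReal_mul hr, ENNReal.ofReal_pow (norm_nonneg _), ofReal_norm]
    rfl
  have h1 := hK u _ ut _ hsys t ht
  have hup : ∫⁻ x in exterior S₀, ENNReal.ofReal (velocityForm ((waveCoeff g ψ).val x)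
        (weakState u (momentum g ut Du) (fun k t x => Du t x k) t x)) ≤
      C.toNNReal * eLpNorm (weakState u (momentum g ut Du) (fun k t x => Du t x k) t) 2
        (volume.restrict (exterior S₀)) ^ 2 := by
    rw [eLpNorm_two_sq, ← lintegral_const_mul' _ _ ENNReal.coe_ne_top]
    refine lintegral_mono fun x => ?_
    rw [← e _ _ hC]
    exact ENNReal.ofReal_le_ofReal (hb x _).2
  have hlow : eLpNorm (weakState u (momentum g ut Du) (fun k t x => Du t x k) t₀) 2
        (volume.restrict (exterior S₀)) ^ 2 ≤
      c⁻¹.toNNReal * ∫⁻ x in exterior S₀, ENNReal.ofReal (velocityForm ((waveCoeff g ψ).val x)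
        (weakState u (momentum g ut Du) (fun k t x => Du t x k) t₀ x)) := by
    rw [eLpNorm_two_sq, ← lintegral_const_mul' _ _ ENNReal.coe_ne_top]
    refine lintegral_mono fun x => ?_
    have h2 := (hb x (weakState u (momentum g ut Du) (fun k t x => Du t x k) t₀ x)).1
    calc _ = ENNReal.ofReal (1 * ‖weakState u (momentum g ut Du) (fun k t x => Du t x k) t₀ x‖ ^ 2) := by
          rw [e _ _ zero_le_one]; simp
      _ ≤ ENNReal.ofReal (c⁻¹ * velocityForm ((waveCoeff g ψ).val x)
            (weakState u (momentum g ut Du) (fun k t x => Du t x k) t₀ x)) := by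
          refine ENNReal.ofReal_le_ofReal ?_
          rw [one_mul, ← div_eq_inv_mul, le_div_iff₀ hc, mul_comm]
          exact h2
      _ = _ := by rw [ENNReal.ofReal_mul (inv_nonneg.2 hc.le)]; rfl
  rw [hE t ht, hE t₀ ht₀]
  refine hup.trans ((mul_le_mul_right h1 _).trans ?_)
  push_cast
  rw [← mul_assoc, mul_assoc (_ * _) (_ : ℝ≥0∞)]
  gcongr

theorem normSqH1_eq_zero {v : Space n → ℝ} (hv : LocallyIntegrableOn v Ω)
    (h : v =ᵐ[volume.restrict Ω] 0) : normSqH1 Ω v = 0 := by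
  have hw : HasWeakGradient Ω v 0 := by
    refine ⟨hv, (locallyIntegrable_zero).locallyIntegrableOn _, fun φ _ _ _ j => ?_⟩
    have e : (fun x => v x * spacePartial φ j x) =ᵐ[volume.restrict Ω] fun _ => 0 := by
      filter_upwards [h] with x hx
      rw [hx, Pi.zero_apply, zero_mul]
    rw [integral_congr_ae e]
    simp
  refine le_antisymm ((iInf₂_le (0 : Space n → Space n) hw).trans ?_) zero_le
  rw [normSqL2, normSqL2, eLpNorm_congr_ae h]
  simp

end SobolevNorms

end ArtificialBlackHole

end

theorem theorem2p3 (n : ℕ) (hn : 1 ≤ n)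
    (g : ArtificialBlackHole.Space n → Matrix (Fin (n + 1)) (Fin (n + 1)) ℝ)
    (hg : ArtificialBlackHole.IsStationaryMetric g)
    (S₀ : ArtificialBlackHole.Space n → ℝ)
    (hS : ArtificialBlackHole.IsClosedSurface S₀)
    (hchar : ArtificialBlackHole.IsCharacteristic g S₀)
    (hin : ArtificialBlackHole.IsIngoing g S₀) :
    (∀ t₀ T : ℝ, ∃ C : ℝ≥0, ∀ u ut : ℝ → ArtificialBlackHole.Space n → ℝ,
      ArtificialBlackHole.IsSolution g t₀ T u ut →
      ∀ t ∈ Icc t₀ T,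
        ArtificialBlackHole.normSqH1 (ArtificialBlackHole.exterior S₀) (u t) +
            ArtificialBlackHole.normSqL2 (ArtificialBlackHole.exterior S₀) (ut t) ≤
          C * (ArtificialBlackHole.normSqH1 (ArtificialBlackHole.exterior S₀) (u t₀) +
            ArtificialBlackHole.normSqL2 (ArtificialBlackHole.exterior S₀) (ut t₀))) ∧
    (∀ (t₀ T : ℝ) (u ut : ℝ → ArtificialBlackHole.Space n → ℝ),
      ArtificialBlackHole.IsSolution g t₀ T u ut →
      (∀ᵐ x, x ∈ ArtificialBlackHole.exterior S₀ → u t₀ x = 0 ∧ ut t₀ x = 0) →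
      ∀ t ∈ Icc t₀ T,
        ∀ᵐ x, x ∈ ArtificialBlackHole.exterior S₀ → u t x = 0 ∧ ut t x = 0) := by
  refine ⟨ArtificialBlackHole.exists_energy_bound hg hS hchar hin, fun t₀ T u ut hu h0 t ht => ?_⟩
  obtain ⟨C, hC⟩ := ArtificialBlackHole.exists_energy_bound hg hS hchar hin t₀ T
  have hΩ := ArtificialBlackHole.isOpen_exterior hS.smooth.continuous
  have ht₀ : t₀ ∈ Icc t₀ T := ⟨le_rfl, ht.1.trans ht.2⟩
  have hE := hC u ut hu t ht
  obtain ⟨Du, hgrad, hcu, hcDu, hcut, -, -⟩ := hu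
  rw [← ae_restrict_iff' hΩ.measurableSet] at h0 ⊢
  -- zero data make the right hand side of the estimate vanish
  have h1 : ArtificialBlackHole.normSqH1 (ArtificialBlackHole.exterior S₀) (u t₀) = 0 :=
    ArtificialBlackHole.normSqH1_eq_zero
      ((hcu.memL2Loc ht₀).locallyIntegrable.locallyIntegrableOn _) (h0.mono fun x hx => hx.1)
  have h2 : ArtificialBlackHole.normSqL2 (ArtificialBlackHole.exterior S₀) (ut t₀) = 0 := by
    have : ut t₀ =ᵐ[volume.restrict (ArtificialBlackHole.exterior S₀)] 0 :=
      h0.mono fun x hx => hx.2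
    rw [ArtificialBlackHole.normSqL2, eLpNorm_congr_ae this, eLpNorm_zero, zero_pow two_ne_zero]
  rw [h1, h2, add_zero, mul_zero, nonpos_iff_eq_zero, add_eq_zero,
    ArtificialBlackHole.normSqH1_eq hΩ ((hgrad t ht).restrict _), add_eq_zero] at hE
  obtain ⟨⟨h3, -⟩, h4⟩ := hE
  rw [ArtificialBlackHole.normSqL2, pow_eq_zero_iff two_ne_zero, eLpNorm_eq_zero_iff
    ((hcu.memL2Loc ht).aestronglyMeasurable.restrict) two_ne_zero] at h3
  rw [ArtificialBlackHole.normSqL2, pow_eq_zero_iff two_ne_zero, eLpNorm_eq_zero_iff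
    ((hcut.memL2Loc ht).aestronglyMeasurable.restrict) two_ne_zero] at h4
  filter_upwards [h3, h4] with x hx3 hx4 using ⟨hx3, hx4⟩
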